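/- Let $d\ge 1$ and let $a=(a_1,\dots,a_d):\mathbb R^d\to\mathbb R^d$ be a vector potential. Consider the conditions (A1) $a_\mu\in L^2_{\rm loc}(\mathbb R^d)$ for all $\mu$; (A3) $a_\mu\in L^4_{\rm loc}(\mathbb R^d)$ for all $\mu$, and the distributional divergence $\nabla\cdot a$ belongs to $L^2_{\rm loc}(\mathbb R^d)$. Assume (A1) (which is implied by (A3)), and let $h=\frac12(\mathrm p-a)^2$, $\mathrm p=-i\nabla$, be the non-negative self-adjoint operator in $L^2(\mathbb R^d;\mathbb C)$ associated with the closed quadratic form $$q(f,g)=\tfrac12\sum_{\mu=1}^d\big((-i\partial_\mu-a_\mu)f,\,(-i\partial_\mu-a_\mu)g\big),\qquad Q(q)=\{f\in L^2:\ (-i\partial_\mu-a_\mu)f\in L^2,\ \mu=1,\dots,d\},$$ with derivatives in the sense of distributions; that is, $D(h)$ consists of the $f\in Q(q)$ for which there is $w\in L^2$ with $(w,g)=q(f,g)$ for all $g\in Q(q)$, and then $hf=w$. Let $\Psi$ be a Bernstein function with vanishing right limit at the origin: $\Psi\in C^\infty((0,\infty))$, $\Psi\ge 0$, $(-1)^n\Psi^{(n)}\le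 0$ on $(0,\infty)$ for all $n\ge 1$, and $\lim_{u\to0+}\Psi(u)=0$ (put $\Psi(0)=0$). Let $\Psi(h)=\int\Psi\,dE$, where $E$ is the spectral measure of $h$. Then: (1) if (A3) holds, $C_0^\infty(\mathbb R^d)$ is an operator core of $\Psi(h)$, i.e. $C_0^\infty(\mathbb R^d)\subset D(\Psi(h))$ and the closure of the restriction of $\Psi(h)$ to $C_0^\infty(\mathbb R^d)$ is $\Psi(h)$; (2) under (A1), $C_0^\infty(\mathbb R^d)$ is a form core of $\Psi(h)$, i.e. an operator core of $\Psi(h)^{1/2}$. -/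

import Mathlib

open MeasureTheory Filter Topology Set
open scoped ContDiff ENNReal InnerProductSpace

noncomputable section

/-! ### Spectral calculus of unbounded self-adjoint operators -/

/-- A projection-valued (spectral) measure on the Borel sets of `ℝ`, acting on `H`. The values on
sets that are not Borel play no role. -/
structure SpectralMeasure (H : Type*) [NormedAddCommGroup H] [InnerProductSpace ℂ H]
    [CompleteSpace H] where
  /-- the projection attached to a set -/
  proj : Set ℝ → (H →L[ℂ] H)
  isStarProjection : ∀ s, MeasurableSet s → IsStarProjection (proj s)
  proj_univ : proj univ = 1
  proj_inter : ∀ s t, MeasurableSet s → MeasurableSet t → proj (s ∩ t) = proj s * proj t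
  hasSum_proj : ∀ f : ℕ → Set ℝ, (∀ i, MeasurableSet (f i)) → Pairwise (Function.onFun Disjoint f) →
    ∀ x : H, HasSum (fun i => proj (f i) x) (proj (⋃ i, f i) x)

namespace SpectralMeasure

variable {H : Type*} [NormedAddCommGroup H] [InnerProductSpace ℂ H] [CompleteSpace H]

theorem inner_proj (E : SpectralMeasure H) {s : Set ℝ} (hs : MeasurableSet s) (x : H) :
    RCLike.re ⟪x, E.proj s x⟫_ℂ = ‖E.proj s x‖ ^ 2 := by
  have h := E.isStarProjection s hs
  have h1 : E.proj s x = E.proj s (E.proj s x) := by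
    conv_lhs => rw [← h.isIdempotentElem.eq]
    rfl
  have h2 : ContinuousLinearMap.adjoint (E.proj s) = E.proj s := h.isSelfAdjoint
  conv_lhs => rw [h1, ← ContinuousLinearMap.adjoint_inner_left, h2]
  exact inner_self_eq_norm_sq _

theorem proj_empty (E : SpectralMeasure H) : E.proj ∅ = 0 := by
  ext x
  have h := E.hasSum_proj (fun _ => ∅) (fun _ => MeasurableSet.empty)
    (fun i j _ => disjoint_bot_left) x
  have h0 := h.summable.tendsto_atTop_zero
  simpa using tendsto_nhds_unique tendsto_const_nhds h0

/-- The finite Borel measure `s ↦ ⟪x, E(s) x⟫ = ‖E(s) x‖²`. -/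
def scalarMeasure (E : SpectralMeasure H) (x : H) : Measure ℝ :=
  Measure.ofMeasurable (fun s _ => ENNReal.ofReal (‖E.proj s x‖ ^ 2))
    (by simp [E.proj_empty])
    (by
      intro f hf hd
      have h := E.hasSum_proj f hf hd x
      have h1 : HasSum (fun i => RCLike.re ⟪x, E.proj (f i) x⟫_ℂ)
          (RCLike.re ⟪x, E.proj (⋃ i, f i) x⟫_ℂ) :=
        (h.mapL (innerSL ℂ x)).mapL (RCLike.reCLM : ℂ →L[ℝ] ℝ)
      rw [E.inner_proj (MeasurableSet.iUnion hf)] at h1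
      simp only [fun i => E.inner_proj (hf i) x] at h1
      rw [← h1.tsum_eq, ENNReal.ofReal_tsum_of_nonneg (fun _ => by positivity) h1.summable])

theorem scalarMeasure_apply (E : SpectralMeasure H) (x : H) {s : Set ℝ} (hs : MeasurableSet s) :
    E.scalarMeasure x s = ENNReal.ofReal (‖E.proj s x‖ ^ 2) :=
  Measure.ofMeasurable_apply s hs

/-- The vectors `x` with `∫ |φ|² d⟪x, E x⟫ < ∞`. -/
def sqIntegrable (E : SpectralMeasure H) (φ : ℝ → ℝ) : Submodule ℂ H where
  carrier := {x | ∫⁻ t, ‖φ t‖ₑ ^ 2 ∂(E.scalarMeasure x) < ⊤}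
  zero_mem' := by
    have : E.scalarMeasure 0 = 0 := by
      ext s hs
      simp [E.scalarMeasure_apply 0 hs]
    simp [this]
  add_mem' := by
    intro x y hx hy
    have hle : E.scalarMeasure (x + y) ≤
        (2 : ℝ≥0∞) • (E.scalarMeasure x + E.scalarMeasure y) := by
      refine Measure.le_iff.2 fun s hs => ?_
      rw [Measure.smul_apply, Measure.add_apply, E.scalarMeasure_apply _ hs,
        E.scalarMeasure_apply _ hs, E.scalarMeasure_apply _ hs,
        ← ENNReal.ofReal_add (by positivity) (by positivity), smul_eq_mul,
        ← ENNReal.ofReal_ofNat 2, ← ENNReal.ofReal_mul (by norm_num)]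
      refine ENNReal.ofReal_le_ofReal ?_
      rw [map_add]
      nlinarith [norm_add_le (E.proj s x) (E.proj s y), norm_nonneg (E.proj s x + E.proj s y),
        sq_nonneg (‖E.proj s x‖ - ‖E.proj s y‖), norm_nonneg (E.proj s x),
        norm_nonneg (E.proj s y)]
    refine (lintegral_mono' hle le_rfl).trans_lt ?_
    rw [lintegral_smul_measure, lintegral_add_measure]
    exact ENNReal.mul_lt_top ENNReal.ofNat_lt_top (ENNReal.add_lt_top.2 ⟨hx, hy⟩)
  smul_mem' := by
    intro c x hx
    have heq : E.scalarMeasure (c • x) = (ENNReal.ofReal (‖c‖ ^ 2)) • E.scalarMeasure x := by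
      ext s hs
      rw [Measure.smul_apply, E.scalarMeasure_apply _ hs, E.scalarMeasure_apply _ hs, smul_eq_mul,
        ← ENNReal.ofReal_mul (by positivity), map_smul, norm_smul, mul_pow]
    change ∫⁻ t, ‖φ t‖ₑ ^ 2 ∂(E.scalarMeasure (c • x)) < ⊤
    rw [heq, lintegral_smul_measure]
    exact ENNReal.mul_lt_top ENNReal.ofReal_lt_top hx

/-- The integral `∫ s dE = ∑ c, c • E(s = c)` of a simple function. -/
def simpleIntegral (E : SpectralMeasure H) (s : SimpleFunc ℝ ℝ) : H →L[ℂ] H :=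
  ∑ c ∈ s.range, (c : ℂ) • E.proj (s ⁻¹' {c})

/-- The graph of `∫ φ dE`: the vector `x` has to satisfy `∫ |φ|² d⟪x, E x⟫ < ∞`, and `y` is the
limit of `(∫ sₙ dE) x` for simple functions `sₙ` tending to `φ` pointwise with `|sₙ - φ| ≤ |φ|` (so that
`sₙ → φ` in `L²(⟪x, E x⟫)`). For
Borel `φ` such `sₙ` exist, and the limit exists and does not depend on their choice. -/
def integralGraph (E : SpectralMeasure H) (φ : ℝ → ℝ) : Submodule ℂ (H × H) where
  carrier := {p | p.1 ∈ E.sqIntegrable φ ∧ ∀ s : ℕ → SimpleFunc ℝ ℝ,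
    (∀ n t, |s n t - φ t| ≤ |φ t|) → (∀ t, Tendsto (fun n => s n t) atTop (𝓝 (φ t))) →
      Tendsto (fun n => E.simpleIntegral (s n) p.1) atTop (𝓝 p.2)}
  zero_mem' := ⟨Submodule.zero_mem _, fun s _ _ => by simp⟩
  add_mem' := by
    intro p r hp hr
    refine ⟨Submodule.add_mem _ hp.1 hr.1, fun s h1 h2 => ?_⟩
    simpa using (hp.2 s h1 h2).add (hr.2 s h1 h2)
  smul_mem' := by
    intro c p hp
    refine ⟨Submodule.smul_mem _ c hp.1, fun s h1 h2 => ?_⟩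
    simpa using (hp.2 s h1 h2).const_smul c

/-- The (unbounded) operator `∫ φ dE` for a Borel function `φ : ℝ → ℝ`, with domain
`{x | ∫ |φ|² d⟪x, E x⟫ < ∞}`. -/
def integral (E : SpectralMeasure H) (φ : ℝ → ℝ) : H →ₗ.[ℂ] H :=
  (E.integralGraph φ).toLinearPMap

end SpectralMeasure

open Classical in
/-- `φ(A) = ∫ φ dE` for a self-adjoint operator `A` and a Borel function `φ`, where `E` is the
spectral measure of `A`, that is, the (unique) spectral measure with `A = ∫ t dE(t)`. If `A` has no
spectral measure, the value is the operator with domain `{0}`. -/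
def spectralCalculus {H : Type*} [NormedAddCommGroup H] [InnerProductSpace ℂ H] [CompleteSpace H]
    (A : H →ₗ.[ℂ] H) (φ : ℝ → ℝ) : H →ₗ.[ℂ] H :=
  if h : ∃ E : SpectralMeasure H, E.integral (fun t => t) = A then h.choose.integral φ else ⊥

/-- `S` is a form core of the non-negative self-adjoint operator `A`: it is a core of `A^{1/2}`,
i.e. it is contained in the form domain `D(A^{1/2})` and dense in it for the form norm. -/
def IsFormCore {H : Type*} [NormedAddCommGroup H] [InnerProductSpace ℂ H] [CompleteSpace H]
    (A : H →ₗ.[ℂ] H) (S : Submodule ℂ H) : Prop :=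
  (spectralCalculus A Real.sqrt).HasCore S

/-! ### Bernstein functions -/

/-- Bernstein functions (smooth on `(0,∞)`, non-negative, with `(-1)ⁿ Ψ⁽ⁿ⁾ ≤ 0` for `n ≥ 1`) with
vanishing right limit at `0`. The values at `u ≤ 0` are irrelevant. -/
structure IsBernsteinZero (Ψ : ℝ → ℝ) : Prop where
  contDiffOn : ContDiffOn ℝ ∞ Ψ (Ioi 0)
  nonneg : ∀ u, 0 < u → 0 ≤ Ψ u
  deriv_sign : ∀ n : ℕ, 1 ≤ n → ∀ u, 0 < u → (-1) ^ n * iteratedDeriv n Ψ u ≤ 0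
  tendsto_zero : Tendsto Ψ (𝓝[>] 0) (𝓝 0)

/-- `Ψ(A)` for a function `Ψ` on `(0,∞)` with right limit `0` at `0`, which is extended by
`Ψ(0) = 0` (and by `0` to the negative half-line, outside the spectrum of a non-negative `A`). -/
def bernsteinCalculus {H : Type*} [NormedAddCommGroup H] [InnerProductSpace ℂ H] [CompleteSpace H]
    (Ψ : ℝ → ℝ) (A : H →ₗ.[ℂ] H) : H →ₗ.[ℂ] H :=
  spectralCalculus A ((Ioi 0).indicator Ψ)

/-! ### The magnetic Schrödinger operator -/

/-- Euclidean space `ℝᵈ`. -/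
abbrev EucSp (d : ℕ) : Type := EuclideanSpace ℝ (Fin d)

/-- The Hilbert space `L²(ℝᵈ; ℂ)`. -/
abbrev L2Sp (d : ℕ) : Type := Lp ℂ 2 (volume : Measure (EucSp d))

/-- `f ∈ L^p_loc(ℝᵈ)`. -/
def MemLpLocal {d : ℕ} (f : EucSp d → ℝ) (p : ℝ≥0∞) : Prop :=
  ∀ K : Set (EucSp d), IsCompact K → MemLp f p (volume.restrict K)

/-- The partial derivative `∂_μ η (x)` of a differentiable function. -/
def partialDeriv {d : ℕ} {F : Type*} [NormedAddCommGroup F] [NormedSpace ℝ F]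
    (μ : Fin d) (η : EucSp d → F) (x : EucSp d) : F :=
  fderiv ℝ η x (EuclideanSpace.single μ 1)

/-- `w` is the distributional divergence of the (locally integrable) vector field `a`. -/
def IsWeakDivergence {d : ℕ} (a : EucSp d → EucSp d) (w : EucSp d → ℝ) : Prop :=
  ∀ η : EucSp d → ℝ, ContDiff ℝ ∞ η → HasCompactSupport η →
    ∫ x, ∑ μ, a x μ * partialDeriv μ η x = - ∫ x, w x * η x

/-- `a ∈ (L²_loc)ᵈ`. -/
def AssumptionA1 {d : ℕ} (a : EucSp d → EucSp d) : Prop :=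
  ∀ μ, MemLpLocal (fun x => a x μ) 2

/-- `a ∈ (L⁴_loc)ᵈ` and `∇·a ∈ L²_loc`. -/
def AssumptionA3 {d : ℕ} (a : EucSp d → EucSp d) : Prop :=
  (∀ μ, MemLpLocal (fun x => a x μ) 4) ∧ ∃ w, IsWeakDivergence a w ∧ MemLpLocal w 2

theorem integrable_mul_of_hasCompactSupport {d : ℕ} (f : L2Sp d) {b : EucSp d → ℝ}
    (hb : MemLpLocal b 2) {η : EucSp d → ℂ} (hη : Continuous η) (hc : HasCompactSupport η) :
    Integrable (fun x => f x * (b x * η x)) := by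
  have hK : IsCompact (tsupport η) := hc
  have hbη : MemLp (fun x => (b x : ℂ) * η x) 2 (volume.restrict (tsupport η)) := by
    have h1 : MemLp (fun x => (b x : ℂ)) 2 (volume.restrict (tsupport η)) := (hb _ hK).ofReal
    have h2 : MemLp η ⊤ (volume.restrict (tsupport η)) :=
      (hη.memLp_top_of_hasCompactSupport hc volume).restrict _
    exact h2.mul h1
  have h3 : IntegrableOn (fun x => f x * ((b x : ℂ) * η x)) (tsupport η) :=
    ((Lp.memLp f).restrict (tsupport η)).integrable_mul hbη
  refine (integrableOn_iff_integrable_of_support_subset fun x hx => ?_).1 h3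
  refine subset_tsupport _ fun h0 => hx ?_
  simp [h0]

theorem memLpLocal_one {d : ℕ} : MemLpLocal (fun _ : EucSp d => (1 : ℝ)) 2 := fun K hK =>
  haveI : IsFiniteMeasure (volume.restrict K) := ⟨by simpa using hK.measure_lt_top⟩
  memLp_const 1

theorem integrable_mul_test {d : ℕ} (f : L2Sp d) {η : EucSp d → ℂ} (hη : Continuous η)
    (hc : HasCompactSupport η) : Integrable (fun x => f x * η x) := by
  simpa using integrable_mul_of_hasCompactSupport f memLpLocal_one hη hc

/-- The graph of `D_μ = p_μ - a_μ = -i∂_μ - a_μ` in `L²`: the pairs `(f, g)` of `L²` functions with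
`-i∂_μ f - a_μ f = g` in the sense of distributions. -/
def covDerivGraph {d : ℕ} (a : EucSp d → EucSp d) (ha : AssumptionA1 a) (μ : Fin d) :
    Submodule ℂ (L2Sp d × L2Sp d) where
  carrier := {p | ∀ η : EucSp d → ℂ, ContDiff ℝ ∞ η → HasCompactSupport η →
    Complex.I * (∫ x, p.1 x * partialDeriv μ η x) - ∫ x, p.1 x * (a x μ * η x) =
      ∫ x, p.2 x * η x}
  zero_mem' := by
    intro η _ _
    have h0 : ((0 : L2Sp d) : EucSp d → ℂ) =ᵐ[volume] 0 := Lp.coeFn_zero _ _ _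
    have h1 : ∀ u : EucSp d → ℂ, ∫ x, (0 : L2Sp d) x * u x = 0 := fun u => by
      refine integral_eq_zero_of_ae ?_
      filter_upwards [h0] with x hx
      rw [hx, Pi.zero_apply, zero_mul]
    simp only [Prod.fst_zero, Prod.snd_zero, h1]
    simp
  add_mem' := by
    intro p r hp hr η h1 h2
    have hd1 : Continuous (partialDeriv μ η) :=
      (h1.continuous_fderiv (by simp)).clm_apply continuous_const
    have hd2 : HasCompactSupport (partialDeriv μ η) :=
      (h2.fderiv (𝕜 := ℝ)).comp_left
        (g := fun L : EucSp d →L[ℝ] ℂ => L (EuclideanSpace.single μ 1)) rfl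
    have key : ∀ (f g : L2Sp d) (u : EucSp d → ℂ), Integrable (fun x => f x * u x) →
        Integrable (fun x => g x * u x) →
        ∫ x, (f + g) x * u x = (∫ x, f x * u x) + ∫ x, g x * u x := by
      intro f g u hf hg
      rw [← integral_add hf hg]
      refine integral_congr_ae ?_
      filter_upwards [Lp.coeFn_add f g] with x hx
      rw [hx, Pi.add_apply, add_mul]
    have e1 := hp η h1 h2
    have e2 := hr η h1 h2
    rw [Prod.fst_add, Prod.snd_add,
      key _ _ _ (integrable_mul_test _ hd1 hd2) (integrable_mul_test _ hd1 hd2),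
      key _ _ (fun x => (a x μ : ℂ) * η x)
        (integrable_mul_of_hasCompactSupport _ (ha μ) h1.continuous h2)
        (integrable_mul_of_hasCompactSupport _ (ha μ) h1.continuous h2),
      key _ _ _ (integrable_mul_test _ h1.continuous h2) (integrable_mul_test _ h1.continuous h2),
      ← e1, ← e2]
    ring
  smul_mem' := by
    intro c p hp η h1 h2
    have key : ∀ (f : L2Sp d) (u : EucSp d → ℂ),
        ∫ x, (c • f) x * u x = c * ∫ x, f x * u x := by
      intro f u
      rw [← integral_const_mul]
      refine integral_congr_ae ?_
      filter_upwards [Lp.coeFn_smul c f] with x hx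
      rw [hx, Pi.smul_apply, smul_eq_mul, mul_assoc]
    have e1 := hp η h1 h2
    rw [Prod.smul_fst, Prod.smul_snd, key, key _ (fun x => (a x μ : ℂ) * η x), key, ← e1]
    ring

/-- The operator `D_μ = p_μ - a_μ` in `L²` with its maximal domain
`{f ∈ L² | (p_μ - a_μ) f ∈ L²}`. -/
def covDeriv {d : ℕ} (a : EucSp d → EucSp d) (ha : AssumptionA1 a) (μ : Fin d) :
    L2Sp d →ₗ.[ℂ] L2Sp d :=
  (covDerivGraph a ha μ).toLinearPMap

/-- The form domain `Q(q) = {f ∈ L² | D_μ f ∈ L² for all μ}`. -/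
def magneticFormDomain {d : ℕ} (a : EucSp d → EucSp d) (ha : AssumptionA1 a) :
    Submodule ℂ (L2Sp d) :=
  ⨅ μ, (covDeriv a ha μ).domain

theorem mem_domain_covDeriv {d : ℕ} {a : EucSp d → EucSp d} {ha : AssumptionA1 a} {f : L2Sp d}
    (hf : f ∈ magneticFormDomain a ha) (μ : Fin d) : f ∈ (covDeriv a ha μ).domain :=
  (Submodule.mem_iInf _).1 hf μ

/-- The form `q(f, g) = ½ ∑_μ (D_μ f, D_μ g)`. -/
def magneticForm {d : ℕ} (a : EucSp d → EucSp d) (ha : AssumptionA1 a)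
    (f g : magneticFormDomain a ha) : ℂ :=
  (1 / 2) * ∑ μ, ⟪covDeriv a ha μ ⟨f, mem_domain_covDeriv f.2 μ⟩,
    covDeriv a ha μ ⟨g, mem_domain_covDeriv g.2 μ⟩⟫_ℂ

/-- The graph of the operator associated with the form `q`: the pairs `(f, w)` with `f ∈ Q(q)` and
`(w, g) = q(f, g)` for all `g ∈ Q(q)`. -/
def magneticGraph {d : ℕ} (a : EucSp d → EucSp d) (ha : AssumptionA1 a) :
    Submodule ℂ (L2Sp d × L2Sp d) where
  carrier := {p | ∃ hf : p.1 ∈ magneticFormDomain a ha, ∀ g : magneticFormDomain a ha,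
    ⟪p.2, (g : L2Sp d)⟫_ℂ = magneticForm a ha ⟨p.1, hf⟩ g}
  zero_mem' := by
    refine ⟨Submodule.zero_mem _, fun g => ?_⟩
    have h : ∀ μ, covDeriv a ha μ ⟨(0 : L2Sp d), Submodule.zero_mem _⟩ = 0 := fun μ =>
      map_zero (covDeriv a ha μ).toFun
    simp only [magneticForm, Prod.fst_zero, Prod.snd_zero, h, inner_zero_left]
    simp
  add_mem' := by
    rintro p r ⟨hp, hp'⟩ ⟨hr, hr'⟩
    refine ⟨Submodule.add_mem _ hp hr, fun g => ?_⟩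
    have h : ∀ μ, covDeriv a ha μ ⟨p.1 + r.1, mem_domain_covDeriv (Submodule.add_mem _ hp hr) μ⟩ =
        covDeriv a ha μ ⟨p.1, mem_domain_covDeriv hp μ⟩ +
          covDeriv a ha μ ⟨r.1, mem_domain_covDeriv hr μ⟩ := fun μ =>
      map_add (covDeriv a ha μ).toFun ⟨p.1, mem_domain_covDeriv hp μ⟩
        ⟨r.1, mem_domain_covDeriv hr μ⟩
    have e1 := hp' g
    have e2 := hr' g
    simp only [magneticForm] at e1 e2
    simp only [magneticForm, Prod.fst_add, Prod.snd_add, h, inner_add_left,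
      Finset.sum_add_distrib, mul_add, e1, e2]
  smul_mem' := by
    rintro c p ⟨hp, hp'⟩
    refine ⟨Submodule.smul_mem _ c hp, fun g => ?_⟩
    have h : ∀ μ, covDeriv a ha μ ⟨c • p.1, mem_domain_covDeriv (Submodule.smul_mem _ c hp) μ⟩ =
        c • covDeriv a ha μ ⟨p.1, mem_domain_covDeriv hp μ⟩ := fun μ =>
      map_smul (covDeriv a ha μ).toFun c ⟨p.1, mem_domain_covDeriv hp μ⟩
    have e1 := hp' g
    simp only [magneticForm] at e1
    simp only [magneticForm, Prod.smul_fst, Prod.smul_snd, h, inner_smul_left, e1,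
      ← Finset.mul_sum]
    ring

/-- The magnetic Schrödinger operator `h = ½ (p - a)²`, the self-adjoint operator associated with
the closed form `q`. -/
def magneticSchrodinger {d : ℕ} (a : EucSp d → EucSp d) (ha : AssumptionA1 a) :
    L2Sp d →ₗ.[ℂ] L2Sp d :=
  (magneticGraph a ha).toLinearPMap

/-- `C₀^∞(ℝᵈ)` (smooth, compactly supported, complex valued) as a subspace of `L²(ℝᵈ)`. -/
def testSubspace (d : ℕ) : Submodule ℂ (L2Sp d) where
  carrier := {f | ∃ η : EucSp d → ℂ, ContDiff ℝ ∞ η ∧ HasCompactSupport η ∧ f =ᵐ[volume] η}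
  zero_mem' := ⟨0, contDiff_zero_fun, HasCompactSupport.zero, Lp.coeFn_zero _ _ _⟩
  add_mem' := by
    rintro f g ⟨η, h1, h2, h3⟩ ⟨θ, k1, k2, k3⟩
    exact ⟨η + θ, h1.add k1, h2.add k2, (Lp.coeFn_add f g).trans (h3.add k3)⟩
  smul_mem' := by
    rintro c f ⟨η, h1, h2, h3⟩
    exact ⟨c • η, contDiff_const.smul h1, h2.smul_left, (Lp.coeFn_smul c f).trans (h3.const_smul c)⟩

end

/-!
The argument has an abstract part, which transfers cores through the functional calculus, and an
analytic part, which shows that test functions are a form core and, under (A3), an operator core of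
`h = ½ (p - a)²`.

*Transfer.* The operator `h` has a spectral measure since its resolvent `(h + 1)⁻¹` is a bounded
self-adjoint operator, obtained from the orthogonal projection onto the graph of the closed
operator that defines the form (`exists_formResolvent`, `exists_spectralMeasure_of_resolvent`). A
Bernstein function is concave and non-negative, so it grows at most linearly: `0 ≤ Ψ(u) ≤ c (1 + u)`
(`IsBernsteinZero.exists_le`). Hence the graph norm of `Ψ(h)` is dominated by that of `h`, and
the graph norm of `Ψ(h)^{1/2}` by that of `h^{1/2}`. As `D(h)` is a core of `Ψ(h)`, every core of
`h` is a core of `Ψ(h)`, and likewise for the square roots (`SpectralMeasure.hasCore_of_le`).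

*Form core under (A1).* A function in the form domain is first truncated by a smooth radial
function of its values, which is compatible with the covariant derivatives since it commutes with
rotations of `ℂ` (`IsCovDeriv.radialMul`), then cut off in space, then mollified. For a bounded
function with compact support the products `a_μ f` cause no problem in `L²`, so `-i∂_μ f` is in
`L²` and the mollifications converge in the form norm (`covGrad_hasCore_test`).

*Operator core under (A3).* It suffices that `h + 1` maps test functions onto a dense subspace. Let
`φ` be a test function, and let `b` be a smooth vector potential with compact support near `a`. The
weak solution `u` of `½ (p - b)² u + u = φ` satisfies `‖u‖_∞ ≤ ‖φ‖_∞`, as one sees by testing the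
equation with a truncation of `u` (`norm_le_of_mem_magneticGraph`). A mollification `w` of `u` is a
smooth approximate solution with the same bound (`exists_smooth_approxSolution`). For a cutoff
function `ζ`, the function `s = ζ w` is a test function, and the commutator with `ζ` contains only
derivatives of `ζ`, `w` and the covariant derivatives of `w`, so it is small for wide cutoffs. What
remains is the error of replacing `a` by `b`, whose leading term is `(a - b) · ∇s`. It is small in
`L²` because `a - b` is small in `L⁴` locally and because `∇s` is bounded in `L⁴` uniformly in `b`
(`exists_gradient_bound`): `Δs` is bounded in `L²` in terms of `‖∇s‖₄`, linearly, while the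
Gagliardo–Nirenberg inequality `‖∂_μ s‖₄² ≤ 3 ‖s‖_∞ ‖∂_μ² s‖₂` gives the reverse bound with a
square, so that the two together bound `‖∇s‖₄`.
-/

noncomputable section

/-! ### Isometric functional calculi and their `L²` completion -/

/-- A functional calculus `f ↦ op f` for an algebra `A` of bounded measurable functions on `X`,
which is isometric in the sense that `‖op f x‖` is the norm of `f` in `L²(μ x)`. Simple functions
of a spectral measure and continuous functions of a bounded self-adjoint operator are instances. -/
structure IsometricCalculus (A X H : Type*) [CommRing A] [MeasurableSpace X]
    [NormedAddCommGroup H] [InnerProductSpace ℂ H] where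
  /-- the function on `X` represented by an element of the algebra -/
  ev : A →+* (X → ℝ)
  /-- the operator attached to an element of the algebra -/
  op : A →+* (H →L[ℂ] H)
  /-- the scalar spectral measure of a vector -/
  μ : H → Measure X
  exists_const : ∀ c : ℝ, ∃ f, (ev f = fun _ => c) ∧ op f = (c : ℂ) • 1
  finite : ∀ x, IsFiniteMeasure (μ x)
  measurable_ev : ∀ f, Measurable (ev f)
  bounded_ev : ∀ f, ∃ C : ℝ, ∀ t, ‖ev f t‖ ≤ C
  isometry : ∀ f x, ‖op f x‖ₑ = eLpNorm (ev f) 2 (μ x)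
  symm : ∀ f x y, ⟪op f x, y⟫_ℂ = ⟪x, op f y⟫_ℂ
  dense : ∀ (ν : Measure X) [IsFiniteMeasure ν] (φ : X → ℝ), MemLp φ 2 ν → ∀ ε : ℝ≥0∞, ε ≠ 0 →
    ∃ f, eLpNorm (ev f - φ) 2 ν ≤ ε

namespace IsometricCalculus

variable {A X H : Type*} [CommRing A] [MeasurableSpace X]
    [NormedAddCommGroup H] [InnerProductSpace ℂ H] (C : IsometricCalculus A X H)

instance (x : H) : IsFiniteMeasure (C.μ x) := C.finite x

/-- `C.Rep φ x y` says that `x` is in the domain of the operator `∫ φ dE`, which maps it to `y`: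
there are elements of the algebra that converge to `φ` in `L²(μ x)` and whose values at `x` converge
to `y`. -/
def Rep (φ : X → ℝ) (x y : H) : Prop :=
  ∃ s : ℕ → A, Tendsto (fun n => eLpNorm (C.ev (s n) - φ) 2 (C.μ x)) atTop (𝓝 0) ∧
    Tendsto (fun n => C.op (s n) x) atTop (𝓝 y)

theorem memLp_two_add_measure {φ : X → ℝ} {ν ν' : Measure X} (h : MemLp φ 2 ν)
    (h' : MemLp φ 2 ν') : MemLp φ 2 (ν + ν') := by
  refine ⟨h.1.add_measure h'.1, ?_⟩
  have h2 := h.2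
  have h2' := h'.2
  rw [eLpNorm_lt_top_iff_lintegral_rpow_enorm_lt_top (by simp) (by simp)] at h2 h2' ⊢
  rw [lintegral_add_measure]
  exact ENNReal.add_lt_top.2 ⟨h2, h2'⟩

variable {C}

theorem aesm (f : A) (ν : Measure X) : AEStronglyMeasurable (C.ev f) ν :=
  (C.measurable_ev f).aestronglyMeasurable

theorem memLp_ev (f : A) (ν : Measure X) [IsFiniteMeasure ν] : MemLp (C.ev f) 2 ν := by
  obtain ⟨K, hK⟩ := C.bounded_ev f
  exact MemLp.of_bound (aesm f ν) K (ae_of_all _ hK)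

theorem isometry_sub (f g : A) (x : H) :
    ‖C.op f x - C.op g x‖ₑ = eLpNorm (C.ev f - C.ev g) 2 (C.μ x) := by
  rw [← map_sub, ← C.isometry, map_sub]; rfl

theorem measure_univ_eq (x : H) : C.μ x univ = ‖x‖ₑ ^ 2 := by
  have h := C.isometry 1 x
  rw [map_one, map_one] at h
  have h2 : eLpNorm (1 : X → ℝ) 2 (C.μ x) = (C.μ x univ) ^ (1 / (2 : ℝ≥0∞).toReal) := by
    by_cases h0 : C.μ x = 0
    · simp [h0]
    · rw [show (1 : X → ℝ) = fun _ => 1 from rfl, eLpNorm_const (1 : ℝ) (by simp) h0]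
      simp
  rw [h2] at h
  rw [show (1 : H →L[ℂ] H) x = x from rfl] at h
  rw [h, ← ENNReal.rpow_natCast, ← ENNReal.rpow_mul]
  simp

theorem rep_ev (f : A) (x : H) : C.Rep (C.ev f) x (C.op f x) :=
  ⟨fun _ => f, by simp, tendsto_const_nhds⟩

theorem Rep.congr_ae {φ ψ : X → ℝ} {x y : H} (h : C.Rep φ x y) (hφ : φ =ᵐ[C.μ x] ψ) :
    C.Rep ψ x y := by
  obtain ⟨s, h1, h2⟩ := h
  refine ⟨s, ?_, h2⟩
  convert h1 using 2 with n
  refine eLpNorm_congr_ae ?_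
  filter_upwards [hφ] with t ht
  simp [ht]

/-- The completed calculus is isometric. -/
theorem Rep.dist_eq {φ ψ : X → ℝ} {x y z : H} (hφ : AEStronglyMeasurable φ (C.μ x))
    (hψ : AEStronglyMeasurable ψ (C.μ x)) (h : C.Rep φ x y) (k : C.Rep ψ x z) :
    ‖y - z‖ₑ = eLpNorm (φ - ψ) 2 (C.μ x) := by
  obtain ⟨s, h1, h2⟩ := h
  obtain ⟨r, k1, k2⟩ := k
  have hl : Tendsto (fun n => ‖C.op (s n) x - C.op (r n) x‖ₑ) atTop (𝓝 ‖y - z‖ₑ) :=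
    (continuous_enorm.tendsto _).comp (h2.sub k2)
  simp only [isometry_sub] at hl
  have hsum : Tendsto (fun n => eLpNorm (C.ev (s n) - φ) 2 (C.μ x) +
      eLpNorm (C.ev (r n) - ψ) 2 (C.μ x)) atTop (𝓝 0) := by simpa using h1.add k1
  apply le_antisymm
  · refine le_of_tendsto_of_tendsto' hl
      (by simpa using hsum.const_add (eLpNorm (φ - ψ) 2 (C.μ x))) fun n => ?_
    have e : C.ev (s n) - C.ev (r n) = (φ - ψ) + ((C.ev (s n) - φ) - (C.ev (r n) - ψ)) := by ring
    rw [e]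
    refine (eLpNorm_add_le (hφ.sub hψ) (((aesm _ _).sub hφ).sub ((aesm _ _).sub hψ))
      (by norm_num)).trans ?_
    gcongr
    exact eLpNorm_sub_le ((aesm _ _).sub hφ) ((aesm _ _).sub hψ) (by norm_num)
  · refine le_of_tendsto_of_tendsto' tendsto_const_nhds
      (by simpa using hl.add hsum) fun n => ?_
    have e : φ - ψ = (C.ev (s n) - C.ev (r n)) - ((C.ev (s n) - φ) - (C.ev (r n) - ψ)) := by ring
    rw [e]
    refine (eLpNorm_sub_le ((aesm _ _).sub (aesm _ _))
      (((aesm _ _).sub hφ).sub ((aesm _ _).sub hψ)) (by norm_num)).trans ?_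
    gcongr
    exact eLpNorm_sub_le ((aesm _ _).sub hφ) ((aesm _ _).sub hψ) (by norm_num)

theorem Rep.enorm_eq {φ : X → ℝ} {x y : H} (hφ : AEStronglyMeasurable φ (C.μ x))
    (h : C.Rep φ x y) : ‖y‖ₑ = eLpNorm φ 2 (C.μ x) := by
  have h0 : C.Rep 0 x 0 := by simpa using rep_ev (C := C) 0 x
  simpa using h.dist_eq hφ aestronglyMeasurable_zero h0

theorem Rep.memLp {φ : X → ℝ} {x y : H} (hφ : AEStronglyMeasurable φ (C.μ x))
    (h : C.Rep φ x y) : MemLp φ 2 (C.μ x) :=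
  ⟨hφ, by rw [← h.enorm_eq hφ]; exact enorm_lt_top⟩

theorem Rep.unique {φ ψ : X → ℝ} {x y z : H} (hφ : AEStronglyMeasurable φ (C.μ x))
    (h : C.Rep φ x y) (k : C.Rep ψ x z) (he : φ =ᵐ[C.μ x] ψ) : y = z := by
  have := h.dist_eq hφ hφ (k.congr_ae he.symm)
  simpa [sub_eq_zero] using this

theorem Rep.sub {φ ψ : X → ℝ} {x y z : H} (hφ : AEStronglyMeasurable φ (C.μ x))
    (hψ : AEStronglyMeasurable ψ (C.μ x)) (h : C.Rep φ x y) (k : C.Rep ψ x z) :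
    C.Rep (φ - ψ) x (y - z) := by
  obtain ⟨s, h1, h2⟩ := h
  obtain ⟨r, k1, k2⟩ := k
  refine ⟨fun n => s n - r n, ?_, by simpa using h2.sub k2⟩
  refine tendsto_of_tendsto_of_tendsto_of_le_of_le tendsto_const_nhds
    (by simpa using h1.add k1) (fun _ => zero_le) fun n => ?_
  simp only [map_sub]
  have e : C.ev (s n) - C.ev (r n) - (φ - ψ) = (C.ev (s n) - φ) - (C.ev (r n) - ψ) := by ring
  rw [e]
  exact eLpNorm_sub_le ((aesm _ _).sub hφ) ((aesm _ _).sub hψ) (by norm_num)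

theorem Rep.op_left {φ : X → ℝ} {x y : H} (h : C.Rep φ x y) (f : A) :
    C.Rep (C.ev f * φ) x (C.op f y) := by
  obtain ⟨s, h1, h2⟩ := h
  obtain ⟨K, hK⟩ := C.bounded_ev f
  refine ⟨fun n => f * s n, ?_, ?_⟩
  · have hle : ∀ n, eLpNorm (C.ev (f * s n) - C.ev f * φ) 2 (C.μ x) ≤
        ENNReal.ofReal K * eLpNorm (C.ev (s n) - φ) 2 (C.μ x) := fun n => by
      rw [map_mul, ← mul_sub]
      refine eLpNorm_le_mul_eLpNorm_of_ae_le_mul (ae_of_all _ fun t => ?_) 2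
      rw [Pi.mul_apply, norm_mul]
      gcongr
      exact hK t
    refine tendsto_of_tendsto_of_tendsto_of_le_of_le tendsto_const_nhds ?_
      (fun _ => zero_le) hle
    simpa using ENNReal.Tendsto.const_mul h1 (Or.inr ENNReal.ofReal_ne_top)
  · simp only [map_mul, mul_apply_eq_comp]
    exact ((C.op f).continuous.tendsto y).comp h2

theorem Rep.const_mul {φ : X → ℝ} {x y : H} (h : C.Rep φ x y) (c : ℝ) :
    C.Rep (fun t => c * φ t) x ((c : ℂ) • y) := by
  obtain ⟨f, h1, h2⟩ := C.exists_const c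
  have := h.op_left f
  rw [h1, h2] at this
  exact this

theorem Rep.add {φ ψ : X → ℝ} {x y z : H} (hφ : AEStronglyMeasurable φ (C.μ x))
    (hψ : AEStronglyMeasurable ψ (C.μ x)) (h : C.Rep φ x y) (k : C.Rep ψ x z) :
    C.Rep (φ + ψ) x (y + z) := by
  have h0 : C.Rep 0 x 0 := by simpa using rep_ev (C := C) 0 x
  have := h.sub hφ (aestronglyMeasurable_zero.sub hψ) (h0.sub aestronglyMeasurable_zero hψ k)
  simpa using this

theorem exists_approx {φ : X → ℝ} (ν : Measure X) [IsFiniteMeasure ν] (hφ : MemLp φ 2 ν) :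
    ∃ s : ℕ → A, Tendsto (fun n => eLpNorm (C.ev (s n) - φ) 2 ν) atTop (𝓝 0) := by
  have h : ∀ n : ℕ, ∃ f : A, eLpNorm (C.ev f - φ) 2 ν ≤ ((n : ℝ≥0∞) + 1)⁻¹ := fun n =>
    C.dense ν φ hφ _ (by simp)
  choose s hs using h
  refine ⟨s, tendsto_of_tendsto_of_tendsto_of_le_of_le tendsto_const_nhds ?_
    (fun _ => zero_le) hs⟩
  have := ENNReal.tendsto_inv_nat_nhds_zero
  have h2 := (tendsto_add_atTop_iff_nat 1).2 this
  simpa using h2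

theorem exists_rep_of_approx [CompleteSpace H] {φ : X → ℝ} {x : H}
    (hφ : AEStronglyMeasurable φ (C.μ x)) {s : ℕ → A}
    (hs : Tendsto (fun n => eLpNorm (C.ev (s n) - φ) 2 (C.μ x)) atTop (𝓝 0)) :
    ∃ y, Tendsto (fun n => C.op (s n) x) atTop (𝓝 y) := by
  refine cauchySeq_tendsto_of_complete (EMetric.cauchySeq_iff.2 fun ε hε => ?_)
  have h2 : ∀ᶠ n in atTop, eLpNorm (C.ev (s n) - φ) 2 (C.μ x) < ε / 2 :=
    hs.eventually_lt_const (ENNReal.half_pos hε.ne')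
  obtain ⟨N, hN⟩ := eventually_atTop.1 h2
  refine ⟨N, fun m hm n hn => ?_⟩
  rw [edist_eq_enorm_sub, isometry_sub]
  have e : C.ev (s m) - C.ev (s n) = (C.ev (s m) - φ) - (C.ev (s n) - φ) := by ring
  rw [e]
  calc _ ≤ _ := eLpNorm_sub_le ((aesm _ _).sub hφ) ((aesm _ _).sub hφ) (by norm_num)
    _ < ε / 2 + ε / 2 := ENNReal.add_lt_add (hN m hm) (hN n hn)
    _ = ε := ENNReal.add_halves ε

theorem exists_rep [CompleteSpace H] {φ : X → ℝ} {x : H} (hφ : MemLp φ 2 (C.μ x)) :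
    ∃ y, C.Rep φ x y := by
  obtain ⟨s, hs⟩ := exists_approx (C := C) (C.μ x) hφ
  obtain ⟨y, hy⟩ := exists_rep_of_approx hφ.1 hs
  exact ⟨y, s, hs, hy⟩

theorem Rep.tendsto_op {φ : X → ℝ} {x y : H} (hφ : AEStronglyMeasurable φ (C.μ x))
    (h : C.Rep φ x y) {s : ℕ → A}
    (hs : Tendsto (fun n => eLpNorm (C.ev (s n) - φ) 2 (C.μ x)) atTop (𝓝 0)) :
    Tendsto (fun n => C.op (s n) x) atTop (𝓝 y) := by
  rw [tendsto_iff_edist_tendsto_0]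
  convert hs using 2 with n
  rw [edist_eq_enorm_sub]
  exact (rep_ev _ _).dist_eq (aesm _ _) hφ h

/-- The operators `∫ φ dE` depend continuously on `φ` in `L²(μ x)`. -/
theorem Rep.of_tendsto [CompleteSpace H] {φ : X → ℝ} {x y : H} {ψ : ℕ → X → ℝ} {z : ℕ → H}
    (hφ : MemLp φ 2 (C.μ x)) (hψ : ∀ n, AEStronglyMeasurable (ψ n) (C.μ x))
    (h : ∀ n, C.Rep (ψ n) x (z n))
    (hl : Tendsto (fun n => eLpNorm (ψ n - φ) 2 (C.μ x)) atTop (𝓝 0))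
    (hz : Tendsto z atTop (𝓝 y)) : C.Rep φ x y := by
  obtain ⟨y', hy'⟩ := exists_rep hφ
  suffices hh : Tendsto z atTop (𝓝 y') by rwa [tendsto_nhds_unique hz hh]
  rw [tendsto_iff_edist_tendsto_0]
  convert hl using 2 with n
  rw [edist_eq_enorm_sub]
  exact (h n).dist_eq (hψ n) hφ.1 hy'

theorem eLpNorm_withDensity_sq {φ : X → ℝ} (hφ : Measurable φ) (ν : Measure X) (g : X → ℝ)
    (hg : AEStronglyMeasurable g ν) :
    eLpNorm g 2 (ν.withDensity fun t => ‖φ t‖ₑ ^ 2) = eLpNorm (g * φ) 2 ν := by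
  rw [eLpNorm_eq_lintegral_rpow_enorm_toReal (by simp) (by simp),
    eLpNorm_eq_lintegral_rpow_enorm_toReal (by simp) (by simp)]
  congr 1
  have hφm : Measurable fun t => ‖φ t‖ₑ ^ 2 := hφ.enorm.pow_const 2
  rw [lintegral_withDensity_eq_lintegral_mul₀ hφm.aemeasurable]
  · refine lintegral_congr fun t => ?_
    simp only [Pi.mul_apply, enorm_mul, ENNReal.toReal_ofNat, ENNReal.rpow_ofNat]
    ring
  · exact hg.enorm.pow_const _

variable (C) in
/-- Finite measures are determined by the `L²` norms of the elements of the algebra. -/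
theorem measure_ext {m ν : Measure X} [IsFiniteMeasure m] [IsFiniteMeasure ν]
    (key : ∀ f : A, eLpNorm (C.ev f) 2 m = eLpNorm (C.ev f) 2 ν) : m = ν := by
  ext K hK
  set g : X → ℝ := K.indicator fun _ => 1 with hg
  have hgm : MemLp g 2 (m + ν) := (memLp_const (1 : ℝ)).indicator hK
  obtain ⟨s, hs⟩ := exists_approx (C := C) (m + ν) hgm
  have lim : ∀ m' : Measure X, m' ≤ m + ν →
      Tendsto (fun n => eLpNorm (C.ev (s n)) 2 m') atTop (𝓝 (eLpNorm g 2 m')) := by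
    intro m' hm
    have hgm' : MemLp g 2 m' := hgm.mono_measure hm
    have : IsFiniteMeasure m' := isFiniteMeasure_of_le _ hm
    have h0 : Tendsto (fun n => eLpNorm (C.ev (s n) - g) 2 m') atTop (𝓝 0) :=
      tendsto_of_tendsto_of_tendsto_of_le_of_le tendsto_const_nhds hs (fun _ => zero_le)
        fun n => eLpNorm_mono_measure _ hm
    have h1 : Tendsto (fun n => (memLp_ev (C := C) (s n) m').toLp) atTop (𝓝 hgm'.toLp) := by
      rw [tendsto_iff_edist_tendsto_0]
      convert h0 using 2 with n
      rw [Lp.edist_toLp_toLp]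
    have h2 := (continuous_enorm.tendsto _).comp h1
    simpa [Function.comp_def, Lp.enorm_toLp] using h2
  have e := tendsto_nhds_unique (by simpa only [key] using lim m (Measure.le_add_right le_rfl))
    (lim ν (Measure.le_add_left le_rfl))
  rw [hg, eLpNorm_indicator_const hK (by simp) (by simp),
    eLpNorm_indicator_const hK (by simp) (by simp)] at e
  simp only [enorm_one, one_mul] at e
  exact ENNReal.rpow_left_injective (by simp) e

/-- The scalar measure of `(∫ φ dE) x` is `|φ|² μ x`. -/
theorem Rep.measure_eq {φ : X → ℝ} {x y : H} (hφ : Measurable φ) (h : C.Rep φ x y) :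
    C.μ y = (C.μ x).withDensity fun t => ‖φ t‖ₑ ^ 2 := by
  have hm := h.memLp hφ.aestronglyMeasurable
  have : IsFiniteMeasure ((C.μ x).withDensity fun t => ‖φ t‖ₑ ^ 2) := by
    refine isFiniteMeasure_withDensity ?_
    have := hm.2
    rw [eLpNorm_lt_top_iff_lintegral_rpow_enorm_lt_top (by simp) (by simp)] at this
    simpa using this.ne
  refine C.measure_ext fun f => ?_
  rw [← C.isometry, (h.op_left f).enorm_eq
      ((aesm _ _).mul hφ.aestronglyMeasurable), eLpNorm_withDensity_sq hφ _ _ (aesm _ _)]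

theorem measure_smul (c : ℂ) (x : H) : C.μ (c • x) = (‖c‖ₑ ^ 2) • C.μ x := by
  have : IsFiniteMeasure ((‖c‖ₑ ^ 2) • C.μ x) := Measure.smul_finite _ (by simp)
  refine C.measure_ext fun f => ?_
  rw [eLpNorm_smul_measure_of_ne_top (by simp), ← C.isometry, ← C.isometry, map_smul, enorm_smul,
    smul_eq_mul, ← ENNReal.rpow_natCast, ← ENNReal.rpow_mul]
  simp

/-- Multiplicativity of the calculus. -/
theorem Rep.mul [CompleteSpace H] {φ ψ : X → ℝ} {x y z : H} (hφ : Measurable φ)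
    (hψ : Measurable ψ) (h : C.Rep φ x y) (k : C.Rep ψ y z) : C.Rep (ψ * φ) x z := by
  have hk := k.memLp hψ.aestronglyMeasurable
  have hμ := h.measure_eq hφ
  obtain ⟨s, k1, k2⟩ := k
  have e : ∀ g : X → ℝ, AEStronglyMeasurable g (C.μ x) →
      eLpNorm g 2 (C.μ y) = eLpNorm (g * φ) 2 (C.μ x) := fun g hg => by
    rw [hμ, eLpNorm_withDensity_sq hφ _ _ hg]
  refine Rep.of_tendsto (ψ := fun n => C.ev (s n) * φ) (z := fun n => C.op (s n) y)
    ⟨hψ.aestronglyMeasurable.mul hφ.aestronglyMeasurable, ?_⟩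
    (fun n => (aesm _ _).mul hφ.aestronglyMeasurable)
    (fun n => h.op_left _) ?_ k2
  · rw [← e _ hψ.aestronglyMeasurable]; exact hk.2
  · convert k1 using 2 with n
    rw [← sub_mul, e _ ((aesm _ _).sub hψ.aestronglyMeasurable)]

theorem Rep.add_vec [CompleteSpace H] {φ : X → ℝ} {x x' y y' : H} (hφ : Measurable φ)
    (h : C.Rep φ x y) (h' : C.Rep φ x' y') (hm : MemLp φ 2 (C.μ (x + x'))) :
    C.Rep φ (x + x') (y + y') := by
  have hs : MemLp φ 2 (C.μ x + C.μ x' + C.μ (x + x')) :=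
    memLp_two_add_measure (memLp_two_add_measure (h.memLp hφ.aestronglyMeasurable)
      (h'.memLp hφ.aestronglyMeasurable)) hm
  obtain ⟨s, hs⟩ := exists_approx (C := C) _ hs
  have lim : ∀ m : Measure X, m ≤ C.μ x + C.μ x' + C.μ (x + x') →
      Tendsto (fun n => eLpNorm (C.ev (s n) - φ) 2 m) atTop (𝓝 0) := fun m hm =>
    tendsto_of_tendsto_of_tendsto_of_le_of_le tendsto_const_nhds hs (fun _ => zero_le)
        fun n => eLpNorm_mono_measure _ hm
  refine ⟨s, lim _ (Measure.le_add_left le_rfl), ?_⟩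
  simp only [map_add]
  exact (h.tendsto_op hφ.aestronglyMeasurable
    (lim _ (Measure.le_add_right (Measure.le_add_right le_rfl)))).add
    (h'.tendsto_op hφ.aestronglyMeasurable
    (lim _ (Measure.le_add_right (Measure.le_add_left le_rfl))))

/-- The operators `∫ φ dE` are symmetric. -/
theorem Rep.inner_eq {φ : X → ℝ} {x x' y y' : H} (hφ : Measurable φ)
    (h : C.Rep φ x y) (h' : C.Rep φ x' y') : ⟪y, x'⟫_ℂ = ⟪x, y'⟫_ℂ := by
  have hs : MemLp φ 2 (C.μ x + C.μ x') :=
    memLp_two_add_measure (h.memLp hφ.aestronglyMeasurable) (h'.memLp hφ.aestronglyMeasurable)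
  obtain ⟨s, hs⟩ := exists_approx (C := C) _ hs
  have lim : ∀ m : Measure X, m ≤ C.μ x + C.μ x' →
      Tendsto (fun n => eLpNorm (C.ev (s n) - φ) 2 m) atTop (𝓝 0) := fun m hm =>
    tendsto_of_tendsto_of_tendsto_of_le_of_le tendsto_const_nhds hs (fun _ => zero_le)
        fun n => eLpNorm_mono_measure _ hm
  have l1 := (h.tendsto_op hφ.aestronglyMeasurable
    (lim _ (Measure.le_add_right le_rfl))).inner (𝕜 := ℂ) (tendsto_const_nhds (x := x'))
  have l2 := (tendsto_const_nhds (x := x)).inner (𝕜 := ℂ) (h'.tendsto_op hφ.aestronglyMeasurable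
    (lim _ (Measure.le_add_left le_rfl)))
  simp only [C.symm] at l1
  exact tendsto_nhds_unique l1 l2

theorem Rep.smul_vec {φ : X → ℝ} {x y : H}
    (h : C.Rep φ x y) (c : ℂ) : C.Rep φ (c • x) (c • y) := by
  obtain ⟨s, h1, h2⟩ := h
  refine ⟨s, ?_, by simpa using h2.const_smul c⟩
  simp only [measure_smul, eLpNorm_smul_measure_of_ne_top (p := 2) (by simp), smul_eq_mul]
  simpa using ENNReal.Tendsto.const_mul h1
    (Or.inr (ENNReal.rpow_ne_top_of_nonneg (by simp) (by simp)))

end IsometricCalculus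

/-! ### The calculus of a spectral measure -/

namespace SpectralMeasure

variable {H : Type*} [NormedAddCommGroup H] [InnerProductSpace ℂ H] [CompleteSpace H]

theorem proj_union (E : SpectralMeasure H) {s t : Set ℝ} (hs : MeasurableSet s)
    (ht : MeasurableSet t) (hd : Disjoint s t) : E.proj (s ∪ t) = E.proj s + E.proj t := by
  ext x
  have hf : ∀ i : ℕ,
      MeasurableSet ((fun i : ℕ => if i = 0 then s else if i = 1 then t else ∅) i) := by
    intro i; dsimp only; split_ifs <;> simp [hs, ht]
  have h := E.hasSum_proj (fun i => if i = 0 then s else if i = 1 then t else ∅) hf (by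
    intro i j hij
    simp only [Function.onFun]
    split_ifs <;> simp_all [disjoint_comm]) x
  have h2 : HasSum (fun i : ℕ => E.proj (if i = 0 then s else if i = 1 then t else ∅) x)
      (∑ i ∈ ({0, 1} : Finset ℕ), E.proj (if i = 0 then s else if i = 1 then t else ∅) x) := by
    refine hasSum_sum_of_ne_finset_zero fun i hi => ?_
    simp only [Finset.mem_insert, Finset.mem_singleton, not_or] at hi
    simp [hi.1, hi.2, E.proj_empty]
  have e := h.unique h2
  have hU : (⋃ i : ℕ, if i = 0 then s else if i = 1 then t else ∅) = s ∪ t := by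
    ext y
    simp only [mem_iUnion, mem_union]
    constructor
    · rintro ⟨i, hi⟩
      split_ifs at hi <;> simp_all
    · rintro (h | h)
      · exact ⟨0, by simpa using h⟩
      · exact ⟨1, by simpa using h⟩
  rw [hU] at e
  simpa using e

/-- The integral of simple functions in the form used for vector-valued measures. -/
def realProj (E : SpectralMeasure H) (s : Set ℝ) : ℝ →L[ℝ] (H →L[ℂ] H) :=
  ContinuousLinearMap.toSpanSingleton ℝ (E.proj s)

theorem realProj_apply (E : SpectralMeasure H) (s : Set ℝ) (c : ℝ) :
    E.realProj s c = (c : ℂ) • E.proj s := by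
  simp [realProj]

theorem finMeasAdditive_realProj (E : SpectralMeasure H) :
    FinMeasAdditive (0 : Measure ℝ) E.realProj := by
  intro s t hs ht _ _ hd
  refine ContinuousLinearMap.ext fun c => ?_
  simp only [add_apply, realProj_apply, E.proj_union hs ht hd, smul_add]

theorem simpleIntegral_eq (E : SpectralMeasure H) (s : SimpleFunc ℝ ℝ) :
    E.simpleIntegral s = s.setToSimpleFunc E.realProj := by
  simp [simpleIntegral, SimpleFunc.setToSimpleFunc, realProj_apply]

theorem simpleIntegral_map (E : SpectralMeasure H) {β : Type*} [NormedAddCommGroup β]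
    (s : SimpleFunc ℝ β) {g : β → ℝ} (hg : g 0 = 0) :
    E.simpleIntegral (s.map g) = ∑ b ∈ s.range, (g b : ℂ) • E.proj (s ⁻¹' {b}) := by
  rw [simpleIntegral_eq, SimpleFunc.map_setToSimpleFunc (μ := 0) _ E.finMeasAdditive_realProj
    (by simp) hg]
  simp [realProj_apply]

theorem proj_mul_of_disjoint (E : SpectralMeasure H) {s t : Set ℝ} (hs : MeasurableSet s)
    (ht : MeasurableSet t) (hd : Disjoint s t) : E.proj s * E.proj t = 0 := by
  rw [← E.proj_inter s t hs ht, hd.inter_eq, E.proj_empty]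

theorem proj_symm (E : SpectralMeasure H) {s : Set ℝ} (hs : MeasurableSet s) (x y : H) :
    ⟪E.proj s x, y⟫_ℂ = ⟪x, E.proj s y⟫_ℂ := by
  have h2 : ContinuousLinearMap.adjoint (E.proj s) = E.proj s :=
    (E.isStarProjection s hs).isSelfAdjoint
  rw [← ContinuousLinearMap.adjoint_inner_left, h2]

theorem simpleIntegral_mul (E : SpectralMeasure H) (s r : SimpleFunc ℝ ℝ) :
    E.simpleIntegral (s * r) = E.simpleIntegral s * E.simpleIntegral r := by
  have e1 := E.simpleIntegral_map (s.pair r) (g := fun p => p.1 * p.2) (by simp)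
  have e2 := E.simpleIntegral_map (s.pair r) (g := Prod.fst) (by simp)
  have e3 := E.simpleIntegral_map (s.pair r) (g := Prod.snd) (by simp)
  rw [show (s.pair r).map (fun p => p.1 * p.2) = s * r from rfl] at e1
  rw [show (s.pair r).map Prod.fst = s from rfl] at e2
  rw [show (s.pair r).map Prod.snd = r from rfl] at e3
  rw [e1, e2, e3, Finset.sum_mul_sum]
  refine Finset.sum_congr rfl fun p hp => ?_
  rw [Finset.sum_eq_single p]
  · rw [smul_mul_smul_comm, ← E.proj_inter _ _ (SimpleFunc.measurableSet_fiber _ _)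
      (SimpleFunc.measurableSet_fiber _ _), inter_self, Complex.ofReal_mul]
  · intro q _ hq
    rw [smul_mul_smul_comm, E.proj_mul_of_disjoint (SimpleFunc.measurableSet_fiber _ _)
      (SimpleFunc.measurableSet_fiber _ _), smul_zero]
    exact Disjoint.preimage _ (by simpa using hq.symm)
  · exact fun h => absurd hp h

theorem norm_simpleIntegral_sq (E : SpectralMeasure H) (s : SimpleFunc ℝ ℝ) (x : H) :
    ‖E.simpleIntegral s x‖ ^ 2 = ∑ c ∈ s.range, c ^ 2 * ‖E.proj (s ⁻¹' {c}) x‖ ^ 2 := by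
  have h0 : ∀ c d : ℝ, c ≠ d → ⟪E.proj (s ⁻¹' {c}) x, E.proj (s ⁻¹' {d}) x⟫_ℂ = 0 := by
    intro c d hcd
    rw [E.proj_symm (SimpleFunc.measurableSet_fiber _ _), ← mul_apply_eq_comp,
      E.proj_mul_of_disjoint (SimpleFunc.measurableSet_fiber _ _)
      (SimpleFunc.measurableSet_fiber _ _) (Disjoint.preimage _ (by simpa using hcd))]
    simp
  rw [← inner_self_eq_norm_sq (𝕜 := ℂ), simpleIntegral]
  simp only [sum_apply, sum_inner, inner_sum, smul_apply,
    inner_smul_left, inner_smul_right, map_sum]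
  refine Finset.sum_congr rfl fun c hc => ?_
  rw [Finset.sum_eq_single c]
  · rw [inner_self_eq_norm_sq_to_K]
    simp only [Complex.conj_ofReal, RCLike.re_to_complex, Complex.coe_algebraMap]
    norm_cast
    ring
  · intro d _ hd
    simp [h0 d c hd]
  · exact fun h => absurd hc h

theorem enorm_simpleIntegral (E : SpectralMeasure H) (s : SimpleFunc ℝ ℝ) (x : H) :
    ‖E.simpleIntegral s x‖ₑ = eLpNorm s 2 (E.scalarMeasure x) := by
  rw [eLpNorm_eq_lintegral_rpow_enorm_toReal (by simp) (by simp)]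
  have h1 : ∫⁻ t, ‖s t‖ₑ ^ (2 : ℝ≥0∞).toReal ∂(E.scalarMeasure x) =
      ‖E.simpleIntegral s x‖ₑ ^ 2 := by
    have h2 : (fun t => ‖s t‖ₑ ^ (2 : ℝ≥0∞).toReal) = s.map (fun c => ‖c‖ₑ ^ 2) := by
      ext t; simp
    rw [h2, SimpleFunc.lintegral_eq_lintegral, SimpleFunc.map_lintegral]
    simp only [E.scalarMeasure_apply x (SimpleFunc.measurableSet_fiber _ _)]
    rw [← ofReal_norm, ← ENNReal.ofReal_pow (norm_nonneg _), norm_simpleIntegral_sq,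
      ENNReal.ofReal_sum_of_nonneg (fun _ _ => by positivity)]
    refine Finset.sum_congr rfl fun c _ => ?_
    rw [ENNReal.ofReal_mul (by positivity), ← ofReal_norm, ← ENNReal.ofReal_pow (norm_nonneg _)]
    simp
  rw [h1, ← ENNReal.rpow_natCast, ← ENNReal.rpow_mul]
  simp

/-- The calculus of simple functions of a spectral measure. -/
def calculus (E : SpectralMeasure H) : IsometricCalculus (SimpleFunc ℝ ℝ) ℝ H where
  ev :=
    { toFun := fun s => s
      map_one' := rfl
      map_zero' := rfl
      map_mul' := fun _ _ => rfl
      map_add' := fun _ _ => rfl }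
  op :=
    { toFun := E.simpleIntegral
      map_one' := by
        rw [show (1 : SimpleFunc ℝ ℝ) = SimpleFunc.const ℝ 1 from rfl, simpleIntegral,
          SimpleFunc.range_const, Finset.sum_singleton,
          show (SimpleFunc.const ℝ (1 : ℝ)) ⁻¹' {1} = univ by ext; simp, E.proj_univ]
        simp
      map_zero' := by
        rw [show (0 : SimpleFunc ℝ ℝ) = SimpleFunc.const ℝ 0 from rfl, simpleIntegral,
          SimpleFunc.range_const]
        simp
      map_mul' := E.simpleIntegral_mul
      map_add' := fun s r => by
        simp only [simpleIntegral_eq]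
        exact SimpleFunc.setToSimpleFunc_add (μ := 0) _ E.finMeasAdditive_realProj
          (by simp) (by simp) }
  μ := E.scalarMeasure
  exists_const c := by
    refine ⟨SimpleFunc.const ℝ c, rfl, ?_⟩
    change E.simpleIntegral (SimpleFunc.const ℝ c) = _
    rw [simpleIntegral, SimpleFunc.range_const, Finset.sum_singleton,
      show (SimpleFunc.const ℝ c) ⁻¹' {c} = univ by ext; simp, E.proj_univ]
  finite x := ⟨by rw [E.scalarMeasure_apply x MeasurableSet.univ]; exact ENNReal.ofReal_lt_top⟩
  measurable_ev s := s.measurable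
  bounded_ev s := s.exists_forall_norm_le
  isometry s x := E.enorm_simpleIntegral s x
  symm s x y := by
    simp only [RingHom.coe_mk, MonoidHom.coe_mk, OneHom.coe_mk, simpleIntegral,
      sum_apply, sum_inner, inner_sum, smul_apply,
      inner_smul_left, inner_smul_right, Complex.conj_ofReal]
    refine Finset.sum_congr rfl fun c _ => ?_
    rw [E.proj_symm (SimpleFunc.measurableSet_fiber _ _)]
  dense ν _ φ hφ ε hε := by
    obtain ⟨g, h1, h2⟩ := hφ.exists_simpleFunc_eLpNorm_sub_lt (by simp) hε
    refine ⟨g, ?_⟩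
    rw [← eLpNorm_neg, neg_sub]
    exact h1.le

@[simp] theorem calculus_μ (E : SpectralMeasure H) (x : H) :
    E.calculus.μ x = E.scalarMeasure x := rfl

@[simp] theorem calculus_ev (E : SpectralMeasure H) (s : SimpleFunc ℝ ℝ) :
    E.calculus.ev s = s := rfl

theorem mem_sqIntegrable_iff (E : SpectralMeasure H) {φ : ℝ → ℝ} (hφ : Measurable φ) (x : H) :
    x ∈ E.sqIntegrable φ ↔ MemLp φ 2 (E.scalarMeasure x) := by
  have : MemLp φ 2 (E.scalarMeasure x) ↔ eLpNorm φ 2 (E.scalarMeasure x) < ⊤ :=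
    ⟨fun h => h.2, fun h => ⟨hφ.aestronglyMeasurable, h⟩⟩
  rw [this, eLpNorm_lt_top_iff_lintegral_rpow_enorm_lt_top (by simp) (by simp)]
  change ∫⁻ t, ‖φ t‖ₑ ^ 2 ∂(E.scalarMeasure x) < ⊤ ↔ _
  simp

/-- The graph of `∫ φ dE` consists of the pairs described by the completed calculus. -/
theorem mem_integralGraph_iff (E : SpectralMeasure H) {φ : ℝ → ℝ} (hφ : Measurable φ) (x y : H) :
    (x, y) ∈ E.integralGraph φ ↔ E.calculus.Rep φ x y := by
  constructor
  · rintro ⟨h1, h2⟩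
    have h1' := (E.mem_sqIntegrable_iff hφ x).1 h1
    refine ⟨SimpleFunc.approxOn φ hφ univ 0 (mem_univ _), ?_, ?_⟩
    · exact SimpleFunc.tendsto_approxOn_Lp_eLpNorm hφ (mem_univ _) (by simp) (by simp)
        (by simpa using! h1'.2)
    · refine h2 _ (fun n t => ?_) fun t => ?_
      · have := SimpleFunc.edist_approxOn_le hφ (mem_univ (0 : ℝ)) t n
        rw [edist_dist, edist_dist] at this
        have := (ENNReal.ofReal_le_ofReal_iff dist_nonneg).1 this
        simpa [Real.dist_eq] using this
      · exact SimpleFunc.tendsto_approxOn hφ (mem_univ _) (by simp)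
  · intro h
    have hm := h.memLp hφ.aestronglyMeasurable
    refine ⟨(E.mem_sqIntegrable_iff hφ x).2 hm, fun s h1 h2 => ?_⟩
    refine h.tendsto_op hφ.aestronglyMeasurable ?_
    have hlim : Tendsto (fun n => ∫⁻ t, ‖s n t - φ t‖ₑ ^ 2 ∂(E.scalarMeasure x)) atTop (𝓝 0) := by
      have := tendsto_lintegral_of_dominated_convergence (μ := E.scalarMeasure x)
        (F := fun n t => ‖s n t - φ t‖ₑ ^ 2) (f := fun _ => 0) (fun t => ‖φ t‖ₑ ^ 2)
        (fun n => (((s n).measurable.sub hφ).enorm.pow_const 2))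
        (fun n => ae_of_all _ fun t => by
          refine pow_le_pow_left' ?_ 2
          rw [← ofReal_norm, ← ofReal_norm]
          exact ENNReal.ofReal_le_ofReal (h1 n t))
        (by
          have := hm.2
          rw [eLpNorm_lt_top_iff_lintegral_rpow_enorm_lt_top (by simp) (by simp)] at this
          simpa using! this.ne)
        (ae_of_all _ fun t => by
          have := ENNReal.Tendsto.pow (n := 2) (((h2 t).sub_const (φ t)).enorm)
          simpa using this)
      simpa using this
    have := hlim.ennrpow_const (1 / 2 : ℝ)
    simp only [ENNReal.zero_rpow_of_pos (show (0 : ℝ) < 1 / 2 by norm_num)] at this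
    convert this using 2 with n
    rw [eLpNorm_eq_lintegral_rpow_enorm_toReal (by simp) (by simp)]
    simp

theorem integral_graph (E : SpectralMeasure H) {φ : ℝ → ℝ} (hφ : Measurable φ) :
    (E.integral φ).graph = E.integralGraph φ := by
  refine Submodule.toLinearPMap_graph_eq _ ?_
  rintro ⟨x, y⟩ h rfl
  rw [E.mem_integralGraph_iff hφ] at h
  have h0 : E.calculus.Rep φ 0 0 := by
    rw [← E.mem_integralGraph_iff hφ]; exact Submodule.zero_mem _
  exact h.unique hφ.aestronglyMeasurable h0 (ae_eq_refl _)

theorem mem_integral_graph_iff (E : SpectralMeasure H) {φ : ℝ → ℝ} (hφ : Measurable φ) (x y : H) :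
    (x, y) ∈ (E.integral φ).graph ↔ E.calculus.Rep φ x y := by
  rw [E.integral_graph hφ, E.mem_integralGraph_iff hφ]

theorem mem_integral_domain_iff (E : SpectralMeasure H) {φ : ℝ → ℝ} (hφ : Measurable φ) (x : H) :
    x ∈ (E.integral φ).domain ↔ MemLp φ 2 (E.scalarMeasure x) := by
  rw [LinearPMap.mem_domain_iff]
  simp only [E.mem_integral_graph_iff hφ]
  exact ⟨fun ⟨y, hy⟩ => hy.memLp hφ.aestronglyMeasurable, fun h => IsometricCalculus.exists_rep h⟩

theorem rep_proj (E : SpectralMeasure H) {K : Set ℝ} (hK : MeasurableSet K) (x : H) :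
    E.calculus.Rep (K.indicator fun _ => 1) x (E.proj K x) := by
  classical
  have h := IsometricCalculus.rep_ev (C := E.calculus)
    (SimpleFunc.piecewise K hK (SimpleFunc.const ℝ 1) (SimpleFunc.const ℝ 0)) x
  have e1 : E.calculus.ev (SimpleFunc.piecewise K hK (SimpleFunc.const ℝ 1) (SimpleFunc.const ℝ 0))
      = K.indicator fun _ => 1 := by
    ext t
    simp [indicator]
  have e2 : E.calculus.op
      (SimpleFunc.piecewise K hK (SimpleFunc.const ℝ 1) (SimpleFunc.const ℝ 0)) x
      = E.proj K x := by
    change E.simpleIntegral _ x = _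
    rw [simpleIntegral_eq, SimpleFunc.setToSimpleFunc_indicator _ (by
      simp [realProj, E.proj_empty]) hK, realProj_apply]
    simp
  rwa [e1, e2] at h

end SpectralMeasure

/-! ### Dominated convergence in `L^p` -/

theorem tendsto_eLpNorm_sub_of_dominated {α F : Type*} [MeasurableSpace α] {ν : Measure α}
    [NormedAddCommGroup F] {p : ℝ≥0∞} (hp0 : p ≠ 0) (hp : p ≠ ⊤) {f : ℕ → α → F} {g : α → F}
    {b : α → ℝ} (hf : ∀ n, AEStronglyMeasurable (f n) ν) (hb : MemLp b p ν)
    (hle : ∀ n, ∀ᵐ x ∂ν, ‖f n x‖ ≤ b x) (hlim : ∀ᵐ x ∂ν, Tendsto (fun n => f n x) atTop (𝓝 (g x))) :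
    Tendsto (fun n => eLpNorm (f n - g) p ν) atTop (𝓝 0) := by
  have hg : AEStronglyMeasurable g ν := aestronglyMeasurable_of_tendsto_ae _ hf hlim
  have hpos : 0 < p.toReal := ENNReal.toReal_pos hp0 hp
  have h2b : MemLp (fun x => 2 * b x) p ν := hb.const_mul 2
  have hgb : ∀ᵐ x ∂ν, ‖g x‖ ≤ b x := by
    filter_upwards [hlim, ae_all_iff.2 hle] with x h1 h2
    exact le_of_tendsto' h1.norm h2
  have h0 : Tendsto (fun n => ∫⁻ x, ‖f n x - g x‖ₑ ^ p.toReal ∂ν) atTop (𝓝 0) := by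
    have := tendsto_lintegral_of_dominated_convergence' (μ := ν)
      (F := fun n x => ‖f n x - g x‖ₑ ^ p.toReal) (f := fun _ => 0)
      (fun x => ‖2 * b x‖ₑ ^ p.toReal)
      (fun n => ((hf n).sub hg).enorm.pow_const _)
      (fun n => by
        filter_upwards [hle n, hgb] with x h1 h2
        refine ENNReal.rpow_le_rpow ?_ hpos.le
        rw [← ofReal_norm, ← ofReal_norm]
        refine ENNReal.ofReal_le_ofReal ((norm_sub_le _ _).trans ?_)
        rw [Real.norm_eq_abs]
        exact le_trans (by linarith) (le_abs_self _))
      ((eLpNorm_lt_top_iff_lintegral_rpow_enorm_lt_top hp0 hp).1 h2b.2).ne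
      (by
        filter_upwards [hlim] with x hx
        have := (hx.sub_const (g x)).enorm.ennrpow_const p.toReal
        simpa [ENNReal.zero_rpow_of_pos hpos] using this)
    simpa using this
  have := h0.ennrpow_const (1 / p.toReal)
  rw [ENNReal.zero_rpow_of_pos (by positivity)] at this
  convert this using 2 with n
  rw [eLpNorm_eq_lintegral_rpow_enorm_toReal hp0 hp]
  rfl

/-! ### Cores of closed operators -/

namespace LinearPMap

variable {H F F' : Type*} [NormedAddCommGroup H] [NormedSpace ℂ H]
  [NormedAddCommGroup F] [NormedSpace ℂ F] [NormedAddCommGroup F'] [NormedSpace ℂ F']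

theorem mem_domRestrict_graph (T : H →ₗ.[ℂ] F) (S : Submodule ℂ H) (p : H × F) :
    p ∈ (T.domRestrict S).graph ↔ p ∈ T.graph ∧ p.1 ∈ S := by
  constructor
  · intro h
    obtain ⟨y, h1, h2⟩ := (mem_graph_iff _).1 h
    have hy : (y : H) ∈ S ⊓ T.domain := y.2
    refine ⟨le_graph_of_le domRestrict_le h, ?_⟩
    rw [← h1]; exact (Submodule.mem_inf.1 hy).1
  · rintro ⟨h1, h2⟩
    obtain ⟨y, e1, e2⟩ := (mem_graph_iff _).1 h1
    have hy : p.1 ∈ (T.domRestrict S).domain := by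
      rw [domRestrict_domain, Submodule.mem_inf]
      exact ⟨h2, e1 ▸ y.2⟩
    refine (mem_graph_iff _).2 ⟨⟨p.1, hy⟩, rfl, ?_⟩
    rw [← e2]
    exact domRestrict_apply (x := ⟨p.1, hy⟩) (y := y) e1.symm

/-- For a closed operator, a core is a subspace of the domain which is dense for the graph norm. -/
theorem hasCore_iff {T : H →ₗ.[ℂ] F} (hT : T.IsClosed) {S : Submodule ℂ H} :
    T.HasCore S ↔ S ≤ T.domain ∧ ∀ p ∈ T.graph, ∀ ε : ℝ, 0 < ε →
      ∃ q ∈ T.graph, q.1 ∈ S ∧ ‖q.1 - p.1‖ < ε ∧ ‖q.2 - p.2‖ < ε := by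
  have hcl : (T.domRestrict S).IsClosable := hT.isClosable.leIsClosable domRestrict_le
  have key : ∀ p : H × F, p ∈ (T.domRestrict S).graph.topologicalClosure ↔ ∀ ε : ℝ, 0 < ε →
      ∃ q ∈ T.graph, q.1 ∈ S ∧ ‖q.1 - p.1‖ < ε ∧ ‖q.2 - p.2‖ < ε := by
    intro p
    rw [← SetLike.mem_coe, Submodule.topologicalClosure_coe, Metric.mem_closure_iff]
    refine forall₂_congr fun ε hε => ?_
    simp only [SetLike.mem_coe, mem_domRestrict_graph, dist_comm p, dist_eq_norm]
    refine exists_congr fun q => ?_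
    simp only [Prod.norm_def, sup_lt_iff, Prod.fst_sub, Prod.snd_sub, and_assoc]
  constructor
  · rintro ⟨h1, h2⟩
    refine ⟨h1, fun p hp => ?_⟩
    rw [← key, hcl.graph_closure_eq_closure_graph, h2]
    exact hp
  · rintro ⟨h1, h2⟩
    refine ⟨h1, eq_of_eq_graph ?_⟩
    rw [← hcl.graph_closure_eq_closure_graph]
    apply le_antisymm
    · rw [← hT.submodule_topologicalClosure_eq]
      exact Submodule.topologicalClosure_mono (le_graph_of_le domRestrict_le)
    · intro p hp
      exact (key p).2 (h2 p hp)

theorem hasCore_domain {T : H →ₗ.[ℂ] F} (hT : T.IsClosed) : T.HasCore T.domain :=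
  (hasCore_iff hT).2 ⟨le_rfl, fun p hp ε hε =>
    ⟨p, hp, mem_domain_of_mem_graph hp, by simpa, by simpa⟩⟩

/-- If the values of two closed operators have equal norms on a core of the first one, then the
domain of the second contains that of the first, and the norms agree there. -/
theorem exists_graph_of_core [CompleteSpace F'] {T : H →ₗ.[ℂ] F} {T' : H →ₗ.[ℂ] F'}
    (hT : T.IsClosed) (hT' : T'.IsClosed) {D : Submodule ℂ H} (hD : T.HasCore D)
    (hD' : D ≤ T'.domain)
    (hn : ∀ x ∈ D, ∀ y y', (x, y) ∈ T.graph → (x, y') ∈ T'.graph → ‖y‖ = ‖y'‖)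
    {x : H} {y : F} (h : (x, y) ∈ T.graph) : ∃ y', (x, y') ∈ T'.graph ∧ ‖y‖ = ‖y'‖ := by
  have hc := ((hasCore_iff hT).1 hD).2 _ h
  choose q hq hqD hq1 hq2 using fun n : ℕ => hc (1 / ((n : ℝ) + 1)) (by positivity)
  have hr : ∀ n, ∃ z, ((q n).1, z) ∈ T'.graph := fun n => mem_domain_iff.1 (hD' (hqD n))
  choose z hz using hr
  have l1 : Tendsto (fun n => (q n).1) atTop (𝓝 x) := by
    rw [tendsto_iff_norm_sub_tendsto_zero]
    exact squeeze_zero (fun _ => norm_nonneg _) (fun n => (hq1 n).le)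
      tendsto_one_div_add_atTop_nhds_zero_nat
  have l2 : Tendsto (fun n => (q n).2) atTop (𝓝 y) := by
    rw [tendsto_iff_norm_sub_tendsto_zero]
    exact squeeze_zero (fun _ => norm_nonneg _) (fun n => (hq2 n).le)
      tendsto_one_div_add_atTop_nhds_zero_nat
  have hz2 : CauchySeq z := by
    rw [Metric.cauchySeq_iff]
    intro ε hε
    obtain ⟨N, hN⟩ := Metric.cauchySeq_iff.1 l2.cauchySeq ε hε
    refine ⟨N, fun m hm n hn' => ?_⟩
    have := hN m hm n hn'
    rw [dist_eq_norm] at this ⊢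
    rwa [← hn _ (D.sub_mem (hqD m) (hqD n)) _ _ (T.graph.sub_mem (hq m) (hq n))
      (T'.graph.sub_mem (hz m) (hz n))]
  obtain ⟨y', hy'⟩ := cauchySeq_tendsto_of_complete hz2
  refine ⟨y', ?_, ?_⟩
  · exact IsClosed.mem_of_tendsto hT' (l1.prodMk_nhds hy') (Eventually.of_forall hz)
  · refine tendsto_nhds_unique l2.norm ?_
    convert hy'.norm using 2 with n
    exact hn _ (hqD n) _ _ (hq n) (hz n)

/-- Two closed operators whose values have equal norms on a common core have the same cores. -/
theorem HasCore.congr_norm [CompleteSpace F] [CompleteSpace F'] {T : H →ₗ.[ℂ] F}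
    {T' : H →ₗ.[ℂ] F'}
    (hT : T.IsClosed) (hT' : T'.IsClosed) {D S : Submodule ℂ H} (hD : T.HasCore D)
    (hD' : T'.HasCore D)
    (hn : ∀ x ∈ D, ∀ y y', (x, y) ∈ T.graph → (x, y') ∈ T'.graph → ‖y‖ = ‖y'‖)
    (hS : T.HasCore S) : T'.HasCore S := by
  have h1 := fun {x y} => exists_graph_of_core (x := x) (y := y) hT hT' hD hD'.1 hn
  have h2 := fun {x y} => exists_graph_of_core (x := x) (y := y) hT' hT hD' hD.1
    (fun x hx y y' hy hy' => (hn x hx y' y hy' hy).symm)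
  have hn' : ∀ x y y', (x, y) ∈ T.graph → (x, y') ∈ T'.graph → ‖y‖ = ‖y'‖ := by
    intro x y y' hy hy'
    obtain ⟨w, hw, e⟩ := h1 hy
    rw [e, T'.mem_graph_snd_inj hw hy' rfl]
  refine (hasCore_iff hT').2 ⟨fun x hx => ?_, fun p hp ε hε => ?_⟩
  · obtain ⟨y, hy⟩ := mem_domain_iff.1 (hS.1 hx)
    obtain ⟨y', hy', -⟩ := h1 hy
    exact mem_domain_of_mem_graph hy'
  · obtain ⟨y, hy, -⟩ := h2 (x := p.1) (y := p.2) hp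
    obtain ⟨q, hq, hqS, e1, e2⟩ := ((hasCore_iff hT).1 hS).2 _ hy ε hε
    obtain ⟨z, hz, -⟩ := h1 (x := q.1) (y := q.2) hq
    refine ⟨(q.1, z), hz, hqS, e1, ?_⟩
    rwa [← hn' _ _ _ (T.graph.sub_mem hq hy) (T'.graph.sub_mem hz hp)]

end LinearPMap

/-! ### The operators `∫ φ dE` -/

namespace SpectralMeasure

variable {H : Type*} [NormedAddCommGroup H] [InnerProductSpace ℂ H] [CompleteSpace H]

instance (E : SpectralMeasure H) (x : H) : IsFiniteMeasure (E.scalarMeasure x) :=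
  E.calculus.finite x

theorem rep_indicator_mul (E : SpectralMeasure H) {φ : ℝ → ℝ} {x y : H}
    (h : E.calculus.Rep φ x y) (hφ : Measurable φ) {K : Set ℝ} (hK : MeasurableSet K) :
    E.calculus.Rep (K.indicator φ) x (E.proj K y) := by
  have h1 := h.mul hφ (measurable_const.indicator hK) (E.rep_proj hK y)
  convert h1 using 1
  ext t
  by_cases ht : t ∈ K <;> simp [ht]

/-- `∫ φ dE` commutes with the spectral projections. -/
theorem rep_proj_proj (E : SpectralMeasure H) {φ : ℝ → ℝ} {x y : H}
    (hφ : Measurable φ) {K : Set ℝ} (hK : MeasurableSet K)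
    (h : E.calculus.Rep (K.indicator φ) x y) : E.calculus.Rep φ (E.proj K x) y := by
  have hp := E.rep_proj hK x
  have hm : MemLp φ 2 (E.calculus.μ (E.proj K x)) := by
    refine ⟨hφ.aestronglyMeasurable, ?_⟩
    rw [hp.measure_eq (measurable_const.indicator hK),
      IsometricCalculus.eLpNorm_withDensity_sq (measurable_const.indicator hK) _ _
        hφ.aestronglyMeasurable]
    convert (h.memLp (hφ.indicator hK).aestronglyMeasurable).2 using 2
    ext t
    by_cases ht : t ∈ K <;> simp [ht]
  obtain ⟨w, hw⟩ := IsometricCalculus.exists_rep hm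
  have h1 := hp.mul (measurable_const.indicator hK) hφ hw
  have e : φ * (K.indicator fun _ => 1) = K.indicator φ := by
    ext t
    by_cases ht : t ∈ K <;> simp [ht]
  rw [e] at h1
  rwa [h.unique (hφ.indicator hK).aestronglyMeasurable h1 (ae_eq_refl _)]

/-- The sets `{|φ| ≤ n}` exhaust the line. -/
theorem tendsto_eLpNorm_indicator_sub {φ ψ : ℝ → ℝ} (hφ : Measurable φ) {ν : Measure ℝ}
    (hψ : MemLp ψ 2 ν) :
    Tendsto (fun n : ℕ => eLpNorm ({t | |φ t| ≤ n}.indicator ψ - ψ) 2 ν) atTop (𝓝 0) := by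
  refine tendsto_eLpNorm_sub_of_dominated (b := fun t => ‖ψ t‖) (by simp) (by simp) (fun n => ?_)
    hψ.norm (fun n => ae_of_all _ fun t => norm_indicator_le_norm_self _ _)
    (ae_of_all _ fun t => ?_)
  · exact hψ.1.indicator (measurableSet_le hφ.abs measurable_const)
  · obtain ⟨N, hN⟩ := exists_nat_ge |φ t|
    refine tendsto_const_nhds.congr' ?_
    filter_upwards [eventually_ge_atTop N] with n hn
    rw [indicator_of_mem]
    exact hN.trans (by exact_mod_cast hn)

theorem memLp_of_bdd {φ : ℝ → ℝ} (hφ : Measurable φ) {ν : Measure ℝ} [IsFiniteMeasure ν] {K : ℝ}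
    (h : ∀ t, |φ t| ≤ K) : MemLp φ 2 ν :=
  MemLp.of_bound hφ.aestronglyMeasurable K (ae_of_all _ h)

theorem tendsto_proj (E : SpectralMeasure H) {φ : ℝ → ℝ} (hφ : Measurable φ) (x : H) :
    Tendsto (fun n : ℕ => E.proj {t | |φ t| ≤ n} x) atTop (𝓝 x) := by
  have h1 : E.calculus.Rep (fun _ => 1) x x := by
    simpa [E.proj_univ] using E.rep_proj MeasurableSet.univ x
  rw [tendsto_iff_edist_tendsto_0]
  refine (tendsto_eLpNorm_indicator_sub hφ (ν := E.scalarMeasure x) (ψ := fun _ => 1)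
    (memLp_const (1 : ℝ))).congr fun n => ?_
  have hK : MeasurableSet {t | |φ t| ≤ (n : ℝ)} := measurableSet_le hφ.abs measurable_const
  rw [edist_eq_enorm_sub]
  exact ((E.rep_proj hK x).dist_eq (measurable_const.indicator hK).aestronglyMeasurable
    aestronglyMeasurable_const h1).symm

/-- `∫ φ dE` is self-adjoint: a pair that is formally adjoint to its graph belongs to it. -/
theorem rep_of_adjoint (E : SpectralMeasure H) {φ : ℝ → ℝ} (hφ : Measurable φ) {x y : H}
    (h : ∀ x' y', E.calculus.Rep φ x' y' → ⟪y, x'⟫_ℂ = ⟪x, y'⟫_ℂ) : E.calculus.Rep φ x y := by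
  have hK : ∀ n : ℕ, MeasurableSet {t | |φ t| ≤ n} := fun n =>
    measurableSet_le hφ.abs measurable_const
  have hm : ∀ n : ℕ, Measurable ({t | |φ t| ≤ (n : ℝ)}.indicator φ) := fun n => hφ.indicator (hK n)
  have hb : ∀ (n : ℕ) (v : H), ∃ w, E.calculus.Rep ({t | |φ t| ≤ (n : ℝ)}.indicator φ) v w :=
    fun n v => by
      refine IsometricCalculus.exists_rep (memLp_of_bdd (hm n) (K := n) fun t => ?_)
      by_cases ht : t ∈ {t | |φ t| ≤ (n : ℝ)}
      · rw [indicator_of_mem ht]; exact ht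
      · rw [indicator_of_notMem ht]; simp
  have hn : ∀ n : ℕ, E.calculus.Rep ({t | |φ t| ≤ (n : ℝ)}.indicator φ) x
      (E.proj {t | |φ t| ≤ (n : ℝ)} y) := by
    intro n
    obtain ⟨z, hz⟩ := hb n x
    suffices hh : z = E.proj {t | |φ t| ≤ (n : ℝ)} y by rwa [← hh]
    refine ext_inner_right ℂ fun v => ?_
    obtain ⟨w, hw⟩ := hb n v
    rw [hz.inner_eq (hm n) hw, E.proj_symm (hK n), h _ _ (E.rep_proj_proj hφ (hK n) hw)]
  -- the truncations of `φ` have norms at most `‖y‖`, so Fatou's lemma applies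
  have hmem : MemLp φ 2 (E.scalarMeasure x) := by
    refine ⟨hφ.aestronglyMeasurable, ?_⟩
    have hl := Lp.eLpNorm_lim_le_liminf_eLpNorm (p := 2) (μ := E.scalarMeasure x)
      (f := fun n : ℕ => {t | |φ t| ≤ (n : ℝ)}.indicator φ)
      (fun n => (hm n).aestronglyMeasurable) φ (ae_of_all _ fun t => by
        obtain ⟨N, hN⟩ := exists_nat_ge |φ t|
        refine tendsto_const_nhds.congr' ?_
        filter_upwards [eventually_ge_atTop N] with n hn
        rw [indicator_of_mem]
        exact hN.trans (by exact_mod_cast hn))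
    refine hl.trans_lt (lt_of_le_of_lt ?_ (enorm_lt_top (x := y)))
    have : ∀ n : ℕ, eLpNorm ({t | |φ t| ≤ (n : ℝ)}.indicator φ) 2 (E.scalarMeasure x) =
        ‖E.proj {t | |φ t| ≤ (n : ℝ)} y‖ₑ := fun n =>
      ((hn n).enorm_eq (hm n).aestronglyMeasurable).symm
    simp only [this]
    have hlim : Tendsto (fun n : ℕ => ‖E.proj {t | |φ t| ≤ (n : ℝ)} y‖ₑ) atTop (𝓝 ‖y‖ₑ) :=
      (continuous_enorm.tendsto _).comp (E.tendsto_proj hφ y)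
    rw [hlim.liminf_eq]
  exact IsometricCalculus.Rep.of_tendsto hmem (fun n => (hm n).aestronglyMeasurable) hn
    (tendsto_eLpNorm_indicator_sub hφ hmem) (E.tendsto_proj hφ y)

theorem integral_isClosed (E : SpectralMeasure H) {φ : ℝ → ℝ} (hφ : Measurable φ) :
    (E.integral φ).IsClosed := by
  have : ((E.integral φ).graph : Set (H × H)) =
      ⋂ (x') (y') (_ : E.calculus.Rep φ x' y'), {p : H × H | ⟪p.2, x'⟫_ℂ = ⟪p.1, y'⟫_ℂ} := by
    ext ⟨x, y⟩
    simp only [mem_iInter, SetLike.mem_coe, E.mem_integral_graph_iff hφ, mem_ofPred_eq]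
    exact ⟨fun h x' y' h' => h.inner_eq hφ h', E.rep_of_adjoint hφ⟩
  rw [LinearPMap.IsClosed, this]
  refine isClosed_iInter fun x' => isClosed_iInter fun y' => isClosed_iInter fun _ => ?_
  exact isClosed_eq (by fun_prop) (by fun_prop)

theorem eLpNorm_one_scalarMeasure (E : SpectralMeasure H) (x : H) :
    eLpNorm (fun _ => (1 : ℝ)) 2 (E.scalarMeasure x) = ‖x‖ₑ := by
  have h1 : E.calculus.Rep (fun _ => 1) x x := by
    simpa [E.proj_univ] using E.rep_proj MeasurableSet.univ x
  exact (h1.enorm_eq aestronglyMeasurable_const).symm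

theorem eLpNorm_le_of_le (E : SpectralMeasure H) {φ ψ : ℝ → ℝ} (hψ : Measurable ψ) {c : ℝ}
    (hle : ∀ t, |φ t| ≤ c * (1 + |ψ t|)) (x : H) :
    eLpNorm φ 2 (E.scalarMeasure x) ≤
      ENNReal.ofReal c * (‖x‖ₑ + eLpNorm ψ 2 (E.scalarMeasure x)) := by
  have h1 : eLpNorm φ 2 (E.scalarMeasure x) ≤
      ENNReal.ofReal c * eLpNorm (fun t => 1 + |ψ t|) 2 (E.scalarMeasure x) := by
    refine eLpNorm_le_mul_eLpNorm_of_ae_le_mul (ae_of_all _ fun t => ?_) 2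
    rw [Real.norm_eq_abs, Real.norm_eq_abs, abs_of_nonneg (by positivity : 0 ≤ 1 + |ψ t|)]
    exact hle t
  refine h1.trans ?_
  gcongr
  rw [← E.eLpNorm_one_scalarMeasure, ← eLpNorm_norm ψ]
  exact eLpNorm_add_le aestronglyMeasurable_const hψ.norm.aestronglyMeasurable (by norm_num)

theorem integral_domain_mono (E : SpectralMeasure H) {φ ψ : ℝ → ℝ} (hφ : Measurable φ)
    (hψ : Measurable ψ) {c : ℝ} (hle : ∀ t, |φ t| ≤ c * (1 + |ψ t|)) :
    (E.integral ψ).domain ≤ (E.integral φ).domain := by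
  intro x hx
  rw [E.mem_integral_domain_iff hψ] at hx
  rw [E.mem_integral_domain_iff hφ]
  refine ⟨hφ.aestronglyMeasurable, (E.eLpNorm_le_of_le hψ hle x).trans_lt ?_⟩
  exact ENNReal.mul_lt_top ENNReal.ofReal_lt_top (ENNReal.add_lt_top.2 ⟨enorm_lt_top, hx.2⟩)

/-- A core of `∫ ψ dE` is a core of every `∫ φ dE` with `|φ| ≤ c (1 + |ψ|)`. -/
theorem hasCore_of_le (E : SpectralMeasure H) {φ ψ : ℝ → ℝ} (hφ : Measurable φ)
    (hψ : Measurable ψ) {c : ℝ} (hle : ∀ t, |φ t| ≤ c * (1 + |ψ t|)) {S : Submodule ℂ H}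
    (hS : (E.integral ψ).HasCore S) : (E.integral φ).HasCore S := by
  have hS2 := (LinearPMap.hasCore_iff (E.integral_isClosed hψ)).1 hS
  refine (LinearPMap.hasCore_iff (E.integral_isClosed hφ)).2
    ⟨hS2.1.trans (E.integral_domain_mono hφ hψ hle), ?_⟩
  rintro ⟨x, y⟩ hp ε hε
  have hc : 0 ≤ c := by
    have h1 := (abs_nonneg _).trans (hle 0)
    by_contra hneg
    have := mul_neg_of_neg_of_pos (not_le.1 hneg) (by positivity : 0 < 1 + |ψ 0|)
    linarith
  rw [E.mem_integral_graph_iff hφ] at hp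
  -- for the spectral projection `P` of `{|ψ| ≤ n}` the vector `P x` is in the domain of `∫ ψ dE`
  -- and `(P x, P y)` is close to `(x, y)`; it remains to approximate `P x` by the core
  have hK : ∀ n : ℕ, MeasurableSet {t | |ψ t| ≤ n} := fun n =>
    measurableSet_le hψ.abs measurable_const
  have l1 := (tendsto_iff_norm_sub_tendsto_zero.1 (E.tendsto_proj hψ x)).eventually_lt_const
    (half_pos hε)
  have l2 := (tendsto_iff_norm_sub_tendsto_zero.1 (E.tendsto_proj hψ y)).eventually_lt_const
    (half_pos hε)
  obtain ⟨n, hn1, hn2⟩ := (l1.and l2).exists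
  set P := E.proj {t | |ψ t| ≤ n} with hP
  have hr : E.calculus.Rep φ (P x) (P y) :=
    E.rep_proj_proj hφ (hK n) (E.rep_indicator_mul hp hφ (hK n))
  obtain ⟨w, hw⟩ : ∃ w, E.calculus.Rep ψ (P x) w := by
    have hmi : Measurable ({t | |ψ t| ≤ (n : ℝ)}.indicator ψ) := hψ.indicator (hK n)
    obtain ⟨w, hw⟩ := IsometricCalculus.exists_rep (C := E.calculus) (x := x)
      (memLp_of_bdd hmi (K := n) fun t => by
        by_cases ht : t ∈ {t | |ψ t| ≤ (n : ℝ)}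
        · rw [indicator_of_mem ht]; exact ht
        · rw [indicator_of_notMem ht]; simp)
    exact ⟨w, E.rep_proj_proj hψ (hK n) hw⟩
  have hw' := (E.mem_integral_graph_iff hψ _ _).2 hw
  set δ : ℝ := ε / (4 * (c + 1)) with hδ
  have hδ0 : 0 < δ := by positivity
  obtain ⟨⟨s, v⟩, hq, hqS, e1, e2⟩ := hS2.2 _ hw' δ hδ0
  obtain ⟨u, hu⟩ := LinearPMap.mem_domain_iff.1 (E.integral_domain_mono hφ hψ hle (hS2.1 hqS))
  dsimp only at e1 e2 hqS hu
  have hdist : ‖u - P y‖ ≤ c * (‖s - P x‖ + ‖v - w‖) := by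
    have g1 := (E.mem_integral_graph_iff hφ _ _).1
      (Submodule.sub_mem _ hu ((E.mem_integral_graph_iff hφ _ _).2 hr))
    have g2 := (E.mem_integral_graph_iff hψ _ _).1 (Submodule.sub_mem _ hq hw')
    have := E.eLpNorm_le_of_le hψ hle (s - P x)
    erw [← g1.enorm_eq hφ.aestronglyMeasurable, ← g2.enorm_eq hψ.aestronglyMeasurable] at this
    rw [← ofReal_norm, ← ofReal_norm, ← ofReal_norm, ← ENNReal.ofReal_add (norm_nonneg _)
      (norm_nonneg _), ← ENNReal.ofReal_mul hc] at this
    exact (ENNReal.ofReal_le_ofReal_iff (by positivity)).1 this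
  have hδ2 : c * (δ + δ) < ε / 2 := by
    rw [hδ, ← mul_two, ← mul_assoc, mul_div_assoc', div_mul_eq_mul_div,
      div_lt_div_iff₀ (by positivity) (by positivity)]
    nlinarith
  have hδ1 : δ < ε / 2 := by
    rw [hδ, div_lt_div_iff₀ (by positivity) (by positivity)]
    nlinarith
  refine ⟨(s, u), hu, hqS, ?_, ?_⟩
  · have := norm_sub_le_norm_sub_add_norm_sub s (P x) x
    dsimp only
    linarith
  · have := norm_sub_le_norm_sub_add_norm_sub u (P y) y
    have h3 : c * (‖s - P x‖ + ‖v - w‖) ≤ c * (δ + δ) := by gcongr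
    dsimp only
    linarith

end SpectralMeasure

/-! ### The spectral measure of a functional calculus -/

namespace IsometricCalculus

variable {A X H : Type*} [CommRing A] [MeasurableSpace X]
    [NormedAddCommGroup H] [InnerProductSpace ℂ H] [CompleteSpace H] (C : IsometricCalculus A X H)

theorem exists_rep_indicator {K : Set X} (hK : MeasurableSet K) (x : H) :
    ∃ y, C.Rep (K.indicator fun _ => 1) x y :=
  exists_rep ((memLp_const (1 : ℝ)).indicator hK)

/-- The operator `∫ 1_K dE`. -/
def setProj {K : Set X} (hK : MeasurableSet K) : H →L[ℂ] H :=
  LinearMap.mkContinuous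
    { toFun := fun x => (C.exists_rep_indicator hK x).choose
      map_add' := fun x x' => by
        have hm : Measurable (K.indicator fun _ => (1 : ℝ)) := measurable_const.indicator hK
        exact (C.exists_rep_indicator hK (x + x')).choose_spec.unique hm.aestronglyMeasurable
          ((C.exists_rep_indicator hK x).choose_spec.add_vec hm
            (C.exists_rep_indicator hK x').choose_spec ((memLp_const (1 : ℝ)).indicator hK))
          (ae_eq_refl _)
      map_smul' := fun c x => by
        have hm : Measurable (K.indicator fun _ => (1 : ℝ)) := measurable_const.indicator hK
        exact (C.exists_rep_indicator hK (c • x)).choose_spec.unique hm.aestronglyMeasurable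
          ((C.exists_rep_indicator hK x).choose_spec.smul_vec c) (ae_eq_refl _) } 1
    (fun x => by
      have hm : Measurable (K.indicator fun _ => (1 : ℝ)) := measurable_const.indicator hK
      have h := (C.exists_rep_indicator hK x).choose_spec.enorm_eq hm.aestronglyMeasurable
      rw [eLpNorm_indicator_const hK (by simp) (by simp)] at h
      rw [one_mul, ← enorm_le_iff_norm_le]
      change ‖(C.exists_rep_indicator hK x).choose‖ₑ ≤ _
      rw [h, enorm_one, one_mul]
      calc (C.μ x K) ^ (1 / (2 : ℝ≥0∞).toReal) ≤ (C.μ x univ) ^ (1 / (2 : ℝ≥0∞).toReal) := by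
            gcongr; exact subset_univ _
        _ = ‖x‖ₑ := by
            rw [measure_univ_eq, ← ENNReal.rpow_natCast, ← ENNReal.rpow_mul]; simp)

theorem rep_setProj {K : Set X} (hK : MeasurableSet K) (x : H) :
    C.Rep (K.indicator fun _ => 1) x (C.setProj hK x) :=
  (C.exists_rep_indicator hK x).choose_spec

theorem setProj_eq {K : Set X} (hK : MeasurableSet K) {x y : H}
    (h : C.Rep (K.indicator fun _ => 1) x y) : C.setProj hK x = y :=
  (C.rep_setProj hK x).unique (measurable_const.indicator hK).aestronglyMeasurable h
    (ae_eq_refl _)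

theorem enorm_setProj_sq {K : Set X} (hK : MeasurableSet K) (x : H) :
    ‖C.setProj hK x‖ₑ ^ 2 = C.μ x K := by
  have h := (C.rep_setProj hK x).enorm_eq (measurable_const.indicator hK).aestronglyMeasurable
  rw [eLpNorm_indicator_const hK (by simp) (by simp)] at h
  rw [h, enorm_one, one_mul, ← ENNReal.rpow_natCast, ← ENNReal.rpow_mul]
  simp

theorem setProj_inter {K L : Set X} (hK : MeasurableSet K) (hL : MeasurableSet L) :
    C.setProj (hK.inter hL) = C.setProj hK * C.setProj hL := by
  ext x
  refine C.setProj_eq _ ?_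
  have := (C.rep_setProj hL x).mul (measurable_const.indicator hL) (measurable_const.indicator hK)
    (C.rep_setProj hK (C.setProj hL x))
  have e : ((K ∩ L).indicator fun _ => (1 : ℝ)) =
      (K.indicator fun _ => 1) * L.indicator fun _ => 1 := by
    ext t
    by_cases h1 : t ∈ K <;> by_cases h2 : t ∈ L <;> simp [h1, h2]
  rw [e]
  exact this

theorem isStarProjection_setProj {K : Set X} (hK : MeasurableSet K) :
    IsStarProjection (C.setProj hK) where
  isIdempotentElem := by
    rw [IsIdempotentElem, ← C.setProj_inter]
    simp only [inter_self]
  isSelfAdjoint := by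
    rw [ContinuousLinearMap.isSelfAdjoint_iff_isSymmetric]
    exact fun x y => (C.rep_setProj hK x).inner_eq (measurable_const.indicator hK)
      (C.rep_setProj hK y)

omit [CompleteSpace H] in
theorem rep_finset_sum {ι : Type*} (s : Finset ι) (φ : ι → X → ℝ) (x : H) (y : ι → H)
    (hφ : ∀ i, Measurable (φ i)) (h : ∀ i, C.Rep (φ i) x (y i)) :
    C.Rep (fun t => ∑ i ∈ s, φ i t) x (∑ i ∈ s, y i) := by
  classical
  induction s using Finset.induction_on with
  | empty => simpa [Pi.zero_def] using rep_ev (C := C) 0 x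
  | insert i s hi ih =>
    simp only [Finset.sum_insert hi]
    exact (h i).add (hφ i).aestronglyMeasurable
      (Finset.measurable_sum _ fun i _ => hφ i).aestronglyMeasurable ih

open Classical in
/-- The spectral measure on `ℝ` obtained from a functional calculus on `X` and a Borel function
`κ : X → ℝ`; it is the spectral measure of `∫ κ dE`. -/
def spectralMeasure {κ : X → ℝ} (hκ : Measurable κ) : SpectralMeasure H where
  proj s := if h : MeasurableSet s then C.setProj (hκ h) else 0
  isStarProjection s hs := by
    rw [dif_pos hs]; exact C.isStarProjection_setProj _
  proj_univ := by
    rw [dif_pos MeasurableSet.univ]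
    ext x
    refine C.setProj_eq _ ?_
    simpa [Pi.one_def] using rep_ev (C := C) 1 x
  proj_inter s t hs ht := by
    rw [dif_pos hs, dif_pos ht, dif_pos (hs.inter ht)]
    exact C.setProj_inter (hκ hs) (hκ ht)
  hasSum_proj f hf hd x := by
    have hU := MeasurableSet.iUnion hf
    simp only [dif_pos (hf _), dif_pos hU]
    have hd' : Pairwise (Function.onFun Disjoint fun i => κ ⁻¹' f i) := fun i j hij =>
      (hd hij).preimage κ
    have hU' : κ ⁻¹' (⋃ i, f i) = ⋃ i, κ ⁻¹' f i := preimage_iUnion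
    have hF : ∀ F : Finset ℕ, MeasurableSet (⋃ i ∈ F, κ ⁻¹' f i) := fun F =>
      F.measurableSet_biUnion fun i _ => hκ (hf i)
    have hrest : ∀ F : Finset ℕ, C.setProj (hκ hU) x - ∑ i ∈ F, C.setProj (hκ (hf i)) x =
        C.setProj ((hκ hU).diff (hF F)) x := fun F => by
      refine (C.setProj_eq _ ?_).symm
      have h1 := (C.rep_setProj (hκ hU) x).sub
        (measurable_const.indicator (hκ hU)).aestronglyMeasurable
        (Finset.measurable_sum F fun i _ =>
          (measurable_const (a := (1 : ℝ))).indicator (hκ (hf i))).aestronglyMeasurable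
        (C.rep_finset_sum F _ x _ (fun i => measurable_const.indicator (hκ (hf i)))
          fun i => C.rep_setProj (hκ (hf i)) x)
      convert h1 using 1
      rw [indicator_sdiff (by
        rw [hU']; exact iUnion₂_subset fun i _ => subset_iUnion (fun i => κ ⁻¹' f i) i)]
      congr 1
      exact Finset.indicator_biUnion F _ fun i _ j _ hij => hd' hij
    rw [HasSum, SummationFilter.unconditional_filter, tendsto_iff_edist_tendsto_0]
    have hsq : Tendsto (fun F : Finset ℕ => C.μ x (κ ⁻¹' (⋃ i, f i) \ ⋃ i ∈ F, κ ⁻¹' f i)) atTop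
        (𝓝 0) := by
      have h2 : Tendsto (fun F : Finset ℕ => C.μ x (⋃ i ∈ F, κ ⁻¹' f i)) atTop
          (𝓝 (C.μ x (κ ⁻¹' (⋃ i, f i)))) := by
        have h3 := (ENNReal.summable (f := fun i => C.μ x (κ ⁻¹' f i))).hasSum
        rw [HasSum, SummationFilter.unconditional_filter] at h3
        rw [hU', measure_iUnion hd' fun i => hκ (hf i)]
        refine h3.congr fun F => ?_
        rw [measure_biUnion_finset (fun i _ j _ hij => hd' hij) fun i _ => hκ (hf i)]
      have h4 := ENNReal.Tendsto.sub
        (tendsto_const_nhds (x := C.μ x (κ ⁻¹' (⋃ i, f i))) (f := (atTop : Filter (Finset ℕ)))) h2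
        (Or.inl (measure_ne_top _ _))
      rw [tsub_self] at h4
      refine h4.congr fun F => ?_
      rw [measure_sdiff (by
        rw [hU']; exact iUnion₂_subset fun i _ => subset_iUnion (fun i => κ ⁻¹' f i) i)
        (hF F).nullMeasurableSet (measure_ne_top _ _)]
    have hl := hsq.ennrpow_const (1 / 2 : ℝ)
    rw [ENNReal.zero_rpow_of_pos (by norm_num)] at hl
    refine hl.congr fun F => ?_
    rw [edist_comm, edist_eq_enorm_sub, hrest, ← C.enorm_setProj_sq ((hκ hU).diff (hF F)),
      ← ENNReal.rpow_natCast, ← ENNReal.rpow_mul]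
    simp

theorem spectralMeasure_proj {κ : X → ℝ} (hκ : Measurable κ) {s : Set ℝ} (hs : MeasurableSet s) :
    (C.spectralMeasure hκ).proj s = C.setProj (hκ hs) := by
  simp [spectralMeasure, hs]

theorem scalarMeasure_spectralMeasure {κ : X → ℝ} (hκ : Measurable κ) (x : H) :
    (C.spectralMeasure hκ).scalarMeasure x = (C.μ x).map κ := by
  ext s hs
  rw [SpectralMeasure.scalarMeasure_apply _ _ hs, Measure.map_apply hκ hs,
    C.spectralMeasure_proj hκ hs, ← C.enorm_setProj_sq (hκ hs), ← ofReal_norm,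
    ENNReal.ofReal_pow (norm_nonneg _)]

theorem rep_simpleIntegral {κ : X → ℝ} (hκ : Measurable κ) (s : SimpleFunc ℝ ℝ) (x : H) :
    C.Rep (s ∘ κ) x ((C.spectralMeasure hκ).simpleIntegral s x) := by
  have h := C.rep_finset_sum s.range
    (fun c t => c * (κ ⁻¹' (s ⁻¹' {c})).indicator (fun _ => (1 : ℝ)) t) x
    (fun c => (c : ℂ) • C.setProj (hκ (s.measurableSet_fiber c)) x)
    (fun c => (measurable_const.indicator (hκ (s.measurableSet_fiber c))).const_mul c)
    (fun c => (C.rep_setProj (hκ (s.measurableSet_fiber c)) x).const_mul c)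
  convert h using 1
  · ext t
    rw [Finset.sum_eq_single (s (κ t))]
    · simp
    · intro c _ hc
      rw [indicator_of_notMem]
      · simp
      · simpa using hc.symm
    · intro hn
      exact absurd (s.mem_range_self _) hn
  · simp [SpectralMeasure.simpleIntegral, C.spectralMeasure_proj hκ (s.measurableSet_fiber _)]

/-- Change of variables. -/
theorem rep_spectralMeasure_iff {κ : X → ℝ} (hκ : Measurable κ) {φ : ℝ → ℝ} (hφ : Measurable φ)
    (x y : H) : (C.spectralMeasure hκ).calculus.Rep φ x y ↔ C.Rep (φ ∘ κ) x y := by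
  have key : ∀ g : ℝ → ℝ, Measurable g →
      eLpNorm g 2 ((C.spectralMeasure hκ).scalarMeasure x) = eLpNorm (g ∘ κ) 2 (C.μ x) := by
    intro g hg
    rw [C.scalarMeasure_spectralMeasure hκ,
      eLpNorm_map_measure hg.aestronglyMeasurable hκ.aemeasurable]
  have one : ∀ y, (C.spectralMeasure hκ).calculus.Rep φ x y → C.Rep (φ ∘ κ) x y := by
    intro y h
    have hm := h.memLp hφ.aestronglyMeasurable
    obtain ⟨s, h1, h2⟩ := h
    refine Rep.of_tendsto (ψ := fun n => s n ∘ κ)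
      ⟨(hφ.comp hκ).aestronglyMeasurable, ?_⟩
      (fun n => ((s n).measurable.comp hκ).aestronglyMeasurable)
      (fun n => C.rep_simpleIntegral hκ (s n) x) ?_ h2
    · rw [← key φ hφ]; exact hm.2
    · refine h1.congr fun n => ?_
      exact key _ ((s n).measurable.sub hφ)
  refine ⟨one y, fun h => ?_⟩
  have hm : MemLp φ 2 ((C.spectralMeasure hκ).calculus.μ x) := by
    refine ⟨hφ.aestronglyMeasurable, ?_⟩
    rw [SpectralMeasure.calculus_μ, key φ hφ]
    exact (h.memLp (hφ.comp hκ).aestronglyMeasurable).2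
  obtain ⟨y', hy'⟩ := exists_rep hm
  rwa [h.unique (hφ.comp hκ).aestronglyMeasurable (one y' hy') (ae_eq_refl _)]

end IsometricCalculus

/-! ### Square roots and positivity -/

namespace SpectralMeasure

variable {H : Type*} [NormedAddCommGroup H] [InnerProductSpace ℂ H] [CompleteSpace H]

theorem exists_rep_sqrt (E : SpectralMeasure H) {φ : ℝ → ℝ} (hφ : Measurable φ)
    {x y : H} (hpos : ∀ᵐ t ∂(E.scalarMeasure x), 0 ≤ φ t) (h : E.calculus.Rep φ x y) :
    ∃ z, E.calculus.Rep (fun t => √(φ t)) x z ∧ ⟪x, y⟫_ℂ = ⟪z, z⟫_ℂ := by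
  have hs : Measurable fun t => √(φ t) := hφ.sqrt
  have hm : MemLp φ 2 (E.scalarMeasure x) := h.memLp hφ.aestronglyMeasurable
  have hms : MemLp (fun t => √(φ t)) 2 (E.scalarMeasure x) := by
    have : MemLp (fun t => 1 + ‖φ t‖) 2 (E.scalarMeasure x) := (memLp_const (1 : ℝ)).add hm.norm
    refine this.mono hs.aestronglyMeasurable (ae_of_all _ fun t => ?_)
    rw [Real.norm_of_nonneg (Real.sqrt_nonneg _), Real.norm_of_nonneg (by positivity),
      Real.sqrt_le_left (by positivity), Real.norm_eq_abs]
    nlinarith [abs_nonneg (φ t), le_abs_self (φ t)]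
  obtain ⟨z, hz⟩ := IsometricCalculus.exists_rep (C := E.calculus) hms
  have hae : (fun t => √(φ t)) * (fun t => √(φ t)) =ᵐ[E.scalarMeasure x] φ := by
    filter_upwards [hpos] with t ht
    exact Real.mul_self_sqrt ht
  have hm2 : MemLp (fun t => √(φ t)) 2 (E.scalarMeasure z) := by
    refine ⟨hs.aestronglyMeasurable, ?_⟩
    rw [← E.calculus_μ, hz.measure_eq hs, E.calculus_μ,
      IsometricCalculus.eLpNorm_withDensity_sq hs _ _ hs.aestronglyMeasurable,
      eLpNorm_congr_ae hae]
    exact hm.2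
  obtain ⟨w, hw⟩ := IsometricCalculus.exists_rep (C := E.calculus) hm2
  have e := (hz.mul hs hs hw).unique (hs.mul hs).aestronglyMeasurable h hae
  exact ⟨z, hz, by rw [← e, ← hz.inner_eq hs hw]⟩

theorem scalarMeasure_proj (E : SpectralMeasure H) {K : Set ℝ} (hK : MeasurableSet K) (x : H) :
    E.scalarMeasure (E.proj K x) K = E.scalarMeasure x K := by
  rw [E.scalarMeasure_apply _ hK, E.scalarMeasure_apply _ hK, ← mul_apply_eq_comp,
    ← E.proj_inter K K hK hK, inter_self]

/-- The spectral measure of a non-negative operator does not charge the negative half-line. -/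
theorem ae_nonneg (E : SpectralMeasure H)
    (hpos : ∀ x y, E.calculus.Rep (fun t => t) x y → 0 ≤ RCLike.re ⟪x, y⟫_ℂ) (x : H) :
    ∀ᵐ t ∂(E.scalarMeasure x), 0 ≤ t := by
  -- vectors in the range of `E [-n, 0)` are in the domain, and the form is non-positive on them
  have key : ∀ n : ℕ, E.scalarMeasure x (Ico (-(n : ℝ)) 0) = 0 := by
    intro n
    set K : Set ℝ := Ico (-(n : ℝ)) 0 with hKdef
    have hK : MeasurableSet K := measurableSet_Ico
    set y := E.proj K x with hy
    have hyy : E.proj K y = y := by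
      rw [hy, ← mul_apply_eq_comp, ← E.proj_inter K K hK hK, inter_self]
    set φ : ℝ → ℝ := K.indicator fun t => -t with hφd
    have hφ : Measurable φ := measurable_neg.indicator hK
    have hφ0 : ∀ t, 0 ≤ φ t := fun t => indicator_nonneg (fun s hs => by linarith [hs.2]) t
    obtain ⟨w, hw⟩ := IsometricCalculus.exists_rep (C := E.calculus) (x := y)
      (memLp_of_bdd hφ (K := n) fun t => by
        rw [abs_of_nonneg (hφ0 t)]
        exact indicator_apply_le' (fun ht => by linarith [ht.1]) fun _ => by positivity)
    obtain ⟨z, hz, hin⟩ := E.exists_rep_sqrt hφ (ae_of_all _ hφ0) hw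
    have h1 := hw.const_mul (-1)
    have h2 : E.calculus.Rep (K.indicator fun t => t) y (((-1 : ℝ) : ℂ) • w) := by
      convert h1 using 1
      ext t
      by_cases ht : t ∈ K <;> simp [φ, ht]
    have h3 := hpos _ _ (E.rep_proj_proj measurable_id' hK h2)
    rw [hyy, inner_smul_right, hin, inner_self_eq_norm_sq_to_K] at h3
    have hz0 : z = 0 := by
      have : ((-1 : ℝ) : ℂ) * ((‖z‖ : ℂ)) ^ 2 = ((-‖z‖ ^ 2 : ℝ) : ℂ) := by push_cast; ring
      erw [this] at h3
      rw [RCLike.re_to_complex, Complex.ofReal_re] at h3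
      have h4 : ‖z‖ ^ 2 = 0 := le_antisymm (by linarith) (by positivity)
      simpa using h4
    have h5 := hz.enorm_eq hφ.sqrt.aestronglyMeasurable
    rw [hz0, enorm_zero, eq_comm, eLpNorm_eq_zero_iff hφ.sqrt.aestronglyMeasurable (by simp)] at h5
    have h6 : E.scalarMeasure y K = 0 := by
      refine measure_mono_null (fun t ht => ?_) (ae_iff.1 h5)
      simp only [mem_ofPred_eq, Pi.zero_apply]
      have : 0 < φ t := by
        simp only [φ, indicator_of_mem ht]; linarith [ht.2]
      exact (Real.sqrt_pos.2 this).ne'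
    rwa [hy, E.scalarMeasure_proj hK] at h6
  rw [ae_iff]
  refine measure_mono_null (fun t ht => ?_) (measure_iUnion_null key)
  simp only [mem_ofPred_eq, not_le] at ht
  obtain ⟨n, hn⟩ := exists_nat_ge (-t)
  exact mem_iUnion.2 ⟨n, by linarith, ht⟩

/-- The form domain of a non-negative operator can be computed from any of its spectral measures: if
`F` is one of `A = ∫ φ dE`, then the values of `∫ √φ dE` and `∫ √t dF` have equal norms on `D(A)`,
which is a core of both. So a core of `√φ(A)` is a form core of `φ(A)`. -/
theorem isFormCore_integral (E : SpectralMeasure H) {φ : ℝ → ℝ} (hφ : Measurable φ)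
    (hpos : ∀ x, ∀ᵐ t ∂(E.scalarMeasure x), 0 ≤ φ t) {S : Submodule ℂ H}
    (hS : (E.integral fun t => √(φ t)).HasCore S) : IsFormCore (E.integral φ) S := by
  have hid : Measurable fun t : ℝ => t := measurable_id
  have hex : ∃ F : SpectralMeasure H, F.integral (fun t => t) = E.integral φ := by
    refine ⟨E.calculus.spectralMeasure hφ, LinearPMap.eq_of_eq_graph ?_⟩
    ext ⟨x, y⟩
    rw [mem_integral_graph_iff _ hid, mem_integral_graph_iff _ hφ,
      IsometricCalculus.rep_spectralMeasure_iff _ _ hid]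
    rfl
  rw [IsFormCore, spectralCalculus, dif_pos hex]
  generalize hF : hex.choose = F
  have hFE : F.integral (fun t => t) = E.integral φ := hF ▸ hex.choose_spec
  have hiff : ∀ x y, F.calculus.Rep (fun t => t) x y ↔ E.calculus.Rep φ x y := fun x y => by
    rw [← mem_integral_graph_iff _ hid, ← mem_integral_graph_iff _ hφ, hFE]
  have hFpos := F.ae_nonneg fun x y h => by
    obtain ⟨z, -, hz⟩ := E.exists_rep_sqrt hφ (hpos x) ((hiff x y).1 h)
    rw [hz, inner_self_eq_norm_sq]
    positivity
  have hle : ∀ u : ℝ, |√u| ≤ 1 * (1 + |u|) := fun u => by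
    rw [abs_of_nonneg (Real.sqrt_nonneg _), one_mul, Real.sqrt_le_left (by positivity)]
    nlinarith [abs_nonneg u, le_abs_self u]
  have hD : (E.integral fun t => √(φ t)).HasCore (E.integral φ).domain :=
    E.hasCore_of_le hφ.sqrt hφ (fun t => hle (φ t))
      (LinearPMap.hasCore_domain (E.integral_isClosed hφ))
  have hD' : (F.integral Real.sqrt).HasCore (E.integral φ).domain := by
    rw [← hFE]
    exact F.hasCore_of_le (Real.continuous_sqrt.measurable) hid hle
      (LinearPMap.hasCore_domain (F.integral_isClosed hid))
  refine hD.congr_norm (E.integral_isClosed hφ.sqrt)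
    (F.integral_isClosed Real.continuous_sqrt.measurable) hD' (fun x hx y y' hy hy' => ?_) hS
  rw [mem_integral_graph_iff _ hφ.sqrt] at hy
  rw [mem_integral_graph_iff _ Real.continuous_sqrt.measurable] at hy'
  obtain ⟨w, hw⟩ := LinearPMap.mem_domain_iff.1 hx
  rw [mem_integral_graph_iff _ hφ] at hw
  obtain ⟨z, h1, h2⟩ := E.exists_rep_sqrt hφ (hpos x) hw
  obtain ⟨z', h1', h2'⟩ := F.exists_rep_sqrt hid (hFpos x) ((hiff x w).2 hw)
  rw [hy.unique hφ.sqrt.aestronglyMeasurable h1 (ae_eq_refl _),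
    hy'.unique Real.continuous_sqrt.measurable.aestronglyMeasurable h1' (ae_eq_refl _)]
  have : ‖z‖ ^ 2 = ‖z'‖ ^ 2 := by
    rw [← inner_self_eq_norm_sq (𝕜 := ℂ), ← inner_self_eq_norm_sq (𝕜 := ℂ), ← h2, ← h2']
  exact (sq_eq_sq₀ (norm_nonneg _) (norm_nonneg _)).1 this

end SpectralMeasure

/-! ### The spectral theorem -/

section Spectral

open CompactlySupported

variable {H : Type*} [NormedAddCommGroup H] [InnerProductSpace ℂ H] [CompleteSpace H]
  {T : H →L[ℂ] H} (hT : IsSelfAdjoint T)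

theorem cfcHom_inner_symm (f : C(spectrum ℝ T, ℝ)) (x y : H) :
    ⟪cfcHom hT f x, y⟫_ℂ = ⟪x, cfcHom hT f y⟫_ℂ :=
  (ContinuousLinearMap.isSelfAdjoint_iff_isSymmetric.1 (cfcHom_predicate hT f)) x y

theorem re_inner_cfcHom_mul_self (f : C(spectrum ℝ T, ℝ)) (x : H) :
    RCLike.re ⟪x, cfcHom hT (f * f) x⟫_ℂ = ‖cfcHom hT f x‖ ^ 2 := by
  rw [map_mul, mul_apply_eq_comp, ← cfcHom_inner_symm hT, inner_self_eq_norm_sq]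

theorem re_inner_cfcHom_nonneg (f : C(spectrum ℝ T, ℝ)) (hf : 0 ≤ f) (x : H) :
    0 ≤ RCLike.re ⟪x, cfcHom hT f x⟫_ℂ := by
  set g : C(spectrum ℝ T, ℝ) := ⟨fun t => √(f t), by fun_prop⟩ with hg
  have : f = g * g := by
    ext t
    exact (Real.mul_self_sqrt (hf t)).symm
  rw [this, re_inner_cfcHom_mul_self]
  positivity

/-- The positive functional `f ↦ ⟪x, f(T) x⟫`. -/
def spectralFunctional (x : H) : C_c(spectrum ℝ T, ℝ) →ₚ[ℝ] ℝ where
  toFun f := RCLike.re ⟪x, cfcHom hT (f : C(spectrum ℝ T, ℝ)) x⟫_ℂ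
  map_add' f g := by
    rw [show ((f + g : C_c(spectrum ℝ T, ℝ)) : C(spectrum ℝ T, ℝ)) =
      (f : C(spectrum ℝ T, ℝ)) + (g : C(spectrum ℝ T, ℝ)) from rfl, map_add, add_apply,
      inner_add_right, map_add]
  map_smul' c f := by
    rw [show ((c • f : C_c(spectrum ℝ T, ℝ)) : C(spectrum ℝ T, ℝ)) =
      c • (f : C(spectrum ℝ T, ℝ)) from rfl, map_smul, smul_apply, inner_smul_right_eq_smul]
    simp
  monotone' f g hfg := by
    have h := re_inner_cfcHom_nonneg hT ((g : C(spectrum ℝ T, ℝ)) - (f : C(spectrum ℝ T, ℝ)))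
      (fun t => by simpa using hfg t) x
    rw [map_sub, sub_apply, inner_sub_right, map_sub] at h
    dsimp only
    linarith

/-- The continuous functional calculus of a bounded self-adjoint operator as an isometric calculus.
The scalar measures come from the Riesz–Markov–Kakutani theorem. -/
def selfAdjointCalculus : IsometricCalculus C(spectrum ℝ T, ℝ) (spectrum ℝ T) H where
  ev :=
    { toFun := fun f => f
      map_one' := rfl
      map_zero' := rfl
      map_mul' := fun _ _ => rfl
      map_add' := fun _ _ => rfl }
  op := ((cfcHom hT : C(spectrum ℝ T, ℝ) →⋆ₐ[ℝ] (H →L[ℂ] H)) : C(spectrum ℝ T, ℝ) →+* (H →L[ℂ] H))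
  μ x := RealRMK.rieszMeasure (spectralFunctional hT x)
  exists_const c := by
    refine ⟨ContinuousMap.const _ c, rfl, ?_⟩
    have h : ContinuousMap.const (spectrum ℝ T) c = c • (1 : C(spectrum ℝ T, ℝ)) := by
      ext; simp
    change cfcHom hT _ = _
    rw [h, map_smul, map_one]
    simp
  finite x := by infer_instance
  measurable_ev f := f.continuous.measurable
  bounded_ev f := ⟨‖f‖, f.norm_coe_le_norm⟩
  isometry f x := by
    change ‖cfcHom hT f x‖ₑ = eLpNorm f 2 _
    have hm : MemLp f 2 (RealRMK.rieszMeasure (spectralFunctional hT x)) :=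
      MemLp.of_bound f.continuous.aestronglyMeasurable ‖f‖ (ae_of_all _ f.norm_coe_le_norm)
    rw [hm.eLpNorm_eq_integral_rpow_norm (by simp) (by simp)]
    have h := RealRMK.integral_rieszMeasure (spectralFunctional hT x)
      ⟨f * f, HasCompactSupport.of_compactSpace _⟩
    have h2 : spectralFunctional hT x ⟨f * f, HasCompactSupport.of_compactSpace _⟩ =
      ‖cfcHom hT f x‖ ^ 2 := re_inner_cfcHom_mul_self hT f x
    rw [h2] at h
    have h3 : ∫ t, ‖f t‖ ^ (2 : ℝ≥0∞).toReal ∂(RealRMK.rieszMeasure (spectralFunctional hT x)) =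
        ‖cfcHom hT f x‖ ^ 2 := by
      rw [← h]
      refine integral_congr_ae (ae_of_all _ fun t => ?_)
      change ‖f t‖ ^ (2 : ℝ≥0∞).toReal = f t * f t
      rw [ENNReal.toReal_ofNat, Real.rpow_ofNat, Real.norm_eq_abs, sq_abs, sq]
    rw [h3, ← Real.rpow_natCast, ← Real.rpow_mul (norm_nonneg _)]
    simp
  symm f x y := cfcHom_inner_symm hT f x y
  dense ν _ φ hφ ε hε := by
    obtain ⟨g, h1, h2⟩ := hφ.exists_boundedContinuous_eLpNorm_sub_le (by simp) hε
    refine ⟨g.toContinuousMap, ?_⟩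
    rw [← eLpNorm_neg, neg_sub]
    exact h1

theorem selfAdjointCalculus_op (f : C(spectrum ℝ T, ℝ)) :
    (selfAdjointCalculus hT).op f = cfcHom hT f := rfl

theorem rep_selfAdjointCalculus_id (x : H) :
    (selfAdjointCalculus hT).Rep (fun t => (t : ℝ)) x (T x) := by
  have h := IsometricCalculus.rep_ev (C := selfAdjointCalculus hT)
    ((ContinuousMap.id ℝ).restrict (spectrum ℝ T)) x
  rw [selfAdjointCalculus_op, cfcHom_id hT] at h
  exact h

/-- An operator `A` for which `(A + 1)⁻¹` is a bounded self-adjoint operator has a spectral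
measure. -/
theorem exists_spectralMeasure_of_resolvent {T : H →L[ℂ] H} (hT : IsSelfAdjoint T)
    (hinj : ∀ x, T x = 0 → x = 0) {A : H →ₗ.[ℂ] H}
    (hA : ∀ x y, (x, y) ∈ A.graph ↔ T (x + y) = x) :
    ∃ E : SpectralMeasure H, E.integral (fun t => t) = A := by
  set C := selfAdjointCalculus hT with hC
  -- the spectrum of `T = (A + 1)⁻¹` is carried to that of `A`
  set κ : spectrum ℝ T → ℝ := fun t => (t : ℝ)⁻¹ - 1 with hκd
  have hκ : Measurable κ := (measurable_subtype_coe.inv).sub measurable_const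
  have hid : Measurable fun t : spectrum ℝ T => (t : ℝ) := measurable_subtype_coe
  have hone : ∀ x, C.Rep (fun _ => 1) x x := fun x => by
    simpa [Pi.one_def] using IsometricCalculus.rep_ev (C := C) 1 x
  have hcoe : (C.ev ((ContinuousMap.id ℝ).restrict (spectrum ℝ T))) =
      fun t : spectrum ℝ T => (t : ℝ) := rfl
  have hopT : C.op ((ContinuousMap.id ℝ).restrict (spectrum ℝ T)) = T := by
    rw [hC, selfAdjointCalculus_op, cfcHom_id hT]
  -- `κ` takes a junk value at `0`, which carries no mass since `T` is injective
  have hnz : ∀ x, ∀ᵐ t : spectrum ℝ T ∂(C.μ x), (t : ℝ) ≠ 0 := fun x => by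
    have hK : MeasurableSet {t : spectrum ℝ T | (t : ℝ) = 0} := hid (measurableSet_singleton 0)
    have h1 := (C.rep_setProj hK x).op_left
      ((ContinuousMap.id ℝ).restrict (spectrum ℝ T))
    have h0 : C.Rep 0 x 0 := by simpa using IsometricCalculus.rep_ev (C := C) 0 x
    rw [hopT] at h1
    have h2 := h0.unique aestronglyMeasurable_zero h1 (ae_of_all _ fun t => by
      by_cases ht : (t : ℝ) = 0 <;> simp [hcoe, ht])
    have h3 := C.enorm_setProj_sq hK x
    rw [hinj _ h2.symm] at h3
    rw [ae_iff]
    simpa using h3.symm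
  refine ⟨C.spectralMeasure hκ, LinearPMap.eq_of_eq_graph ?_⟩
  ext ⟨x, y⟩
  rw [SpectralMeasure.mem_integral_graph_iff _ measurable_id',
    C.rep_spectralMeasure_iff hκ measurable_id', hA]
  change C.Rep κ x y ↔ _
  constructor
  · intro h
    have h1 := (h.add hκ.aestronglyMeasurable aestronglyMeasurable_const (hone x)).op_left
      ((ContinuousMap.id ℝ).restrict (spectrum ℝ T))
    rw [hopT, add_comm y x] at h1
    refine h1.unique ?_ (hone x) ?_
    · exact (hid.mul (hκ.add measurable_const)).aestronglyMeasurable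
    · filter_upwards [hnz x] with t ht
      simp only [Pi.mul_apply, Pi.add_apply, hcoe, κ]
      field_simp
      ring
  · intro h
    set w := x + y with hw
    have h1 : C.Rep (fun t : spectrum ℝ T => (t : ℝ)) w x := by
      have := rep_selfAdjointCalculus_id hT w
      rwa [h] at this
    have hae : κ * (fun t : spectrum ℝ T => (t : ℝ)) =ᵐ[C.μ w]
        (fun _ => 1) - fun t : spectrum ℝ T => (t : ℝ) := by
      filter_upwards [hnz w] with t ht
      simp only [Pi.mul_apply, Pi.sub_apply, κ]
      field_simp
    have h2 := (hone w).sub aestronglyMeasurable_const hid.aestronglyMeasurable h1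
    have hm : MemLp κ 2 (C.μ x) := by
      refine ⟨hκ.aestronglyMeasurable, ?_⟩
      rw [h1.measure_eq hid, IsometricCalculus.eLpNorm_withDensity_sq hid _ _
        hκ.aestronglyMeasurable, eLpNorm_congr_ae hae]
      exact (h2.memLp (measurable_const.sub hid).aestronglyMeasurable).2
    obtain ⟨z, hz⟩ := IsometricCalculus.exists_rep hm
    have e := (h1.mul hid hκ hz).unique (hκ.mul hid).aestronglyMeasurable h2 hae
    rw [e, hw, add_sub_cancel_left] at hz
    exact hz

end Spectral

/-! ### Mollification -/

section Mollify

open Metric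

variable {d : ℕ} {F : Type*} [NormedAddCommGroup F] [NormedSpace ℝ F]

/-- A sequence of bump functions at the origin whose supports shrink to it. -/
def bumpSeq (d n : ℕ) : ContDiffBump (0 : EucSp d) where
  rIn := 1 / (2 * ((n : ℝ) + 1))
  rOut := 1 / ((n : ℝ) + 1)
  rIn_pos := by positivity
  rIn_lt_rOut := by
    apply one_div_lt_one_div_of_lt (by positivity)
    have : (0 : ℝ) ≤ n := by positivity
    linarith

/-- The mollification kernels. -/
def mollKernel (d n : ℕ) : EucSp d → ℝ := (bumpSeq d n).normed volume

/-- The mollification of a function: its convolution with a smooth kernel of total mass one that is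
supported in the ball of radius `1 / (n + 1)`. -/
def mollify (n : ℕ) (f : EucSp d → F) : EucSp d → F :=
  convolution (mollKernel d n) f (ContinuousLinearMap.lsmul ℝ ℝ) volume

theorem mollKernel_nonneg (n : ℕ) (x : EucSp d) : 0 ≤ mollKernel d n x :=
  (bumpSeq d n).nonneg_normed x

theorem contDiff_mollKernel (n : ℕ) : ContDiff ℝ ∞ (mollKernel d n) :=
  (bumpSeq d n).contDiff_normed

theorem hasCompactSupport_mollKernel (n : ℕ) : HasCompactSupport (mollKernel d n) :=
  (bumpSeq d n).hasCompactSupport_normed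

theorem integrable_mollKernel (n : ℕ) : Integrable (mollKernel d n) :=
  (bumpSeq d n).integrable_normed

theorem integral_mollKernel (n : ℕ) : ∫ x, mollKernel d n x = 1 :=
  (bumpSeq d n).integral_normed

theorem mollKernel_eq_zero {n : ℕ} {x : EucSp d} (hx : 1 / ((n : ℝ) + 1) ≤ ‖x‖) :
    mollKernel d n x = 0 := by
  by_contra h
  have : x ∈ Function.support (mollKernel d n) := h
  rw [mollKernel, (bumpSeq d n).support_normed_eq, mem_ball_zero_iff] at this
  exact absurd hx (not_le.2 this)

theorem mollify_apply (n : ℕ) (f : EucSp d → F) (x : EucSp d) :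
    mollify n f x = ∫ y, mollKernel d n y • f (x - y) := rfl

theorem mollify_apply' (n : ℕ) (f : EucSp d → F) (x : EucSp d) :
    mollify n f x = ∫ y, mollKernel d n (x - y) • f y := by
  rw [mollify, convolution_lsmul_swap]

theorem contDiff_mollify [CompleteSpace F] (n : ℕ) {f : EucSp d → F} (hf : LocallyIntegrable f) :
    ContDiff ℝ ∞ (mollify n f) :=
  (hasCompactSupport_mollKernel n).contDiff_convolution_left _ (contDiff_mollKernel n) hf

theorem hasCompactSupport_mollify (n : ℕ) {f : EucSp d → F} (hf : HasCompactSupport f) :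
    HasCompactSupport (mollify n f) :=
  (hasCompactSupport_mollKernel n).convolution _ hf

theorem integrable_mollKernel_smul (n : ℕ) {f : EucSp d → F} (hf : LocallyIntegrable f)
    (x : EucSp d) : Integrable fun y => mollKernel d n y • f (x - y) :=
  (hasCompactSupport_mollKernel n).convolutionExists_left (ContinuousLinearMap.lsmul ℝ ℝ)
    (contDiff_mollKernel n).continuous hf x

theorem mollify_congr_ae (n : ℕ) {f g : EucSp d → F} (h : f =ᵐ[volume] g) :
    mollify n f = mollify n g :=
  convolution_congr _ (ae_eq_refl _) h

/-- The mollification at `x` depends only on the function near `x`. -/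
theorem mollify_congr_of_ball {n : ℕ} {f g : EucSp d → F} {x : EucSp d}
    (h : ∀ y, ‖x - y‖ < 1 → f y = g y) : mollify n f x = mollify n g x := by
  rw [mollify_apply', mollify_apply']
  refine integral_congr_ae (ae_of_all _ fun y => ?_)
  dsimp only
  by_cases hy : ‖x - y‖ < 1
  · rw [h y hy]
  · have : 1 / ((n : ℝ) + 1) ≤ 1 := by
      rw [div_le_one (by positivity)]
      have : (0 : ℝ) ≤ n := by positivity
      linarith
    rw [mollKernel_eq_zero (this.trans (not_lt.1 hy)), zero_smul, zero_smul]

theorem norm_mollify_le {n : ℕ} {f : EucSp d → F} {M : ℝ} (hM : ∀ᵐ x, ‖f x‖ ≤ M)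
    (x : EucSp d) : ‖mollify n f x‖ ≤ M := by
  rw [mollify_apply']
  have hi : Integrable fun y => mollKernel d n (x - y) * M :=
    ((integrable_mollKernel n).comp_sub_left x).mul_const M
  refine (norm_integral_le_of_norm_le hi ?_).trans (le_of_eq ?_)
  · filter_upwards [hM] with y hy
    rw [norm_smul, Real.norm_of_nonneg (mollKernel_nonneg n _)]
    exact mul_le_mul_of_nonneg_left hy (mollKernel_nonneg n _)
  · rw [integral_mul_const, integral_sub_left_eq_self (mollKernel d n), integral_mollKernel,
      one_mul]

theorem ae_tendsto_mollify [CompleteSpace F] {f : EucSp d → F} (hf : LocallyIntegrable f) :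
    ∀ᵐ x, Tendsto (fun n => mollify n f x) atTop (𝓝 (f x)) := by
  refine ContDiffBump.ae_convolution_tendsto_right_of_locallyIntegrable (K := 2) ?_ ?_ hf
  · exact tendsto_one_div_add_atTop_nhds_zero_nat
  · refine Eventually.of_forall fun n => ?_
    simp only [bumpSeq]
    have : (n : ℝ) + 1 ≠ 0 := by positivity
    field_simp
    norm_num

/-- Translations act continuously on `L^p`. -/
theorem tendsto_eLpNorm_translate {F : Type*} [NormedAddCommGroup F] {p : ℝ≥0∞} (hp1 : 1 ≤ p)
    (hp : p ≠ ⊤) {f : EucSp d → F}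
    (hf : MemLp f p) :
    Tendsto (fun y : EucSp d => eLpNorm (fun x => f (x - y) - f x) p) (𝓝 0) (𝓝 0) := by
  have : Fact (1 ≤ p) := ⟨hp1⟩
  have hg : Continuous fun y : EucSp d => (⟨fun x => x - y, by fun_prop⟩ : C(EucSp d, EucSp d)) :=
    ContinuousMap.continuous_of_continuous_uncurry _
      (continuous_snd.sub continuous_fst)
  have hmp : ∀ y : EucSp d, MeasurePreserving (fun x : EucSp d => x - y) volume volume := fun y =>
    measurePreserving_sub_right volume y
  have hc := Continuous.compMeasurePreservingLp (μ := volume) (ν := volume)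
    (f := fun _ => hf.toLp f)
    (continuous_const) hg hmp hp
  have h0 := tendsto_iff_edist_tendsto_0.1 (hc.tendsto 0)
  refine h0.congr fun y => ?_
  simp only [ContinuousMap.coe_mk, Lp.toLp_compMeasurePreserving, Lp.edist_toLp_toLp]
  refine eLpNorm_congr_ae (ae_of_all _ fun x => ?_)
  simp [Function.comp_def]

theorem isProbabilityMeasure_mollKernel (n : ℕ) :
    IsProbabilityMeasure (volume.withDensity fun y => ENNReal.ofReal (mollKernel d n y)) := by
  refine ⟨?_⟩
  rw [withDensity_apply _ MeasurableSet.univ, Measure.restrict_univ,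
    ← ofReal_integral_eq_lintegral_ofReal (integrable_mollKernel n)
      (ae_of_all _ (mollKernel_nonneg n)), integral_mollKernel, ENNReal.ofReal_one]

/-- Jensen's inequality for the mollification error. -/
theorem eLpNorm_mollify_sub_le [CompleteSpace F] {p : ℝ≥0∞} (hp1 : 1 ≤ p) (hp : p ≠ ⊤)
    {f : EucSp d → F}
    (hfm : StronglyMeasurable f) (hf : MemLp f p) (n : ℕ) {ε : ℝ≥0∞}
    (hε : ∀ y : EucSp d, ‖y‖ < 1 / ((n : ℝ) + 1) → eLpNorm (fun x => f (x - y) - f x) p ≤ ε) :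
    eLpNorm (mollify n f - f) p ≤ ε := by
  have hloc : LocallyIntegrable f := hf.locallyIntegrable hp1
  have hp0 : p ≠ 0 := (zero_lt_one.trans_le hp1).ne'
  have hpr : 0 < p.toReal := ENNReal.toReal_pos hp0 hp
  set k : EucSp d → ℝ≥0∞ := fun y => ENNReal.ofReal (mollKernel d n y) with hk
  have hkm : Measurable k := (contDiff_mollKernel n).continuous.measurable.ennreal_ofReal
  set ν : Measure (EucSp d) := volume.withDensity k with hν
  have := isProbabilityMeasure_mollKernel (d := d) n
  have hjoint : StronglyMeasurable fun q : EucSp d × EucSp d => f (q.1 - q.2) - f q.1 :=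
    (hfm.comp_measurable (measurable_fst.sub measurable_snd)).sub
      (hfm.comp_measurable measurable_fst)
  have hsl : ∀ x, StronglyMeasurable fun y => f (x - y) - f x := fun x =>
    hjoint.comp_measurable measurable_prodMk_left
  have hpt : ∀ x, ‖mollify n f x - f x‖ₑ ^ p.toReal ≤
      ∫⁻ y, k y * ‖f (x - y) - f x‖ₑ ^ p.toReal := by
    intro x
    have e1 : mollify n f x - f x = ∫ y, mollKernel d n y • (f (x - y) - f x) := by
      simp only [smul_sub]
      rw [integral_sub (integrable_mollKernel_smul n hloc x)
        ((integrable_mollKernel n).smul_const _), mollify_apply, integral_smul_const,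
        integral_mollKernel, one_smul]
    have e2 : ‖mollify n f x - f x‖ₑ ≤ ∫⁻ y, ‖f (x - y) - f x‖ₑ ∂ν := by
      rw [e1, hν, lintegral_withDensity_eq_lintegral_mul _ hkm (hsl x).enorm]
      refine (enorm_integral_le_lintegral_enorm _).trans (le_of_eq ?_)
      refine lintegral_congr fun y => ?_
      rw [enorm_smul, Pi.mul_apply, hk, Real.enorm_eq_ofReal (mollKernel_nonneg n y)]
    -- `ν` is a probability measure
    have e3 : eLpNorm' (fun y => f (x - y) - f x) 1 ν ≤
        eLpNorm' (fun y => f (x - y) - f x) p.toReal ν :=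
      eLpNorm'_le_eLpNorm'_of_exponent_le one_pos
        (by rw [← ENNReal.toReal_one]; exact ENNReal.toReal_mono hp hp1) ν
        (hsl x).aestronglyMeasurable
    rw [eLpNorm'_eq_lintegral_enorm, eLpNorm'_eq_lintegral_enorm] at e3
    simp only [ENNReal.rpow_one, div_one] at e3
    calc _ ≤ (((∫⁻ y, ‖f (x - y) - f x‖ₑ ^ p.toReal ∂ν) ^ (1 / p.toReal))) ^ p.toReal :=
          ENNReal.rpow_le_rpow (e2.trans e3) hpr.le
      _ = ∫⁻ y, ‖f (x - y) - f x‖ₑ ^ p.toReal ∂ν := by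
          rw [← ENNReal.rpow_mul, one_div_mul_cancel hpr.ne', ENNReal.rpow_one]
      _ = _ := by
          rw [hν, lintegral_withDensity_eq_lintegral_mul _ hkm ((hsl x).enorm.pow_const _)]
          rfl
  have hεp : ∀ y, k y * ∫⁻ x, ‖f (x - y) - f x‖ₑ ^ p.toReal ≤ k y * ε ^ p.toReal := by
    intro y
    by_cases hy : ‖y‖ < 1 / ((n : ℝ) + 1)
    · gcongr
      have := hε y hy
      rw [eLpNorm_eq_lintegral_rpow_enorm_toReal hp0 hp] at this
      have h2 := ENNReal.rpow_le_rpow this hpr.le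
      rwa [← ENNReal.rpow_mul, one_div_mul_cancel hpr.ne', ENNReal.rpow_one] at h2
    · simp [hk, mollKernel_eq_zero (not_lt.1 hy)]
  rw [eLpNorm_eq_lintegral_rpow_enorm_toReal hp0 hp]
  have hfin : ∫⁻ x, ‖(mollify n f - f) x‖ₑ ^ p.toReal ≤ ε ^ p.toReal := by
    calc _ ≤ ∫⁻ x, ∫⁻ y, k y * ‖f (x - y) - f x‖ₑ ^ p.toReal := lintegral_mono hpt
      _ = ∫⁻ y, ∫⁻ x, k y * ‖f (x - y) - f x‖ₑ ^ p.toReal := by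
          refine lintegral_lintegral_swap ?_
          exact ((hkm.comp measurable_snd).mul (hjoint.enorm.pow_const _)).aemeasurable
      _ = ∫⁻ y, k y * ∫⁻ x, ‖f (x - y) - f x‖ₑ ^ p.toReal := by
          refine lintegral_congr fun y => ?_
          rw [lintegral_const_mul]
          exact (hjoint.comp_measurable measurable_prodMk_right).enorm.pow_const _
      _ ≤ ∫⁻ y, k y * ε ^ p.toReal := lintegral_mono hεp
      _ = ε ^ p.toReal := by
          rw [lintegral_mul_const _ hkm]
          have h1 := this.measure_univ
          rw [withDensity_apply _ MeasurableSet.univ, Measure.restrict_univ] at h1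
          rw [h1, one_mul]
  calc _ ≤ (ε ^ p.toReal) ^ (1 / p.toReal) := ENNReal.rpow_le_rpow hfin (by positivity)
    _ = ε := by rw [← ENNReal.rpow_mul, mul_one_div_cancel hpr.ne', ENNReal.rpow_one]

/-- Mollifications converge in `L^p`. -/
theorem tendsto_eLpNorm_mollify_sub [CompleteSpace F] {p : ℝ≥0∞} (hp1 : 1 ≤ p) (hp : p ≠ ⊤)
    {f : EucSp d → F} (hf : MemLp f p) :
    Tendsto (fun n => eLpNorm (mollify n f - f) p) atTop (𝓝 0) := by
  have hmk := hf.1.ae_eq_mk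
  have hf' : MemLp (hf.1.mk f) p := hf.ae_eq hmk
  have key : Tendsto (fun n => eLpNorm (mollify n (hf.1.mk f) - hf.1.mk f) p) atTop (𝓝 0) := by
    rw [ENNReal.tendsto_nhds_zero]
    intro ε hε
    have h1 := ENNReal.tendsto_nhds_zero.1 (tendsto_eLpNorm_translate hp1 hp hf') ε hε
    obtain ⟨δ, hδ, h2⟩ := Metric.eventually_nhds_iff.1 h1
    have h3 := (tendsto_one_div_add_atTop_nhds_zero_nat (𝕜 := ℝ)).eventually_lt_const hδ
    filter_upwards [h3] with n hn
    refine eLpNorm_mollify_sub_le hp1 hp hf.1.stronglyMeasurable_mk hf' n fun y hy => h2 ?_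
    rw [dist_zero_right]
    exact hy.trans hn
  refine key.congr fun n => eLpNorm_congr_ae ?_
  rw [← mollify_congr_ae n hmk]
  filter_upwards [hmk] with x hx
  simp [hx]

/-- Mollifications converge in `L^p` on compact sets. -/
theorem tendsto_eLpNorm_mollify_sub_restrict [CompleteSpace F] {p : ℝ≥0∞} (hp1 : 1 ≤ p)
    (hp : p ≠ ⊤) {f : EucSp d → F} (hf : ∀ K : Set (EucSp d), IsCompact K →
      MemLp f p (volume.restrict K))
    {K : Set (EucSp d)} (hK : IsCompact K) :
    Tendsto (fun n => eLpNorm (mollify n f - f) p (volume.restrict K)) atTop (𝓝 0) := by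
  have hK' : IsCompact (cthickening 1 K) := hK.cthickening
  have hf' : MemLp ((cthickening 1 K).indicator f) p :=
    (memLp_indicator_iff_restrict hK'.measurableSet).2 (hf _ hK')
  refine tendsto_of_tendsto_of_tendsto_of_le_of_le tendsto_const_nhds
    (tendsto_eLpNorm_mollify_sub hp1 hp hf') (fun _ => zero_le) fun n => ?_
  refine le_trans (le_of_eq (eLpNorm_congr_ae ?_)) (eLpNorm_mono_measure _ Measure.restrict_le_self)
  filter_upwards [ae_restrict_mem hK.measurableSet] with x hx
  have hx' : x ∈ cthickening 1 K := self_subset_cthickening K hx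
  rw [Pi.sub_apply, Pi.sub_apply, indicator_of_mem hx']
  congr 1
  refine mollify_congr_of_ball fun y hy => ?_
  rw [indicator_of_mem]
  exact mem_cthickening_of_dist_le y x 1 K hx (by rw [dist_eq_norm, norm_sub_rev]; exact hy.le)

end Mollify

/-! ### Weak partial derivatives -/

section Weak

variable {d : ℕ} {F : Type*} [NormedAddCommGroup F] [NormedSpace ℝ F]

theorem contDiff_partialDeriv {μ : Fin d} {η : EucSp d → F} (hη : ContDiff ℝ ∞ η) :
    ContDiff ℝ ∞ (partialDeriv μ η) :=
  (hη.fderiv_right (m := ∞) (by simp)).clm_apply contDiff_const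

theorem continuous_partialDeriv {μ : Fin d} {η : EucSp d → F} (hη : ContDiff ℝ 1 η) :
    Continuous (partialDeriv μ η) :=
  (hη.continuous_fderiv (by simp)).clm_apply continuous_const

theorem hasCompactSupport_partialDeriv {μ : Fin d} {η : EucSp d → F} (hη : HasCompactSupport η) :
    HasCompactSupport (partialDeriv μ η) :=
  (hη.fderiv (𝕜 := ℝ)).comp_left (g := fun L : EucSp d →L[ℝ] F => L (EuclideanSpace.single μ 1)) rfl

theorem partialDeriv_mul {𝔸 : Type*} [NormedCommRing 𝔸] [NormedAlgebra ℝ 𝔸] {μ : Fin d}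
    {η θ : EucSp d → 𝔸} {x : EucSp d}
    (hη : DifferentiableAt ℝ η x) (hθ : DifferentiableAt ℝ θ x) :
    partialDeriv μ (fun x => η x * θ x) x =
      η x * partialDeriv μ θ x + partialDeriv μ η x * θ x := by
  simp only [partialDeriv]
  rw [fderiv_fun_mul hη hθ]
  simp [mul_comm]

theorem partialDeriv_add {μ : Fin d} {η θ : EucSp d → F} {x : EucSp d}
    (hη : DifferentiableAt ℝ η x) (hθ : DifferentiableAt ℝ θ x) :
    partialDeriv μ (fun x => η x + θ x) x = partialDeriv μ η x + partialDeriv μ θ x := by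
  simp only [partialDeriv]
  rw [fderiv_fun_add hη hθ]
  simp

theorem partialDeriv_comp {G : Type*} [NormedAddCommGroup G] [NormedSpace ℝ G] {μ : Fin d}
    {η : EucSp d → F} {x : EucSp d} {L : F → G}
    (hL : DifferentiableAt ℝ L (η x)) (hη : DifferentiableAt ℝ η x) :
    partialDeriv μ (fun x => L (η x)) x = fderiv ℝ L (η x) (partialDeriv μ η x) := by
  simp only [partialDeriv]
  rw [show (fun x => L (η x)) = L ∘ η from rfl, fderiv_comp x hL hη]
  rfl

theorem partialDeriv_clm_comp {G : Type*} [NormedAddCommGroup G] [NormedSpace ℝ G] {μ : Fin d}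
    {η : EucSp d → F} {x : EucSp d} (L : F →L[ℝ] G) (hη : DifferentiableAt ℝ η x) :
    partialDeriv μ (fun x => L (η x)) x = L (partialDeriv μ η x) := by
  rw [partialDeriv_comp L.differentiableAt hη, L.fderiv]

theorem integrable_mul_of_locallyIntegrable {f : EucSp d → ℂ} (hf : LocallyIntegrable f)
    {η : EucSp d → ℂ}
    (hη : Continuous η) (hc : HasCompactSupport η) : Integrable fun x => f x * η x := by
  have := hf.integrable_smul_left_of_hasCompactSupport hη hc
  simpa [mul_comm] using this

theorem locallyIntegrable_norm {f : EucSp d → ℂ} (hf : LocallyIntegrable f) :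
    LocallyIntegrable fun x => ‖f x‖ :=
  hf.mono hf.aestronglyMeasurable.norm (ae_of_all _ fun x => by rw [norm_norm])

theorem aestronglyMeasurable_clm_apply {ν : Measure (EucSp d)} {B : EucSp d → ℂ →L[ℝ] ℂ}
    {g : EucSp d → ℂ} (hB : AEStronglyMeasurable B ν) (hg : AEStronglyMeasurable g ν) :
    AEStronglyMeasurable (fun x => B x (g x)) ν :=
  (continuous_fst.clm_apply continuous_snd).comp_aestronglyMeasurable (hB.prodMk hg)

/-- `g` is the weak partial derivative `∂_μ f`. -/
def HasWeakPartial (μ : Fin d) (f g : EucSp d → ℂ) : Prop :=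
  ∀ η : EucSp d → ℂ, ContDiff ℝ ∞ η → HasCompactSupport η →
    ∫ x, f x * partialDeriv μ η x = -∫ x, g x * η x

theorem hasWeakPartial_of_contDiff {μ : Fin d} {f : EucSp d → ℂ} (hf : ContDiff ℝ 1 f) :
    HasWeakPartial μ f (partialDeriv μ f) := by
  intro η h1 h2
  have hη : Continuous (partialDeriv μ η) := continuous_partialDeriv (h1.of_le (by simp))
  refine integral_mul_fderiv_eq_neg_fderiv_mul_of_integrable (𝕜 := ℂ) ?_ ?_ ?_
    (fun x _ => (hf.differentiable (by simp)) x) (fun x _ => (h1.differentiable (by simp)) x)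
  · exact integrable_mul_of_locallyIntegrable
      (continuous_partialDeriv (μ := μ) hf).locallyIntegrable h1.continuous h2
  · exact integrable_mul_of_locallyIntegrable hf.continuous.locallyIntegrable hη
      (hasCompactSupport_partialDeriv h2)
  · exact integrable_mul_of_locallyIntegrable hf.continuous.locallyIntegrable h1.continuous h2

/-- The mollification and its derivatives at a point are given by pairing with a test function. -/
theorem exists_mollify_kernel (n : ℕ) (x : EucSp d) : ∃ η : EucSp d → ℂ, ContDiff ℝ ∞ η ∧
    HasCompactSupport η ∧ (∀ f : EucSp d → ℂ, mollify n f x = ∫ y, f y * η y) ∧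
    ∀ (μ : Fin d) (f : EucSp d → ℂ), LocallyIntegrable f →
      partialDeriv μ (mollify n f) x = -∫ y, f y * partialDeriv μ η y := by
  have hρ : ContDiff ℝ ∞ (mollKernel d n) := contDiff_mollKernel n
  refine ⟨fun y => ((mollKernel d n (x - y) : ℝ) : ℂ),
    Complex.ofRealCLM.contDiff.comp (hρ.comp (contDiff_const.sub contDiff_id)), ?_, fun f => ?_,
    fun μ f hf => ?_⟩
  · have : HasCompactSupport fun y => mollKernel d n (x - y) :=
      (hasCompactSupport_mollKernel n).comp_homeomorph (Homeomorph.subLeft x)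
    exact this.comp_left (g := fun r : ℝ => (r : ℂ)) rfl
  · rw [mollify_apply']
    exact integral_congr_ae (ae_of_all _ fun y => by simp [mul_comm])
  have hd := (hasCompactSupport_mollKernel (d := d) n).hasFDerivAt_convolution_left
    (ContinuousLinearMap.lsmul ℝ ℝ : ℝ →L[ℝ] ℂ →L[ℝ] ℂ) (hρ.of_le (by simp)) hf x
  have e1 : partialDeriv μ (mollify n f) x =
      ∫ y, f y * ((partialDeriv μ (mollKernel d n) (x - y) : ℝ) : ℂ) := by
    rw [partialDeriv, mollify, hd.fderiv, convolution_eq_swap]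
    have hi : Integrable fun t => ((ContinuousLinearMap.lsmul ℝ ℝ : ℝ →L[ℝ] ℂ →L[ℝ] ℂ).precompL
        (EucSp d)) (fderiv ℝ (mollKernel d n) (x - t)) (f t) := by
      have := ((hasCompactSupport_mollKernel (d := d) n).fderiv (𝕜 := ℝ)).convolutionExists_left
        ((ContinuousLinearMap.lsmul ℝ ℝ : ℝ →L[ℝ] ℂ →L[ℝ] ℂ).precompL (EucSp d))
        (hρ.continuous_fderiv (by simp)) hf x
      exact this.integrable_swap
    rw [ContinuousLinearMap.integral_apply hi]
    refine integral_congr_ae (ae_of_all _ fun t => ?_)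
    simp [ContinuousLinearMap.precompL_apply, partialDeriv, mul_comm]
  rw [e1, ← integral_neg]
  refine integral_congr_ae (ae_of_all _ fun y => ?_)
  have hd1 : DifferentiableAt ℝ (fun y => mollKernel d n (x - y)) y :=
    ((hρ.differentiable (by simp)) _).comp y (by fun_prop)
  have e := partialDeriv_clm_comp (μ := μ) Complex.ofRealCLM hd1
  simp only [Complex.ofRealCLM_apply] at e
  have e2 : partialDeriv μ (fun y => mollKernel d n (x - y)) y =
      -partialDeriv μ (mollKernel d n) (x - y) := by
    have hd2 : HasFDerivAt (fun y : EucSp d => x - y) (-ContinuousLinearMap.id ℝ (EucSp d)) y :=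
      (hasFDerivAt_id y).const_sub x
    have hd3 : HasFDerivAt (mollKernel d n) (fderiv ℝ (mollKernel d n) (x - y)) (x - y) :=
      ((hρ.differentiable (by simp)) _).hasFDerivAt
    have hd4 : HasFDerivAt (fun y => mollKernel d n (x - y)) _ y := hd3.comp y hd2
    simp only [partialDeriv]
    rw [hd4.fderiv]
    simp
  dsimp only
  rw [e, e2, Complex.ofReal_neg, mul_neg, neg_neg]

/-- Differentiation commutes with mollification. -/
theorem partialDeriv_mollify {μ : Fin d} {f g : EucSp d → ℂ} (hf : LocallyIntegrable f)
    (h : HasWeakPartial μ f g) (n : ℕ) (x : EucSp d) :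
    partialDeriv μ (mollify n f) x = mollify n g x := by
  obtain ⟨η, h1, h2, h3, h4⟩ := exists_mollify_kernel n x
  rw [h4 μ f hf, h3 g, h η h1 h2, neg_neg]

/-- `v` is the weak divergence of the vector field `G`. -/
def HasWeakDiv (G : Fin d → EucSp d → ℂ) (v : EucSp d → ℂ) : Prop :=
  ∀ η : EucSp d → ℂ, ContDiff ℝ ∞ η → HasCompactSupport η →
    ∑ μ, ∫ x, G μ x * partialDeriv μ η x = -∫ x, v x * η x

theorem sum_partialDeriv_mollify {G : Fin d → EucSp d → ℂ} {v : EucSp d → ℂ}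
    (hG : ∀ μ, LocallyIntegrable (G μ)) (h : HasWeakDiv G v) (n : ℕ) (x : EucSp d) :
    ∑ μ, partialDeriv μ (mollify n (G μ)) x = mollify n v x := by
  obtain ⟨η, h1, h2, h3, h4⟩ := exists_mollify_kernel n x
  simp only [fun μ => h4 μ _ (hG μ)]
  rw [Finset.sum_neg_distrib, h3 v, h η h1 h2, neg_neg]

/-- Convergence in `L¹` on all compact sets. -/
def TendstoL1Loc (f : ℕ → EucSp d → ℂ) (g : EucSp d → ℂ) : Prop :=
  ∀ K : Set (EucSp d), IsCompact K →
    Tendsto (fun n => eLpNorm (f n - g) 1 (volume.restrict K)) atTop (𝓝 0)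

theorem tendsto_integral_mul_test {f : ℕ → EucSp d → ℂ} {g : EucSp d → ℂ}
    (hf : ∀ n, LocallyIntegrable (f n)) (hg : LocallyIntegrable g) (h : TendstoL1Loc f g)
    {η : EucSp d → ℂ} (hη : Continuous η) (hc : HasCompactSupport η) :
    Tendsto (fun n => ∫ x, f n x * η x) atTop (𝓝 (∫ x, g x * η x)) := by
  obtain ⟨C, hC⟩ := hη.bounded_above_of_compact_support hc
  have hset : ∀ u : EucSp d → ℂ, ∫ x in tsupport η, u x * η x = ∫ x, u x * η x := fun u =>
    setIntegral_eq_integral_of_forall_compl_eq_zero fun x hx => by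
      rw [image_eq_zero_of_notMem_tsupport hx, mul_zero]
  simp only [← hset]
  refine tendsto_integral_of_L1 _
    (integrable_mul_of_locallyIntegrable hg hη hc).aestronglyMeasurable.restrict
    (Eventually.of_forall fun n =>
      (integrable_mul_of_locallyIntegrable (hf n) hη hc).integrableOn) ?_
  have h0 := ENNReal.Tendsto.const_mul (a := ENNReal.ofReal C) (h _ hc)
    (Or.inr ENNReal.ofReal_ne_top)
  rw [mul_zero] at h0
  refine tendsto_of_tendsto_of_tendsto_of_le_of_le tendsto_const_nhds h0 (fun _ => zero_le)
    fun n => ?_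
  rw [← eLpNorm_one_eq_lintegral_enorm]
  refine eLpNorm_le_mul_eLpNorm_of_ae_le_mul (ae_of_all _ fun x => ?_) 1
  rw [← sub_mul, norm_mul, mul_comm, Pi.sub_apply]
  gcongr
  exact hC x

theorem HasWeakPartial.of_tendsto {μ : Fin d} {f f' : ℕ → EucSp d → ℂ} {g g' : EucSp d → ℂ}
    (hf : ∀ n, LocallyIntegrable (f n)) (hf' : ∀ n, LocallyIntegrable (f' n))
    (hg : LocallyIntegrable g) (hg' : LocallyIntegrable g')
    (h : ∀ n, HasWeakPartial μ (f n) (f' n)) (hl : TendstoL1Loc f g) (hl' : TendstoL1Loc f' g') :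
    HasWeakPartial μ g g' := by
  intro η h1 h2
  have t1 := tendsto_integral_mul_test hf hg hl
    (continuous_partialDeriv (μ := μ) (h1.of_le (by simp))) (hasCompactSupport_partialDeriv h2)
  have t2 := (tendsto_integral_mul_test hf' hg' hl' h1.continuous h2).neg
  simp only [h _ η h1 h2] at t1
  exact tendsto_nhds_unique t1 t2

theorem memLp_one_restrict {f : EucSp d → ℂ} (hf : LocallyIntegrable f) (K : Set (EucSp d))
    (hK : IsCompact K) : MemLp f 1 (volume.restrict K) :=
  memLp_one_iff_integrable.2 (hf.integrableOn_isCompact hK)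

theorem tendstoL1Loc_mollify {f : EucSp d → ℂ} (hf : LocallyIntegrable f) :
    TendstoL1Loc (fun n => mollify n f) f := fun _ hK =>
  tendsto_eLpNorm_mollify_sub_restrict le_rfl (by simp) (memLp_one_restrict hf) hK

/-- The chain rule for weak derivatives and functions of class `C¹` with bounded derivative. -/
theorem HasWeakPartial.comp {μ : Fin d} {f g : EucSp d → ℂ} (hf : LocallyIntegrable f)
    (hg : LocallyIntegrable g) (h : HasWeakPartial μ f g) {L : ℂ → ℂ} (hL : ContDiff ℝ 1 L) {C : ℝ}
    (hC : ∀ z, ‖fderiv ℝ L z‖ ≤ C) :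
    LocallyIntegrable (fun x => L (f x)) ∧ LocallyIntegrable (fun x => fderiv ℝ L (f x) (g x)) ∧
    HasWeakPartial μ (fun x => L (f x)) (fun x => fderiv ℝ L (f x) (g x)) := by
  have hC0 : 0 ≤ C := (norm_nonneg _).trans (hC 0)
  have hlip : ∀ z w, ‖L z - L w‖ ≤ C * ‖z - w‖ := fun z w =>
    Convex.norm_image_sub_le_of_norm_fderiv_le (fun x _ => (hL.differentiable (by simp)) x)
      (fun x _ => hC x) convex_univ (mem_univ w) (mem_univ z)
  have hfd : Continuous (fderiv ℝ L) := hL.continuous_fderiv (by simp)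
  have m1 : AEStronglyMeasurable (fun x => L (f x)) volume :=
    hL.continuous.comp_aestronglyMeasurable hf.aestronglyMeasurable
  have m2 : AEStronglyMeasurable (fun x => fderiv ℝ L (f x) (g x)) volume :=
    aestronglyMeasurable_clm_apply (hfd.comp_aestronglyMeasurable hf.aestronglyMeasurable)
      hg.aestronglyMeasurable
  have i1 : LocallyIntegrable (fun x => L (f x)) := by
    have hsum : LocallyIntegrable (fun x => (‖L 0‖ : ℝ) + C * ‖f x‖) :=
      (locallyIntegrable_const _).add ((locallyIntegrable_norm hf).smul C)
    refine hsum.mono m1 (ae_of_all _ fun x => ?_)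
    rw [Real.norm_of_nonneg (by positivity)]
    have := hlip (f x) 0
    rw [sub_zero] at this
    have h2 := norm_le_norm_add_norm_sub' (L (f x)) (L 0)
    linarith
  have i2 : LocallyIntegrable (fun x => fderiv ℝ L (f x) (g x)) := by
    refine ((locallyIntegrable_norm hg).smul C).mono m2 (ae_of_all _ fun x => ?_)
    rw [Pi.smul_apply, smul_eq_mul, Real.norm_of_nonneg (by positivity)]
    exact (ContinuousLinearMap.le_opNorm _ _).trans (by gcongr; exact hC _)
  refine ⟨i1, i2, ?_⟩
  -- the classical chain rule holds for the mollifications of `f`, and both sides converge in `L¹`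
  -- locally
  have hm : ∀ n, ContDiff ℝ ∞ (mollify n f) := fun n => contDiff_mollify n hf
  have hmg : ∀ n, ContDiff ℝ ∞ (mollify n g) := fun n => contDiff_mollify n hg
  have hcomp : ∀ n, ContDiff ℝ 1 fun x => L (mollify n f x) := fun n =>
    hL.comp ((hm n).of_le (by simp))
  have hder : ∀ n, partialDeriv μ (fun x => L (mollify n f x)) =
      fun x => fderiv ℝ L (mollify n f x) (mollify n g x) := fun n => by
    ext x
    rw [partialDeriv_comp ((hL.differentiable (by simp)) _) (((hm n).differentiable (by simp)) x),
      partialDeriv_mollify hf h]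
  have hcont : ∀ n, Continuous fun x => fderiv ℝ L (mollify n f x) (mollify n g x) := fun n =>
    (hfd.comp (hm n).continuous).clm_apply (hmg n).continuous
  refine HasWeakPartial.of_tendsto (f := fun n x => L (mollify n f x))
    (f' := fun n x => fderiv ℝ L (mollify n f x) (mollify n g x))
    (fun n => (hcomp n).continuous.locallyIntegrable) (fun n => (hcont n).locallyIntegrable) i1 i2
    (fun n => hder n ▸ hasWeakPartial_of_contDiff (hcomp n)) ?_ ?_
  · intro K hK
    have h0 := ENNReal.Tendsto.const_mul (a := ENNReal.ofReal C) (tendstoL1Loc_mollify hf K hK)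
      (Or.inr ENNReal.ofReal_ne_top)
    rw [mul_zero] at h0
    refine tendsto_of_tendsto_of_tendsto_of_le_of_le tendsto_const_nhds h0 (fun _ => zero_le)
      fun n => ?_
    exact eLpNorm_le_mul_eLpNorm_of_ae_le_mul (ae_of_all _ fun x => hlip _ _) 1
  · intro K hK
    have h0 := ENNReal.Tendsto.const_mul (a := ENNReal.ofReal C) (tendstoL1Loc_mollify hg K hK)
      (Or.inr ENNReal.ofReal_ne_top)
    rw [mul_zero] at h0
    have hfr : AEStronglyMeasurable f (volume.restrict K) := hf.aestronglyMeasurable.restrict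
    have hgr : AEStronglyMeasurable g (volume.restrict K) := hg.aestronglyMeasurable.restrict
    have hA : ∀ n, AEStronglyMeasurable (fun x => fderiv ℝ L (mollify n f x) (g x))
        (volume.restrict K) := fun n =>
      aestronglyMeasurable_clm_apply (hfd.comp (hm n).continuous).aestronglyMeasurable hgr
    -- `L'(fₙ) g` converges by dominated convergence, as `fₙ` converges almost everywhere
    have h1 : Tendsto (fun n => eLpNorm ((fun x => fderiv ℝ L (mollify n f x) (g x)) -
        fun x => fderiv ℝ L (f x) (g x)) 1 (volume.restrict K)) atTop (𝓝 0) := by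
      refine tendsto_eLpNorm_sub_of_dominated (b := fun x => C * ‖g x‖) (by simp) (by simp) hA
        ((memLp_one_restrict hg K hK).norm.const_mul C) (fun n => ae_of_all _ fun x => ?_) ?_
      · exact (ContinuousLinearMap.le_opNorm _ _).trans (by gcongr; exact hC _)
      · filter_upwards [ae_restrict_of_ae (ae_tendsto_mollify hf)] with x hx
        exact ((ContinuousLinearMap.apply ℝ ℂ (g x)).continuous.tendsto _).comp
          ((hfd.tendsto _).comp hx)
    have hs := h0.add h1
    rw [add_zero] at hs
    refine tendsto_of_tendsto_of_tendsto_of_le_of_le tendsto_const_nhds hs (fun _ => zero_le)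
      fun n => ?_
    have e : (fun x => fderiv ℝ L (mollify n f x) (mollify n g x)) -
        (fun x => fderiv ℝ L (f x) (g x)) =
        (fun x => fderiv ℝ L (mollify n f x) ((mollify n g - g) x)) +
        ((fun x => fderiv ℝ L (mollify n f x) (g x)) - fun x => fderiv ℝ L (f x) (g x)) := by
      ext x; simp
    dsimp only
    rw [e]
    refine (eLpNorm_add_le ?_ ((hA n).sub m2.restrict) le_rfl).trans ?_
    · exact aestronglyMeasurable_clm_apply (hfd.comp (hm n).continuous).aestronglyMeasurable
        ((hmg n).continuous.aestronglyMeasurable.sub hgr)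
    · gcongr
      refine eLpNorm_le_mul_eLpNorm_of_ae_le_mul (ae_of_all _ fun x => ?_) 1
      exact (ContinuousLinearMap.le_opNorm _ _).trans (by gcongr; exact hC _)

/-- The product rule with a smooth factor. -/
theorem HasWeakPartial.mul_smooth {μ : Fin d} {f g : EucSp d → ℂ} (hf : LocallyIntegrable f)
    (hg : LocallyIntegrable g) (h : HasWeakPartial μ f g) {χ : EucSp d → ℂ} (hχ : ContDiff ℝ ∞ χ) :
    HasWeakPartial μ (fun x => χ x * f x) (fun x => χ x * g x + partialDeriv μ χ x * f x) := by
  intro η h1 h2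
  have hχc := hχ.continuous
  have hχ' : Continuous (partialDeriv μ χ) := continuous_partialDeriv (hχ.of_le (by simp))
  have hη' : Continuous (partialDeriv μ η) := continuous_partialDeriv (h1.of_le (by simp))
  have h3 : HasCompactSupport fun x => χ x * η x := h2.mul_left
  have e := h (fun x => χ x * η x) (hχ.mul h1) h3
  have e1 : ∀ x, f x * partialDeriv μ (fun x => χ x * η x) x =
      χ x * f x * partialDeriv μ η x + partialDeriv μ χ x * f x * η x := fun x => by
    rw [partialDeriv_mul ((hχ.differentiable (by simp)) x) ((h1.differentiable (by simp)) x)]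
    ring
  have i1 : Integrable fun x => χ x * f x * partialDeriv μ η x := by
    have := integrable_mul_of_locallyIntegrable hf (hχc.mul hη')
      (hasCompactSupport_partialDeriv h2).mul_left
    refine this.congr (ae_of_all _ fun x => ?_)
    simp only [Pi.mul_apply]; ring
  have i2 : Integrable fun x => partialDeriv μ χ x * f x * η x := by
    have := integrable_mul_of_locallyIntegrable hf (hχ'.mul h1.continuous) h2.mul_left
    refine this.congr (ae_of_all _ fun x => ?_)
    simp only [Pi.mul_apply]; ring
  have i3 : Integrable fun x => χ x * g x * η x := by
    have := integrable_mul_of_locallyIntegrable hg (hχc.mul h1.continuous) h2.mul_left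
    refine this.congr (ae_of_all _ fun x => ?_)
    simp only [Pi.mul_apply]; ring
  simp only [e1] at e
  rw [integral_add i1 i2] at e
  have e2 : ∫ x, g x * (χ x * η x) = ∫ x, χ x * g x * η x :=
    integral_congr_ae (ae_of_all _ fun x => by ring)
  simp only [add_mul]
  rw [integral_add i3 i2, neg_add, ← e2, ← e]
  ring

end Weak

/-! ### The covariant derivatives as a closed operator -/

section Cov

variable {d : ℕ} {a : EucSp d → EucSp d}

theorem MemLpLocal.locallyIntegrable {b : EucSp d → ℝ} {p : ℝ≥0∞} (hp : 1 ≤ p)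
    (hb : MemLpLocal b p) : LocallyIntegrable b :=
  locallyIntegrable_iff.2 fun K hK =>
    have : IsFiniteMeasure (volume.restrict K) := ⟨by simpa using hK.measure_lt_top⟩
    (hb K hK).integrable hp

theorem MemLpLocal.aestronglyMeasurable {b : EucSp d → ℝ} {p : ℝ≥0∞} (hp : 1 ≤ p)
    (hb : MemLpLocal b p) : AEStronglyMeasurable b :=
  (hb.locallyIntegrable hp).aestronglyMeasurable

theorem AssumptionA1.aestronglyMeasurable (ha : AssumptionA1 a) (μ : Fin d) :
    AEStronglyMeasurable (fun x => (a x μ : ℂ)) :=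
  Complex.continuous_ofReal.comp_aestronglyMeasurable
    ((ha μ).aestronglyMeasurable (by norm_num))

theorem AssumptionA1.locallyIntegrable_mul (ha : AssumptionA1 a) (μ : Fin d) {f : EucSp d → ℂ}
    (hf : MemLp f 2) : LocallyIntegrable fun x => (a x μ : ℂ) * f x :=
  locallyIntegrable_iff.2 fun K hK =>
    MemLp.integrable_mul (p := 2) (q := 2) (ha μ K hK).ofReal (hf.restrict K)

/-- The function `g` is the covariant derivative `D_μ f = -i ∂_μ f - a_μ f`, and both `f` and `g`
are square integrable. -/
structure IsCovDeriv (a : EucSp d → EucSp d) (μ : Fin d) (f g : EucSp d → ℂ) : Prop where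
  memLp : MemLp f 2
  memLp' : MemLp g 2
  weak : HasWeakPartial μ f fun x => Complex.I * (g x + a x μ * f x)

theorem HasWeakPartial.congr_ae {μ : Fin d} {f f' g g' : EucSp d → ℂ} (h : HasWeakPartial μ f g)
    (hf : f =ᵐ[volume] f') (hg : g =ᵐ[volume] g') : HasWeakPartial μ f' g' := by
  intro η h1 h2
  have e1 : ∫ x, f' x * partialDeriv μ η x = ∫ x, f x * partialDeriv μ η x :=
    integral_congr_ae (hf.mono fun x hx => by simp only [hx])
  have e2 : ∫ x, g' x * η x = ∫ x, g x * η x :=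
    integral_congr_ae (hg.mono fun x hx => by simp only [hx])
  rw [e1, e2, h η h1 h2]

theorem IsCovDeriv.congr_ae {μ : Fin d} {f f' g g' : EucSp d → ℂ} (h : IsCovDeriv a μ f g)
    (hf : f =ᵐ[volume] f') (hg : g =ᵐ[volume] g') : IsCovDeriv a μ f' g' where
  memLp := h.memLp.ae_eq hf
  memLp' := h.memLp'.ae_eq hg
  weak := h.weak.congr_ae hf (by filter_upwards [hf, hg] with x h1 h2; rw [h1, h2])

theorem IsCovDeriv.locallyIntegrable {μ : Fin d} {f g : EucSp d → ℂ} (ha : AssumptionA1 a)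
    (h : IsCovDeriv a μ f g) :
    LocallyIntegrable f ∧ LocallyIntegrable fun x => Complex.I * (g x + a x μ * f x) := by
  refine ⟨h.memLp.locallyIntegrable (by norm_num), ?_⟩
  have := ((h.memLp'.locallyIntegrable (by norm_num)).add (ha.locallyIntegrable_mul μ h.memLp)).smul
    Complex.I
  exact this

theorem mem_covDerivGraph_iff (ha : AssumptionA1 a) (μ : Fin d) (f g : L2Sp d) :
    (f, g) ∈ covDerivGraph a ha μ ↔ IsCovDeriv a μ f g := by
  have key : ∀ η : EucSp d → ℂ, ContDiff ℝ ∞ η → HasCompactSupport η →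
      ∫ x, Complex.I * (g x + a x μ * f x) * η x =
        Complex.I * ((∫ x, g x * η x) + ∫ x, f x * (a x μ * η x)) := by
    intro η h1 h2
    rw [← integral_add (integrable_mul_test g h1.continuous h2)
      (integrable_mul_of_hasCompactSupport f (ha μ) h1.continuous h2), ← integral_const_mul]
    exact integral_congr_ae (ae_of_all _ fun x => by ring)
  constructor
  · intro h
    refine ⟨Lp.memLp f, Lp.memLp g, fun η h1 h2 => ?_⟩
    have e : Complex.I * (∫ x, f x * partialDeriv μ η x) - ∫ x, f x * (a x μ * η x) =
      ∫ x, g x * η x := h η h1 h2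
    rw [key η h1 h2, ← e]
    linear_combination (∫ x, f x * partialDeriv μ η x) * Complex.I_mul_I
  · intro h η h1 h2
    have e := h.weak η h1 h2
    rw [key η h1 h2] at e
    dsimp only
    rw [e]
    linear_combination (-(∫ x, g x * η x) - ∫ x, f x * (a x μ * η x)) * Complex.I_mul_I

theorem mem_covDerivGraph_toLp_iff (ha : AssumptionA1 a) (μ : Fin d) {f g : EucSp d → ℂ}
    (hf : MemLp f 2 volume) (hg : MemLp g 2 volume) :
    (hf.toLp f, hg.toLp g) ∈ covDerivGraph a ha μ ↔ IsCovDeriv a μ f g := by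
  rw [mem_covDerivGraph_iff]
  exact ⟨fun h => h.congr_ae (MemLp.coeFn_toLp hf) (MemLp.coeFn_toLp hg),
    fun h => h.congr_ae (MemLp.coeFn_toLp hf).symm (MemLp.coeFn_toLp hg).symm⟩

theorem covDerivGraph_functional (ha : AssumptionA1 a) (μ : Fin d) {g : L2Sp d}
    (h : ((0 : L2Sp d), g) ∈ covDerivGraph a ha μ) : g = 0 := by
  rw [Lp.eq_zero_iff_ae_eq_zero]
  refine ae_eq_zero_of_integral_contDiff_smul_eq_zero
    ((Lp.memLp g).locallyIntegrable (by norm_num)) fun η h1 h2 => ?_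
  have e := h (fun x => (η x : ℂ)) (Complex.ofRealCLM.contDiff.comp h1)
    (h2.comp_left (g := fun r : ℝ => (r : ℂ)) rfl)
  have h0 : ∀ u : EucSp d → ℂ, ∫ x, (0 : L2Sp d) x * u x = 0 := fun u => by
    refine integral_eq_zero_of_ae ?_
    filter_upwards [Lp.coeFn_zero ℂ 2 (volume : Measure (EucSp d))] with x hx
    rw [hx, Pi.zero_apply, zero_mul]
  simp only [h0, mul_zero, sub_zero] at e
  rw [e]
  exact integral_congr_ae (ae_of_all _ fun x => by simp [mul_comm])

theorem continuous_integral_mul {u : EucSp d → ℂ} (hu : MemLp u 2) :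
    Continuous fun f : L2Sp d => ∫ x, f x * u x := by
  have hs : MemLp (fun x => star (u x)) 2 := hu.star
  have e : (fun f : L2Sp d => ∫ x, f x * u x) = fun f => ⟪hs.toLp _, f⟫_ℂ := by
    ext f
    rw [L2.inner_def]
    refine integral_congr_ae ?_
    filter_upwards [hs.coeFn_toLp] with x hx
    rw [hx]
    simp [RCLike.inner_apply]
  rw [e]
  exact continuous_const.inner continuous_id

theorem isClosed_covDerivGraph (ha : AssumptionA1 a) (μ : Fin d) :
    IsClosed (covDerivGraph a ha μ : Set (L2Sp d × L2Sp d)) := by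
  have e : (covDerivGraph a ha μ : Set (L2Sp d × L2Sp d)) =
      ⋂ (η : EucSp d → ℂ) (_ : ContDiff ℝ ∞ η) (_ : HasCompactSupport η),
        {p | Complex.I * (∫ x, p.1 x * partialDeriv μ η x) - ∫ x, p.1 x * (a x μ * η x) =
          ∫ x, p.2 x * η x} := by
    ext p
    simp only [mem_iInter]
    rfl
  rw [e]
  refine isClosed_iInter fun η => isClosed_iInter fun h1 => isClosed_iInter fun h2 => ?_
  have m1 : MemLp (partialDeriv μ η) 2 :=
    (continuous_partialDeriv (h1.of_le (by simp))).memLp_of_hasCompactSupport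
      (hasCompactSupport_partialDeriv h2)
  have m2 : MemLp η 2 := h1.continuous.memLp_of_hasCompactSupport h2
  have m3 : MemLp (fun x => (a x μ : ℂ) * η x) 2 := by
    have hK : IsCompact (tsupport η) := h2
    have h3 : MemLp (fun x => (a x μ : ℂ) * η x) 2 (volume.restrict (tsupport η)) :=
      MemLp.mul (p := 2) (q := ⊤)
        ((h1.continuous.memLp_top_of_hasCompactSupport h2 volume).restrict _) (ha μ _ hK).ofReal
    have h4 := (memLp_indicator_iff_restrict hK.measurableSet).2 h3
    have h5 : (tsupport η).indicator (fun x => (a x μ : ℂ) * η x) = fun x => (a x μ : ℂ) * η x :=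
      indicator_eq_self.2 fun x hx => by
        by_contra h6
        exact hx (by simp [image_eq_zero_of_notMem_tsupport h6])
    rwa [h5] at h4
  exact isClosed_eq ((continuous_const.mul ((continuous_integral_mul m1).comp continuous_fst)).sub
    ((continuous_integral_mul m3).comp continuous_fst))
    ((continuous_integral_mul m2).comp continuous_snd)

theorem mem_covDeriv_graph_iff (ha : AssumptionA1 a) (μ : Fin d) (p : L2Sp d × L2Sp d) :
    p ∈ (covDeriv a ha μ).graph ↔ p ∈ covDerivGraph a ha μ := by
  rw [covDeriv, Submodule.toLinearPMap_graph_eq]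
  rintro ⟨x, y⟩ hx h0
  obtain rfl : x = 0 := h0
  exact covDerivGraph_functional ha μ hx

/-- The space `L²(ℝᵈ; ℂᵈ)`, as the Hilbert sum of `d` copies of `L²(ℝᵈ; ℂ)`. -/
abbrev L2Vec (d : ℕ) : Type := PiLp 2 fun _ : Fin d => L2Sp d

/-- The graph of the covariant gradient `f ↦ (D_μ f)_μ`. -/
def covGradGraph (a : EucSp d → EucSp d) (ha : AssumptionA1 a) :
    Submodule ℂ (L2Sp d × L2Vec d) :=
  ⨅ μ, (covDerivGraph a ha μ).comap
    (LinearMap.id.prodMap (PiLp.proj 2 (fun _ : Fin d => L2Sp d) μ).toLinearMap)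

theorem mem_covGradGraph (ha : AssumptionA1 a) (p : L2Sp d × L2Vec d) :
    p ∈ covGradGraph a ha ↔ ∀ μ, (p.1, p.2 μ) ∈ covDerivGraph a ha μ := by
  rw [covGradGraph, Submodule.mem_iInf]
  rfl

/-- The covariant gradient `f ↦ (D_μ f)_μ` with its maximal domain `Q(q)`. -/
def covGrad (a : EucSp d → EucSp d) (ha : AssumptionA1 a) : L2Sp d →ₗ.[ℂ] L2Vec d :=
  (covGradGraph a ha).toLinearPMap

theorem mem_covGradGraph_iff (ha : AssumptionA1 a) (f : L2Sp d) (g : L2Vec d) :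
    (f, g) ∈ covGradGraph a ha ↔ ∀ μ, IsCovDeriv a μ f (g μ) :=
  (mem_covGradGraph ha _).trans (forall_congr' fun μ => mem_covDerivGraph_iff ha μ f (g μ))

theorem mem_covGrad_graph_iff (ha : AssumptionA1 a) (p : L2Sp d × L2Vec d) :
    p ∈ (covGrad a ha).graph ↔ p ∈ covGradGraph a ha := by
  rw [covGrad, Submodule.toLinearPMap_graph_eq]
  rintro ⟨x, y⟩ hx h0
  obtain rfl : x = 0 := h0
  ext1 μ
  exact covDerivGraph_functional ha μ ((mem_covGradGraph ha _).1 hx μ)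

theorem covGrad_isClosed (ha : AssumptionA1 a) : (covGrad a ha).IsClosed := by
  have e : ((covGrad a ha).graph : Set (L2Sp d × L2Vec d)) =
      ⋂ μ, (fun p : L2Sp d × L2Vec d => (p.1, p.2 μ)) ⁻¹' (covDerivGraph a ha μ) := by
    ext p
    simp only [mem_iInter]
    exact (mem_covGrad_graph_iff ha p).trans (mem_covGradGraph ha p)
  rw [LinearPMap.IsClosed, e]
  exact isClosed_iInter fun μ => (isClosed_covDerivGraph ha μ).preimage
    (continuous_fst.prodMk ((PiLp.continuous_apply 2 _ μ).comp continuous_snd))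

theorem mem_magneticFormDomain_iff (ha : AssumptionA1 a) (f : L2Sp d) :
    f ∈ magneticFormDomain a ha ↔ ∃ g, (f, g) ∈ covGradGraph a ha := by
  rw [magneticFormDomain, Submodule.mem_iInf]
  constructor
  · intro h
    refine ⟨WithLp.toLp 2 fun μ => covDeriv a ha μ ⟨f, h μ⟩, (mem_covGradGraph ha _).2 fun μ => ?_⟩
    exact (mem_covDeriv_graph_iff ha μ _).1 (LinearPMap.mem_graph _ ⟨f, h μ⟩)
  · rintro ⟨g, hg⟩ μ
    exact LinearPMap.mem_domain_of_mem_graph ((mem_covDeriv_graph_iff ha μ _).2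
      ((mem_covGradGraph ha _).1 hg μ))

theorem magneticForm_eq (ha : AssumptionA1 a) {f f' : magneticFormDomain a ha} {g g' : L2Vec d}
    (h : ((f : L2Sp d), g) ∈ covGradGraph a ha) (h' : ((f' : L2Sp d), g') ∈ covGradGraph a ha) :
    magneticForm a ha f f' = (1 / 2) * ⟪g, g'⟫_ℂ := by
  have key : ∀ (f : magneticFormDomain a ha) (g : L2Vec d)
      (_ : ((f : L2Sp d), g) ∈ covGradGraph a ha)
      (μ : Fin d), covDeriv a ha μ ⟨f, mem_domain_covDeriv f.2 μ⟩ = g μ := fun f g h μ =>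
    (LinearPMap.mem_graph_iff' _).1 ((mem_covDeriv_graph_iff ha μ _).2
      ((mem_covGradGraph ha _).1 h μ)) |>.elim fun y hy => by
        obtain ⟨e1, e2⟩ := Prod.mk.inj hy
        dsimp only at e2
        rw [← e2]
        congr 1
        exact Subtype.ext e1.symm
  rw [magneticForm, PiLp.inner_apply]
  simp only [key f g h, key f' g' h']

/-- The operator associated with the form in terms of the covariant gradient. -/
theorem mem_magneticGraph_iff (ha : AssumptionA1 a) (f w : L2Sp d) :
    (f, w) ∈ magneticGraph a ha ↔ ∃ g, (f, g) ∈ covGradGraph a ha ∧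
      ∀ f' g', (f', g') ∈ covGradGraph a ha → ⟪w, f'⟫_ℂ = (1 / 2) * ⟪g, g'⟫_ℂ := by
  constructor
  · rintro ⟨hf, h⟩
    obtain ⟨g, hg⟩ := (mem_magneticFormDomain_iff ha f).1 hf
    refine ⟨g, hg, fun f' g' h' => ?_⟩
    have h3 := h ⟨f', (mem_magneticFormDomain_iff ha f').2 ⟨g', h'⟩⟩
    rwa [magneticForm_eq ha (f := ⟨f, hf⟩) hg h'] at h3
  · rintro ⟨g, hg, h⟩
    refine ⟨(mem_magneticFormDomain_iff ha f).2 ⟨g, hg⟩, fun f' => ?_⟩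
    obtain ⟨g', h'⟩ := (mem_magneticFormDomain_iff ha f').1 f'.2
    rw [magneticForm_eq ha (f := ⟨f, _⟩) hg h']
    exact h _ _ h'

end Cov

/-! ### Gauge equivariant nonlinear maps of the values -/

section Radial

theorem deriv_smoothTransition_eq_zero {s : ℝ} (hs : s ∉ Icc (0 : ℝ) 1) :
    deriv Real.smoothTransition s = 0 := by
  rw [mem_Icc, not_and_or, not_le, not_le] at hs
  rcases hs with hs | hs
  · have : Real.smoothTransition =ᶠ[𝓝 s] fun _ => 0 := by
      filter_upwards [Iio_mem_nhds hs] with t ht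
      exact Real.smoothTransition.zero_of_nonpos (le_of_lt ht)
    rw [this.deriv_eq, deriv_const]
  · have : Real.smoothTransition =ᶠ[𝓝 s] fun _ => 1 := by
      filter_upwards [Ioi_mem_nhds hs] with t ht
      exact Real.smoothTransition.one_of_one_le (le_of_lt ht)
    rw [this.deriv_eq, deriv_const]

theorem contDiff_smoothTransition {n : ℕ∞} : ContDiff ℝ n Real.smoothTransition :=
  Real.smoothTransition.contDiff

theorem exists_deriv_smoothTransition_le : ∃ K : ℝ, ∀ s, |deriv Real.smoothTransition s| ≤ K := by
  have hc : Continuous (deriv Real.smoothTransition) :=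
    (contDiff_smoothTransition (n := 1)).continuous_deriv (by simp)
  have hs : HasCompactSupport (deriv Real.smoothTransition) :=
    HasCompactSupport.intro isCompact_Icc fun s hs => deriv_smoothTransition_eq_zero hs
  exact hc.bounded_above_of_compact_support hs

/-- The map `z ↦ τ(α + β |z|²) z` for the smooth step function `τ`. It commutes with rotations, so
that it is compatible with covariant derivatives. -/
def radialMul (α β : ℝ) (z : ℂ) : ℂ := Real.smoothTransition (α + β * ‖z‖ ^ 2) • z

theorem contDiff_radialMul (α β : ℝ) : ContDiff ℝ 1 (radialMul α β) :=
  ((contDiff_smoothTransition (n := 1)).comp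
    (contDiff_const.add (contDiff_const.mul (contDiff_norm_sq ℝ)))).smul contDiff_id

theorem fderiv_radialMul (α β : ℝ) (z w : ℂ) :
    fderiv ℝ (radialMul α β) z w = Real.smoothTransition (α + β * ‖z‖ ^ 2) • w +
      (2 * β * deriv Real.smoothTransition (α + β * ‖z‖ ^ 2) * ⟪z, w⟫_ℝ) • z := by
  have h1 : HasFDerivAt (fun z : ℂ => α + β * ‖z‖ ^ 2) (β • (2 • innerSL ℝ z)) z :=
    (((hasStrictFDerivAt_norm_sq z).hasFDerivAt).const_mul β).const_add α
  have h2 : HasDerivAt Real.smoothTransition (deriv Real.smoothTransition (α + β * ‖z‖ ^ 2))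
      (α + β * ‖z‖ ^ 2) :=
    ((contDiff_smoothTransition (n := 1)).differentiable (by simp) _).hasDerivAt
  have h3 := h2.comp_hasFDerivAt z h1
  have h4 : HasFDerivAt (radialMul α β) _ z := h3.smul (hasFDerivAt_id z)
  rw [h4.fderiv]
  simp only [Function.comp_apply, add_apply, smul_apply, ContinuousLinearMap.id_apply,
    ContinuousLinearMap.smulRight_apply, innerSL_apply_apply, smul_eq_mul, nsmul_eq_mul]
  congr 2
  push_cast
  ring

theorem norm_radialMul_le (α β : ℝ) (z : ℂ) : ‖radialMul α β z‖ ≤ ‖z‖ := by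
  rw [radialMul, norm_smul, Real.norm_of_nonneg (Real.smoothTransition.nonneg _)]
  exact mul_le_of_le_one_left (norm_nonneg _) (Real.smoothTransition.le_one _)

/-- The derivative of `radialMul α β` is bounded uniformly in `β`. -/
theorem exists_fderiv_radialMul_le (α : ℝ) :
    ∃ C : ℝ, ∀ β z, ‖fderiv ℝ (radialMul α β) z‖ ≤ C := by
  obtain ⟨K, hK⟩ := exists_deriv_smoothTransition_le
  refine ⟨1 + 2 * ((1 + |α|) * K), fun β z => ?_⟩
  have hK0 : 0 ≤ K := (abs_nonneg _).trans (hK 0)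
  have key : |β| * ‖z‖ ^ 2 * |deriv Real.smoothTransition (α + β * ‖z‖ ^ 2)| ≤ (1 + |α|) * K := by
    by_cases hs : α + β * ‖z‖ ^ 2 ∈ Icc (0 : ℝ) 1
    · refine mul_le_mul ?_ (hK _) (abs_nonneg _) (by positivity)
      have e : |β| * ‖z‖ ^ 2 = |β * ‖z‖ ^ 2| := by rw [abs_mul, abs_of_nonneg (sq_nonneg ‖z‖)]
      rw [e, abs_le]
      have := abs_le.1 (le_refl |α|)
      constructor <;> linarith [hs.1, hs.2]
    · rw [deriv_smoothTransition_eq_zero hs, abs_zero, mul_zero]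
      positivity
  refine ContinuousLinearMap.opNorm_le_bound _ (by positivity) fun w => ?_
  rw [fderiv_radialMul]
  refine (norm_add_le _ _).trans ?_
  rw [norm_smul, norm_smul, Real.norm_of_nonneg (Real.smoothTransition.nonneg _), add_mul]
  refine add_le_add (by gcongr; exact Real.smoothTransition.le_one _) ?_
  have h1 : |⟪z, w⟫_ℝ| ≤ ‖z‖ * ‖w‖ := abs_real_inner_le_norm z w
  rw [Real.norm_eq_abs, abs_mul, abs_mul, abs_mul, abs_two]
  calc 2 * |β| * |deriv Real.smoothTransition (α + β * ‖z‖ ^ 2)| * |⟪z, w⟫_ℝ| * ‖z‖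
      ≤ 2 * |β| * |deriv Real.smoothTransition (α + β * ‖z‖ ^ 2)| * (‖z‖ * ‖w‖) * ‖z‖ := by gcongr
    _ = 2 * (|β| * ‖z‖ ^ 2 * |deriv Real.smoothTransition (α + β * ‖z‖ ^ 2)|) * ‖w‖ := by ring
    _ ≤ 2 * ((1 + |α|) * K) * ‖w‖ := by gcongr

theorem fderiv_radialMul_rotation (α β : ℝ) (z : ℂ) (r : ℝ) :
    fderiv ℝ (radialMul α β) z (Complex.I * (r * z)) = Complex.I * (r * radialMul α β z) := by
  have h : ⟪z, Complex.I * (r * z)⟫_ℝ = 0 := by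
    rw [Complex.inner]
    simp
    ring
  rw [fderiv_radialMul, h, radialMul]
  simp only [mul_zero, zero_smul, add_zero, Complex.real_smul]
  ring

theorem radialMul_trunc_bdd {β : ℝ} (hβ : 0 < β) (z : ℂ) :
    ‖radialMul 2 (-β) z‖ ≤ 2 / β + 1 := by
  by_cases h : 2 + -β * ‖z‖ ^ 2 ≤ 0
  · rw [radialMul, Real.smoothTransition.zero_of_nonpos h, zero_smul, norm_zero]
    positivity
  · refine (norm_radialMul_le _ _ _).trans ?_
    have h1 : ‖z‖ ^ 2 ≤ 2 / β := by
      rw [le_div_iff₀ hβ]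
      linarith
    nlinarith [sq_nonneg (‖z‖ - 1)]

theorem tendsto_inv_nat_succ : Tendsto (fun n : ℕ => (1 : ℝ) / (n + 1)) atTop (𝓝 0) :=
  tendsto_one_div_add_atTop_nhds_zero_nat

theorem eventually_trunc (z : ℂ) :
    ∀ᶠ n : ℕ in atTop, 1 < 2 + -(1 / ((n : ℝ) + 1)) * ‖z‖ ^ 2 := by
  have h : Tendsto (fun n : ℕ => 2 + -(1 / ((n : ℝ) + 1)) * ‖z‖ ^ 2) atTop
      (𝓝 (2 + -0 * ‖z‖ ^ 2)) :=
    tendsto_const_nhds.add ((tendsto_inv_nat_succ.neg).mul_const _)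
  exact h.eventually (lt_mem_nhds (by norm_num))

theorem tendsto_radialMul_trunc (z : ℂ) :
    Tendsto (fun n : ℕ => radialMul 2 (-(1 / ((n : ℝ) + 1))) z) atTop (𝓝 z) := by
  refine tendsto_const_nhds.congr' ?_
  filter_upwards [eventually_trunc z] with n hn
  rw [radialMul, Real.smoothTransition.one_of_one_le hn.le, one_smul]

theorem tendsto_fderiv_radialMul_trunc (z w : ℂ) :
    Tendsto (fun n : ℕ => fderiv ℝ (radialMul 2 (-(1 / ((n : ℝ) + 1)))) z w) atTop (𝓝 w) := by
  refine tendsto_const_nhds.congr' ?_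
  filter_upwards [eventually_trunc z] with n hn
  rw [fderiv_radialMul, Real.smoothTransition.one_of_one_le hn.le, one_smul,
    deriv_smoothTransition_eq_zero fun h => absurd h.2 (not_le.2 hn)]
  simp

variable {d : ℕ} {a : EucSp d → EucSp d}

theorem measurable_fderiv_radialMul {ν : Measure (EucSp d)} (α β : ℝ) {f g : EucSp d → ℂ}
    (hf : AEStronglyMeasurable f ν) (hg : AEStronglyMeasurable g ν) :
    AEStronglyMeasurable (fun x => fderiv ℝ (radialMul α β) (f x) (g x)) ν :=
  aestronglyMeasurable_clm_apply
    (((contDiff_radialMul α β).continuous_fderiv (by simp)).comp_aestronglyMeasurable hf) hg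

/-- Compatibility of covariant derivatives with `radialMul`. -/
theorem IsCovDeriv.radialMul (ha : AssumptionA1 a) {μ : Fin d} {f g : EucSp d → ℂ}
    (h : IsCovDeriv a μ f g) (α β : ℝ) :
    IsCovDeriv a μ (fun x => radialMul α β (f x))
      (fun x => -Complex.I * fderiv ℝ (_root_.radialMul α β) (f x) (Complex.I * g x)) := by
  obtain ⟨C, hC⟩ := exists_fderiv_radialMul_le α
  have hg : MemLp (fun x => Complex.I * g x) 2 := h.memLp'.const_mul _
  have hm1 := measurable_fderiv_radialMul α β h.memLp.1 hg.1
  refine ⟨h.memLp.mono ((contDiff_radialMul α β).continuous.comp_aestronglyMeasurable h.memLp.1)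
    (ae_of_all _ fun x => norm_radialMul_le α β _), ?_, ?_⟩
  · refine (h.memLp'.norm.const_mul C).mono (hm1.const_mul _) (ae_of_all _ fun x => ?_)
    have hC0 : 0 ≤ C := (norm_nonneg _).trans (hC 0 0)
    rw [norm_mul, norm_neg, Complex.norm_I, one_mul, Real.norm_of_nonneg (by positivity)]
    refine ((fderiv ℝ (_root_.radialMul α β) (f x)).le_of_opNorm_le (hC β _) _).trans_eq ?_
    rw [norm_mul, Complex.norm_I, one_mul]
  · obtain ⟨l1, l2⟩ := h.locallyIntegrable ha
    have := (h.weak.comp l1 l2 (contDiff_radialMul α β) (hC β)).2.2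
    refine this.congr_ae (ae_eq_refl _) (ae_of_all _ fun x => ?_)
    dsimp only
    rw [mul_add, map_add, fderiv_radialMul_rotation]
    linear_combination (fderiv ℝ (_root_.radialMul α β) (f x) (Complex.I * g x)) * Complex.I_mul_I

theorem IsCovDeriv.mul_smooth (ha : AssumptionA1 a) {μ : Fin d} {f g : EucSp d → ℂ}
    (h : IsCovDeriv a μ f g) {χ : EucSp d → ℂ} (hχ : ContDiff ℝ ∞ χ) {C : ℝ}
    (h1 : ∀ x, ‖χ x‖ ≤ C) (h2 : ∀ x, ‖partialDeriv μ χ x‖ ≤ C) :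
    IsCovDeriv a μ (fun x => χ x * f x)
      (fun x => χ x * g x + -Complex.I * (partialDeriv μ χ x * f x)) := by
  have key : ∀ u v : EucSp d → ℂ, Continuous u → (∀ x, ‖u x‖ ≤ C) → MemLp v 2 →
      MemLp (fun x => u x * v x) 2 := fun u v hu hb hv =>
    hv.of_le_mul (hu.aestronglyMeasurable.mul hv.1) (ae_of_all _ fun x => by
      rw [norm_mul]; gcongr; exact hb x)
  have hχ' : Continuous (partialDeriv μ χ) := continuous_partialDeriv (hχ.of_le (by simp))
  refine ⟨key _ _ hχ.continuous h1 h.memLp, (key _ _ hχ.continuous h1 h.memLp').add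
    ((key _ _ hχ' h2 h.memLp).const_mul _), ?_⟩
  obtain ⟨l1, l2⟩ := h.locallyIntegrable ha
  refine (h.weak.mul_smooth l1 l2 hχ).congr_ae (ae_eq_refl _) (ae_of_all _ fun x => ?_)
  dsimp only
  linear_combination (partialDeriv μ χ x * f x) * Complex.I_mul_I

end Radial

/-! ### Cutoff functions -/

section Cutoff

variable {d : ℕ}

/-- The bump function behind the cutoffs: `1` on the unit ball and `0` off the ball of radius
`2`. -/
def cutoffBump (d : ℕ) : ContDiffBump (0 : EucSp d) where
  rIn := 1
  rOut := 2
  rIn_pos := one_pos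
  rIn_lt_rOut := one_lt_two

/-- A smooth function with values in `[0, 1]` that is `1` on the ball of radius `n + 1`, vanishes
off the ball of radius `2 (n + 1)`, and whose derivatives are small for large `n`. -/
def cutoff (d n : ℕ) (x : EucSp d) : ℂ := ((cutoffBump d ((1 / ((n : ℝ) + 1)) • x) : ℝ) : ℂ)

theorem partialDeriv_comp_smul {F : Type*} [NormedAddCommGroup F] [NormedSpace ℝ F] {μ : Fin d}
    {η : EucSp d → F} (hη : Differentiable ℝ η) (c : ℝ) (x : EucSp d) :
    partialDeriv μ (fun x => η (c • x)) x = c • partialDeriv μ η (c • x) := by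
  have h1 : HasFDerivAt (fun x : EucSp d => c • x) (c • ContinuousLinearMap.id ℝ (EucSp d)) x :=
    (hasFDerivAt_id x).const_smul c
  have h2 : HasFDerivAt (fun x => η (c • x)) _ x := (hη (c • x)).hasFDerivAt.comp x h1
  rw [partialDeriv, h2.fderiv]
  simp [partialDeriv]

/-- The bump function with complex values. -/
def cutoffBase (d : ℕ) (x : EucSp d) : ℂ := ((cutoffBump d x : ℝ) : ℂ)

theorem contDiff_cutoffBase : ContDiff ℝ ∞ (cutoffBase d) :=
  Complex.ofRealCLM.contDiff.comp (cutoffBump d).contDiff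

theorem hasCompactSupport_cutoffBase : HasCompactSupport (cutoffBase d) :=
  (cutoffBump d).hasCompactSupport.comp_left (g := fun r : ℝ => (r : ℂ)) rfl

theorem contDiff_cutoff (n : ℕ) : ContDiff ℝ ∞ (cutoff d n) :=
  contDiff_cutoffBase.comp (contDiff_const_smul _)

theorem hasCompactSupport_cutoff (n : ℕ) : HasCompactSupport (cutoff d n) := by
  have h : (1 : ℝ) / (n + 1) ≠ 0 := by positivity
  exact (hasCompactSupport_cutoffBase (d := d)).comp_smul h

theorem norm_cutoff_le (n : ℕ) (x : EucSp d) : ‖cutoff d n x‖ ≤ 1 := by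
  rw [cutoff, Complex.norm_real, Real.norm_of_nonneg (cutoffBump d).nonneg]
  exact (cutoffBump d).le_one

theorem cutoff_eq_one {n : ℕ} {x : EucSp d} (hx : ‖x‖ ≤ n + 1) : cutoff d n x = 1 := by
  have : cutoffBump d ((1 / ((n : ℝ) + 1)) • x) = 1 := by
    refine (cutoffBump d).one_of_mem_closedBall ?_
    rw [mem_closedBall_zero_iff, norm_smul, Real.norm_of_nonneg (by positivity), one_div,
      inv_mul_le_iff₀ (by positivity)]
    simpa [cutoffBump] using hx
  rw [cutoff, this, Complex.ofReal_one]

theorem partialDeriv_cutoff (n : ℕ) (μ : Fin d) :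
    partialDeriv μ (cutoff d n) = fun x =>
      ((1 : ℝ) / (n + 1)) • partialDeriv μ (cutoffBase d) (((1 : ℝ) / (n + 1)) • x) :=
  funext fun x => partialDeriv_comp_smul (contDiff_cutoffBase.differentiable (by simp)) _ x

theorem partialDeriv_partialDeriv_cutoff (n : ℕ) (μ : Fin d) (x : EucSp d) :
    partialDeriv μ (partialDeriv μ (cutoff d n)) x = ((1 : ℝ) / (n + 1)) • ((1 : ℝ) / (n + 1)) •
      partialDeriv μ (partialDeriv μ (cutoffBase d)) (((1 : ℝ) / (n + 1)) • x) := by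
  have hs : ContDiff ℝ ∞ (partialDeriv μ (cutoffBase d)) :=
    contDiff_partialDeriv contDiff_cutoffBase
  rw [partialDeriv_cutoff]
  have h1 : Differentiable ℝ fun x : EucSp d =>
      partialDeriv μ (cutoffBase d) (((1 : ℝ) / (n + 1)) • x) :=
    (hs.comp (contDiff_const_smul _)).differentiable (by simp)
  have h2 : HasFDerivAt (fun x : EucSp d => ((1 : ℝ) / (n + 1)) •
      partialDeriv μ (cutoffBase d) (((1 : ℝ) / (n + 1)) • x)) _ x :=
    (h1 x).hasFDerivAt.const_smul ((1 : ℝ) / (n + 1))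
  rw [← partialDeriv_comp_smul (hs.differentiable (by simp))]
  simp only [partialDeriv] at h2 ⊢
  rw [h2.fderiv]
  rfl

/-- The first two derivatives of the cutoffs are `O(1 / n)`. -/
theorem exists_partialDeriv_cutoff_le (d : ℕ) : ∃ C : ℝ, 0 ≤ C ∧
    ∀ (n : ℕ) (μ : Fin d) (x : EucSp d),
    ‖partialDeriv μ (cutoff d n) x‖ ≤ C * (1 / (n + 1)) ∧
    ‖partialDeriv μ (partialDeriv μ (cutoff d n)) x‖ ≤ C * (1 / (n + 1)) := by
  have hs := contDiff_cutoffBase (d := d)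
  have hc := hasCompactSupport_cutoffBase (d := d)
  have h1 : ∀ μ : Fin d, ∃ C, ∀ x, ‖partialDeriv μ (cutoffBase d) x‖ ≤ C := fun μ =>
    (contDiff_partialDeriv hs).continuous.bounded_above_of_compact_support
      (hasCompactSupport_partialDeriv hc)
  have h2 : ∀ μ : Fin d, ∃ C, ∀ x,
      ‖partialDeriv μ (partialDeriv μ (cutoffBase d)) x‖ ≤ C := fun μ =>
    (contDiff_partialDeriv (contDiff_partialDeriv hs)).continuous.bounded_above_of_compact_support
      (hasCompactSupport_partialDeriv (hasCompactSupport_partialDeriv hc))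
  choose C1 hC1 using h1
  choose C2 hC2 using h2
  have hp1 : ∀ μ, 0 ≤ C1 μ := fun μ => (norm_nonneg _).trans (hC1 μ 0)
  have hp2 : ∀ μ, 0 ≤ C2 μ := fun μ => (norm_nonneg _).trans (hC2 μ 0)
  refine ⟨∑ μ, (C1 μ + C2 μ), Finset.sum_nonneg fun μ _ => add_nonneg (hp1 μ) (hp2 μ),
    fun n μ x => ?_⟩
  have hle : C1 μ + C2 μ ≤ ∑ μ, (C1 μ + C2 μ) :=
    Finset.single_le_sum (f := fun μ => C1 μ + C2 μ)
      (fun μ _ => add_nonneg (hp1 μ) (hp2 μ)) (Finset.mem_univ μ)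
  have hn : (1 : ℝ) / (n + 1) ≤ 1 := by
    rw [div_le_one (by positivity)]
    linarith [(Nat.cast_nonneg n : (0 : ℝ) ≤ n)]
  have hn0 : (0 : ℝ) ≤ 1 / (n + 1) := by positivity
  constructor
  · rw [partialDeriv_cutoff, norm_smul, Real.norm_of_nonneg hn0, mul_comm]
    gcongr
    linarith [hC1 μ (((1 : ℝ) / (n + 1)) • x), hp2 μ]
  · rw [partialDeriv_partialDeriv_cutoff, norm_smul, norm_smul, Real.norm_of_nonneg hn0, mul_comm]
    gcongr
    refine (mul_le_of_le_one_left (norm_nonneg _) hn).trans ?_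
    linarith [hC2 μ (((1 : ℝ) / (n + 1)) • x), hp1 μ]

theorem eventually_cutoff_eq_one (x : EucSp d) : ∀ᶠ n : ℕ in atTop, cutoff d n x = 1 := by
  filter_upwards [eventually_ge_atTop ⌈‖x‖⌉₊] with n hn
  refine cutoff_eq_one ((Nat.le_ceil _).trans ?_)
  have : ((⌈‖x‖⌉₊ : ℕ) : ℝ) ≤ n := by exact_mod_cast hn
  linarith

end Cutoff

/-! ### Density of the test functions in the form domain -/

section Density

variable {d : ℕ} {a : EucSp d → EucSp d}

theorem MemLpLocal.memLp_mul {b : EucSp d → ℝ} (hb : MemLpLocal b 2) {f : EucSp d → ℂ}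
    (hf : AEStronglyMeasurable f) {K : Set (EucSp d)} (hK : IsCompact K) (h0 : ∀ x ∉ K, f x = 0)
    {M : ℝ} (hM : ∀ᵐ x, ‖f x‖ ≤ M) : MemLp (fun x => (b x : ℂ) * f x) 2 := by
  have h1 : MemLp (K.indicator fun x => (b x : ℂ)) 2 :=
    (memLp_indicator_iff_restrict hK.measurableSet).2 (hb K hK).ofReal
  have hbm : AEStronglyMeasurable fun x => (b x : ℂ) :=
    Complex.continuous_ofReal.comp_aestronglyMeasurable (hb.aestronglyMeasurable (by norm_num))
  refine (h1.norm.const_mul M).mono (hbm.mul hf) ?_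
  filter_upwards [hM] with x hx
  have hM0 : 0 ≤ M := (norm_nonneg _).trans hx
  rw [Real.norm_of_nonneg (by positivity), norm_mul]
  by_cases hxK : x ∈ K
  · rw [indicator_of_mem hxK, mul_comm]
    gcongr
  · rw [h0 x hxK, norm_zero, mul_zero]
    positivity

theorem MemLpLocal.memLp_mul_test {b : EucSp d → ℝ} (hb : MemLpLocal b 2) {η : EucSp d → ℂ}
    (hη : Continuous η) (hc : HasCompactSupport η) : MemLp (fun x => (b x : ℂ) * η x) 2 := by
  obtain ⟨C, hC⟩ := hη.bounded_above_of_compact_support hc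
  exact hb.memLp_mul hη.aestronglyMeasurable hc
    (fun x hx => image_eq_zero_of_notMem_tsupport hx) (ae_of_all _ hC)

/-- The covariant derivative of a smooth function. -/
def covTest (a : EucSp d → EucSp d) (μ : Fin d) (s : EucSp d → ℂ) (x : EucSp d) : ℂ :=
  -Complex.I * partialDeriv μ s x - a x μ * s x

theorem isCovDeriv_covTest (ha : AssumptionA1 a) (μ : Fin d) {s : EucSp d → ℂ}
    (hs : ContDiff ℝ ∞ s) (hc : HasCompactSupport s) : IsCovDeriv a μ s (covTest a μ s) := by
  refine ⟨hs.continuous.memLp_of_hasCompactSupport hc, MemLp.sub ?_ ?_, ?_⟩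
  · exact ((contDiff_partialDeriv hs).continuous.memLp_of_hasCompactSupport
      (hasCompactSupport_partialDeriv hc)).const_mul _
  · exact (ha μ).memLp_mul_test hs.continuous hc
  · refine (hasWeakPartial_of_contDiff (μ := μ) (hs.of_le (by simp))).congr_ae (ae_eq_refl _)
      (ae_of_all _ fun x => ?_)
    simp only [covTest]
    linear_combination (partialDeriv μ s x) * Complex.I_mul_I

/-- `f` and its covariant derivatives `g μ` are simultaneously approximated in `L²` by test
functions and their covariant derivatives. -/
def TestApprox (a : EucSp d → EucSp d) (f : EucSp d → ℂ) (g : Fin d → EucSp d → ℂ) : Prop :=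
  ∀ ε : ℝ≥0∞, 0 < ε → ∃ s : EucSp d → ℂ, ContDiff ℝ ∞ s ∧ HasCompactSupport s ∧
    eLpNorm (s - f) 2 ≤ ε ∧ ∀ μ, eLpNorm (covTest a μ s - g μ) 2 ≤ ε

theorem TestApprox.of_tendsto (ha : AssumptionA1 a) {f : ℕ → EucSp d → ℂ}
    {g : ℕ → Fin d → EucSp d → ℂ} {f' : EucSp d → ℂ} {g' : Fin d → EucSp d → ℂ}
    (h : ∀ n, TestApprox a (f n) (g n)) (hf : ∀ n, MemLp (f n) 2)
    (hg : ∀ n μ, MemLp (g n μ) 2) (hf' : MemLp f' 2) (hg' : ∀ μ, MemLp (g' μ) 2)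
    (hl : Tendsto (fun n => eLpNorm (f n - f') 2) atTop (𝓝 0))
    (hl' : ∀ μ, Tendsto (fun n => eLpNorm (g n μ - g' μ) 2) atTop (𝓝 0)) :
    TestApprox a f' g' := by
  intro ε hε
  have hε2 : 0 < ε / 2 := ENNReal.half_pos hε.ne'
  have e1 : ∀ᶠ n in atTop, eLpNorm (f n - f') 2 ≤ ε / 2 := ENNReal.tendsto_nhds_zero.1 hl _ hε2
  have e2 : ∀ᶠ n in atTop, ∀ μ, eLpNorm (g n μ - g' μ) 2 ≤ ε / 2 :=
    eventually_all.2 fun μ => ENNReal.tendsto_nhds_zero.1 (hl' μ) _ hε2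
  obtain ⟨n, h1, h2⟩ := (e1.and e2).exists
  obtain ⟨s, s1, s2, s3, s4⟩ := h n _ hε2
  refine ⟨s, s1, s2, ?_, fun μ => ?_⟩
  · have e : s - f' = (s - f n) + (f n - f') := by abel
    rw [e]
    refine (eLpNorm_add_le (s1.continuous.aestronglyMeasurable.sub (hf n).1)
      ((hf n).1.sub hf'.1) (by norm_num)).trans ?_
    exact (add_le_add s3 h1).trans_eq (ENNReal.add_halves ε)
  · have e : covTest a μ s - g' μ = (covTest a μ s - g n μ) + (g n μ - g' μ) := by abel
    rw [e]
    refine (eLpNorm_add_le ((isCovDeriv_covTest ha μ s1 s2).memLp'.1.sub (hg n μ).1)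
      ((hg n μ).1.sub (hg' μ).1) (by norm_num)).trans ?_
    exact (add_le_add (s4 μ) (h2 μ)).trans_eq (ENNReal.add_halves ε)

/-- Bounded functions of compact support are approximated by their mollifications. -/
theorem testApprox_of_bounded_of_support (ha : AssumptionA1 a) {f : EucSp d → ℂ}
    {g : Fin d → EucSp d → ℂ} (h : ∀ μ, IsCovDeriv a μ f (g μ)) (hf2 : MemLp f 2) {M : ℝ}
    (hM : ∀ᵐ x, ‖f x‖ ≤ M) {R : ℝ} (hR : ∀ x, R < ‖x‖ → f x = 0) : TestApprox a f g := by
  have hloc : LocallyIntegrable f := hf2.locallyIntegrable (by norm_num)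
  have hK : IsCompact (Metric.closedBall (0 : EucSp d) (R + 1)) := isCompact_closedBall _ _
  have hf0 : ∀ x ∉ Metric.closedBall (0 : EucSp d) (R + 1), f x = 0 := fun x hx =>
    hR x (by rw [mem_closedBall_zero_iff] at hx; linarith)
  have hc : HasCompactSupport f := HasCompactSupport.intro hK hf0
  have hm0 : ∀ n, ∀ x ∉ Metric.closedBall (0 : EucSp d) (R + 1), mollify n f x = 0 := by
    intro n x hx
    have e := mollify_congr_of_ball (n := n) (f := f) (g := fun _ => (0 : ℂ)) (x := x)
        fun y hy => by
      refine hR y ?_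
      rw [mem_closedBall_zero_iff] at hx
      have := norm_sub_norm_le x y
      linarith
    rw [e, mollify_apply]
    simp
  -- `a_μ f` is in `L²` since `f` is bounded with compact support, so the weak derivative of `f` is
  -- in `L²` as well
  have haf : ∀ μ, MemLp (fun x => (a x μ : ℂ) * f x) 2 := fun μ => (ha μ).memLp_mul hf2.1 hK hf0 hM
  have hG : ∀ μ, MemLp (fun x => Complex.I * (g μ x + a x μ * f x)) 2 := fun μ =>
    ((h μ).memLp'.add (haf μ)).const_mul Complex.I
  have hsm : ∀ n, ContDiff ℝ ∞ (mollify n f) := fun n => contDiff_mollify n hloc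
  have ham : ∀ μ n, AEStronglyMeasurable fun x => (a x μ : ℂ) * mollify n f x := fun μ n =>
    (ha.aestronglyMeasurable μ).mul (hsm n).continuous.aestronglyMeasurable
  have t1 := tendsto_eLpNorm_mollify_sub (p := 2) (by norm_num) (by norm_num) hf2
  have t2 : ∀ μ, Tendsto (fun n => eLpNorm (covTest a μ (mollify n f) - g μ) 2) atTop (𝓝 0) := by
    intro μ
    have u1 := tendsto_eLpNorm_mollify_sub (p := 2) (by norm_num) (by norm_num) (hG μ)
    have u2 : Tendsto (fun n => eLpNorm ((fun x => (a x μ : ℂ) * mollify n f x) -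
        fun x => (a x μ : ℂ) * f x) 2) atTop (𝓝 0) := by
      have hb : MemLp
          ((Metric.closedBall (0 : EucSp d) (R + 1)).indicator fun x => (a x μ : ℂ)) 2 :=
        (memLp_indicator_iff_restrict hK.measurableSet).2 (ha μ _ hK).ofReal
      refine tendsto_eLpNorm_sub_of_dominated (by simp) (by simp) (ham μ) (hb.norm.const_mul M)
        (fun n => ae_of_all _ fun x => ?_) ?_
      · rw [norm_mul]
        by_cases hx : x ∈ Metric.closedBall (0 : EucSp d) (R + 1)
        · rw [indicator_of_mem hx, mul_comm]
          gcongr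
          exact norm_mollify_le hM x
        · rw [hm0 n x hx, indicator_of_notMem hx]
          simp
      · filter_upwards [ae_tendsto_mollify hloc] with x hx
        exact hx.const_mul _
    have u3 := u1.add u2
    rw [add_zero] at u3
    refine tendsto_of_tendsto_of_tendsto_of_le_of_le tendsto_const_nhds u3 (fun _ => zero_le)
      fun n => ?_
    have e : covTest a μ (mollify n f) - g μ =
        (-Complex.I) • (mollify n (fun x => Complex.I * (g μ x + a x μ * f x)) -
          fun x => Complex.I * (g μ x + a x μ * f x)) +
        (-1 : ℂ) • ((fun x => (a x μ : ℂ) * mollify n f x) - fun x => (a x μ : ℂ) * f x) := by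
      ext x
      simp only [covTest, Pi.sub_apply, Pi.add_apply, Pi.smul_apply, smul_eq_mul]
      rw [partialDeriv_mollify hloc (h μ).weak]
      linear_combination (-(g μ x + a x μ * f x)) * Complex.I_mul_I
    dsimp only
    rw [e]
    have hm1 : AEStronglyMeasurable (mollify n (fun x => Complex.I * (g μ x + a x μ * f x)) -
        fun x => Complex.I * (g μ x + a x μ * f x)) volume :=
      (contDiff_mollify n
        ((h μ).locallyIntegrable ha).2).continuous.aestronglyMeasurable.sub (hG μ).1
    refine (eLpNorm_add_le (hm1.const_smul _) (((ham μ n).sub (haf μ).1).const_smul _)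
      (by norm_num)).trans ?_
    have hI : ‖-Complex.I‖ₑ = 1 := by rw [← ofReal_norm]; simp
    rw [eLpNorm_const_smul, eLpNorm_const_smul, hI]
    simp
  intro ε hε
  obtain ⟨n, h1, h2⟩ := ((ENNReal.tendsto_nhds_zero.1 t1 _ hε).and
    (eventually_all.2 fun μ => ENNReal.tendsto_nhds_zero.1 (t2 μ) _ hε)).exists
  exact ⟨mollify n f, hsm n, hasCompactSupport_mollify n hc, h1, h2⟩

/-- Bounded functions are approximated by cutting them off in space. -/
theorem testApprox_of_bounded (ha : AssumptionA1 a) {f : EucSp d → ℂ} {g : Fin d → EucSp d → ℂ}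
    (h : ∀ μ, IsCovDeriv a μ f (g μ)) (hf2 : MemLp f 2) {M : ℝ} (hM : ∀ᵐ x, ‖f x‖ ≤ M) :
    TestApprox a f g := by
  obtain ⟨C, hC0, hC⟩ := exists_partialDeriv_cutoff_le d
  have hn : ∀ n : ℕ, (1 : ℝ) / (n + 1) ≤ 1 := fun n => by
    rw [div_le_one (by positivity)]
    linarith [(Nat.cast_nonneg n : (0 : ℝ) ≤ n)]
  have hd : ∀ (n : ℕ) (μ : Fin d) x, ‖partialDeriv μ (cutoff d n) x‖ ≤ C := fun n μ x =>
    (hC n μ x).1.trans (mul_le_of_le_one_right hC0 (hn n))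
  have hcov : ∀ n μ, IsCovDeriv a μ (fun x => cutoff d n x * f x) (fun x => cutoff d n x * g μ x +
      -Complex.I * (partialDeriv μ (cutoff d n) x * f x)) := fun n μ =>
    (h μ).mul_smooth ha (contDiff_cutoff n) (C := 1 + C)
      (fun x => (norm_cutoff_le n x).trans (by linarith)) (fun x => (hd n μ x).trans (by linarith))
  have hb : ∀ n x, ‖cutoff d n x * f x‖ ≤ ‖f x‖ := fun n x => by
    rw [norm_mul]
    exact mul_le_of_le_one_left (norm_nonneg _) (norm_cutoff_le n x)
  have hmem : ∀ n, MemLp (fun x => cutoff d n x * f x) 2 := fun n =>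
    hf2.mono ((contDiff_cutoff n).continuous.aestronglyMeasurable.mul hf2.1) (ae_of_all _ (hb n))
  refine TestApprox.of_tendsto ha (f := fun n x => cutoff d n x * f x) (fun n => ?_) hmem
    (fun n μ => (hcov n μ).memLp') hf2 (fun μ => (h μ).memLp') ?_ fun μ => ?_
  · obtain ⟨R, hR⟩ := (hasCompactSupport_cutoff (d := d) n).isBounded.subset_closedBall 0
    refine testApprox_of_bounded_of_support ha (hcov n) (hmem n) (M := M) ?_ (R := R) fun x hx => ?_
    · filter_upwards [hM] with x hx
      exact (hb n x).trans hx
    · have h0 : cutoff d n x = 0 := image_eq_zero_of_notMem_tsupport fun h =>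
        absurd (mem_closedBall_zero_iff.1 (hR h)) (not_le.2 hx)
      rw [h0, zero_mul]
  · refine tendsto_eLpNorm_sub_of_dominated (by simp) (by simp) (fun n => (hmem n).1) hf2.norm
      (fun n => ae_of_all _ (hb n)) (ae_of_all _ fun x => ?_)
    refine tendsto_const_nhds.congr' ?_
    filter_upwards [eventually_cutoff_eq_one x] with n hn
    rw [hn, one_mul]
  · refine tendsto_eLpNorm_sub_of_dominated (by simp) (by simp) (fun n => (hcov n μ).memLp'.1)
      ((h μ).memLp'.norm.add (hf2.norm.const_mul C)) (fun n => ae_of_all _ fun x => ?_)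
      (ae_of_all _ fun x => ?_)
    · refine (norm_add_le _ _).trans (add_le_add ?_ ?_)
      · rw [norm_mul]
        exact mul_le_of_le_one_left (norm_nonneg _) (norm_cutoff_le n x)
      · rw [norm_mul, norm_mul, norm_neg, Complex.norm_I, one_mul]
        exact mul_le_mul_of_nonneg_right (hd n μ x) (norm_nonneg _)
    · have l1 : Tendsto (fun n => cutoff d n x * g μ x) atTop (𝓝 (g μ x)) := by
        refine tendsto_const_nhds.congr' ?_
        filter_upwards [eventually_cutoff_eq_one x] with n hn
        rw [hn, one_mul]
      have l2 : Tendsto (fun n => partialDeriv μ (cutoff d n) x) atTop (𝓝 0) := by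
        refine squeeze_zero_norm (fun n => (hC n μ x).1) ?_
        simpa using tendsto_inv_nat_succ.const_mul C
      simpa using l1.add ((l2.mul_const (f x)).const_mul (-Complex.I))

/-- Every element of the form domain is approximated by test functions in the form norm. -/
theorem testApprox (ha : AssumptionA1 a) {f : EucSp d → ℂ} {g : Fin d → EucSp d → ℂ}
    (hf2 : MemLp f 2) (h : ∀ μ, IsCovDeriv a μ f (g μ)) : TestApprox a f g := by
  obtain ⟨C, hC⟩ := exists_fderiv_radialMul_le 2
  have hC0 : 0 ≤ C := (norm_nonneg _).trans (hC 0 0)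
  have hcov := fun (n : ℕ) μ => (h μ).radialMul ha 2 (-(1 / ((n : ℝ) + 1)))
  have hmem : ∀ n : ℕ, MemLp (fun x => radialMul 2 (-(1 / ((n : ℝ) + 1))) (f x)) 2 := fun n =>
    hf2.mono ((contDiff_radialMul _ _).continuous.comp_aestronglyMeasurable hf2.1)
      (ae_of_all _ fun x => norm_radialMul_le _ _ _)
  refine TestApprox.of_tendsto ha (fun n => ?_) hmem
    (fun n μ => (hcov n μ).memLp') hf2 (fun μ => (h μ).memLp') ?_ fun μ => ?_
  · exact testApprox_of_bounded ha (hcov n) (hmem n)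
      (ae_of_all _ fun x => radialMul_trunc_bdd (by positivity) (f x))
  · exact tendsto_eLpNorm_sub_of_dominated (by simp) (by simp) (fun n => (hmem n).1) hf2.norm
      (fun n => ae_of_all _ fun x => norm_radialMul_le _ _ _)
      (ae_of_all _ fun x => tendsto_radialMul_trunc _)
  · refine tendsto_eLpNorm_sub_of_dominated (by simp) (by simp) (fun n => (hcov n μ).memLp'.1)
      ((h μ).memLp'.norm.const_mul C) (fun n => ae_of_all _ fun x => ?_) (ae_of_all _ fun x => ?_)
    · rw [norm_mul, norm_neg, Complex.norm_I, one_mul]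
      refine (ContinuousLinearMap.le_of_opNorm_le _ (hC _ _) _).trans_eq ?_
      rw [norm_mul, Complex.norm_I, one_mul]
    · have := (tendsto_fderiv_radialMul_trunc (f x) (Complex.I * g μ x)).const_mul (-Complex.I)
      rwa [← mul_assoc, neg_mul, Complex.I_mul_I, neg_neg, one_mul] at this

theorem mem_testSubspace_toLp {s : EucSp d → ℂ} (hs : ContDiff ℝ ∞ s) (hc : HasCompactSupport s)
    (h : MemLp s 2 volume) : h.toLp s ∈ testSubspace d :=
  ⟨s, hs, hc, MemLp.coeFn_toLp h⟩

theorem norm_toLp_sub_le {s : EucSp d → ℂ} (hs : MemLp s 2 volume) (f : L2Sp d) {δ : ℝ}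
    (hδ : 0 ≤ δ) (h : eLpNorm (s - (f : EucSp d → ℂ)) 2 volume ≤ ENNReal.ofReal δ) :
    ‖hs.toLp s - f‖ ≤ δ := by
  rw [← dist_eq_norm, dist_edist]
  refine ENNReal.toReal_le_of_le_ofReal hδ ?_
  conv_lhs => rw [← Lp.toLp_coeFn f (Lp.memLp f)]
  rwa [Lp.edist_toLp_toLp]

/-- The test functions are a form core. -/
theorem covGrad_hasCore_test (ha : AssumptionA1 a) : (covGrad a ha).HasCore (testSubspace d) := by
  rw [LinearPMap.hasCore_iff (covGrad_isClosed ha)]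
  have hgr : ∀ (s : EucSp d → ℂ) (hs : ContDiff ℝ ∞ s) (hc : HasCompactSupport s),
      ((hs.continuous.memLp_of_hasCompactSupport hc : MemLp s 2 volume).toLp s,
        WithLp.toLp 2 fun μ => (isCovDeriv_covTest ha μ hs hc).memLp'.toLp (covTest a μ s)) ∈
        (covGrad a ha).graph := fun s hs hc =>
    (mem_covGrad_graph_iff ha _).2 ((mem_covGradGraph ha _).2 fun μ =>
      (mem_covDerivGraph_toLp_iff ha μ (isCovDeriv_covTest ha μ hs hc).memLp
        (isCovDeriv_covTest ha μ hs hc).memLp').2 (isCovDeriv_covTest ha μ hs hc))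
  constructor
  · rintro f ⟨s, hs, hc, h⟩
    have e : f = (hs.continuous.memLp_of_hasCompactSupport hc : MemLp s 2 volume).toLp s :=
      Lp.ext (h.trans (MemLp.coeFn_toLp _).symm)
    rw [e]
    exact LinearPMap.mem_domain_of_mem_graph (hgr s hs hc)
  · rintro ⟨f, g⟩ hfg ε hε
    have hcov := (mem_covGradGraph_iff ha f g).1 ((mem_covGrad_graph_iff ha _).1 hfg)
    set δ := ε / (d + 2) with hδdef
    have hδ : 0 < δ := by positivity
    obtain ⟨s, hs, hc, h1, h2⟩ := testApprox ha (Lp.memLp f) hcov (ENNReal.ofReal δ)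
      (ENNReal.ofReal_pos.2 hδ)
    have hd : (0 : ℝ) ≤ d := Nat.cast_nonneg d
    have hε' : ε = δ * (d + 2) := by rw [hδdef]; field_simp
    refine ⟨_, hgr s hs hc, mem_testSubspace_toLp hs hc
      (hs.continuous.memLp_of_hasCompactSupport hc), ?_, ?_⟩
    · refine (norm_toLp_sub_le (hs.continuous.memLp_of_hasCompactSupport hc) f hδ.le h1).trans_lt ?_
      nlinarith
    · have hle : ∀ μ, ‖(isCovDeriv_covTest ha μ hs hc).memLp'.toLp (covTest a μ s) - g μ‖ ≤ δ :=
        fun μ => norm_toLp_sub_le _ (g μ) hδ.le (h2 μ)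
      refine lt_of_pow_lt_pow_left₀ 2 hε.le ?_
      rw [PiLp.norm_sq_eq_of_L2, hε']
      calc _ ≤ ∑ _μ : Fin d, δ ^ 2 :=
            Finset.sum_le_sum fun μ _ => pow_le_pow_left₀ (norm_nonneg _) (hle μ) 2
        _ = d * δ ^ 2 := by simp
        _ < (δ * (d + 2)) ^ 2 := by
            rw [mul_pow, mul_comm (δ ^ 2)]
            exact mul_lt_mul_of_pos_right (by nlinarith) (by positivity)

end Density

/-! ### The operator of a closed form -/

section FormOperator

variable {H F : Type*} [NormedAddCommGroup H] [InnerProductSpace ℂ H]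
  [NormedAddCommGroup F] [InnerProductSpace ℂ F]

/-- `w = A x` for the operator `A = T* T` associated with the form `⟪T f, T g⟫`. -/
def IsFormPair (T : H →ₗ.[ℂ] F) (x w : H) : Prop :=
  ∃ g, (x, g) ∈ T.graph ∧ ∀ p ∈ T.graph, ⟪w, p.1⟫_ℂ = ⟪g, p.2⟫_ℂ

/-- The graph of `T` as a subspace of the Hilbert sum `H ⊕ F`. -/
def hilbertGraph (T : H →ₗ.[ℂ] F) : Submodule ℂ (WithLp 2 (H × F)) :=
  T.graph.comap (WithLp.linearEquiv 2 ℂ (H × F)).toLinearMap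

theorem completeSpace_hilbertGraph [CompleteSpace H] [CompleteSpace F] {T : H →ₗ.[ℂ] F}
    (hT : T.IsClosed) :
    CompleteSpace (hilbertGraph T) := by
  have : IsClosed (hilbertGraph T : Set (WithLp 2 (H × F))) :=
    IsClosed.preimage (WithLp.prod_continuous_ofLp 2 H F) hT
  exact this.completeSpace_coe

theorem snd_eq_zero_of_mem_graph {T : H →ₗ.[ℂ] F} {g : F} (h : ((0 : H), g) ∈ T.graph) : g = 0 :=
  LinearPMap.graph_fst_eq_zero_snd T h rfl

/-- The resolvent `R = (1 + T* T)⁻¹` of a closed operator `T`: `R y` is the first component of the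
orthogonal projection of `(y, 0)` to the graph of `T`. The range of `R`, which is the domain of
`T* T`, is a core of `T`. -/
theorem exists_formResolvent [CompleteSpace H] [CompleteSpace F] {T : H →ₗ.[ℂ] F} (hT : T.IsClosed)
    (hd : Dense (T.domain : Set H)) :
    ∃ R : H →L[ℂ] H, IsSelfAdjoint R ∧ (∀ x, R x = 0 → x = 0) ∧
      (∀ x w, IsFormPair T x w ↔ R (x + w) = x) ∧
      ∀ p ∈ T.graph, ∀ ε : ℝ, 0 < ε → ∃ y g, (R y, g) ∈ T.graph ∧
        ‖R y - p.1‖ < ε ∧ ‖g - p.2‖ < ε := by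
  have := completeSpace_hilbertGraph hT
  set G := hilbertGraph T with hG
  set inl : H →L[ℂ] WithLp 2 (H × F) :=
    (WithLp.prodContinuousLinearEquiv 2 ℂ H F).symm.toContinuousLinearMap.comp
      (ContinuousLinearMap.inl ℂ H F) with hinl
  have inner_inl : ∀ (y : H) (p : WithLp 2 (H × F)), ⟪inl y, p⟫_ℂ = ⟪y, p.fst⟫_ℂ := fun y p => by
    rw [WithLp.prod_inner_apply]
    simp [hinl]
  set P := G.starProjection with hP
  set R : H →L[ℂ] H := (WithLp.fstL 2 ℂ H F).comp (P.comp inl) with hR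
  have hRy : ∀ y, R y = (P (inl y)).fst := fun y => rfl
  have hmem : ∀ y, (R y, (P (inl y)).snd) ∈ T.graph := fun y =>
    G.starProjection_apply_mem (inl y)
  have hspec : ∀ y, ∀ p ∈ T.graph, ⟪y - R y, p.1⟫_ℂ = ⟪(P (inl y)).snd, p.2⟫_ℂ := fun y p hp => by
    have h1 := G.starProjection_inner_eq_zero (inl y) (WithLp.toLp 2 p) hp
    rw [inner_sub_left, inner_inl, WithLp.prod_inner_apply] at h1
    rw [inner_sub_left]
    have h2 : ⟪y, p.1⟫_ℂ - (⟪R y, p.1⟫_ℂ + ⟪(P (inl y)).snd, p.2⟫_ℂ) = 0 := h1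
    linear_combination h2
  have hinj : ∀ x, R x = 0 → x = 0 := fun x hx => by
    have h0 : (P (inl x)).snd = 0 := snd_eq_zero_of_mem_graph (hx ▸ hmem x)
    refine hd.eq_zero_of_inner_left ℂ fun v hv => ?_
    obtain ⟨g, hg⟩ := (LinearPMap.mem_domain_iff).1 hv
    have := hspec x _ hg
    rwa [hx, sub_zero, h0, inner_zero_left] at this
  refine ⟨R, ?_, hinj, fun x w => ⟨?_, fun h => ?_⟩, ?_⟩
  · rw [ContinuousLinearMap.isSelfAdjoint_iff_isSymmetric]
    intro x y
    have h1 := G.inner_starProjection_left_eq_right (inl x) (inl y)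
    have h2 : ⟪P (inl x), inl y⟫_ℂ = ⟪R x, y⟫_ℂ := by
      rw [← inner_conj_symm, inner_inl, inner_conj_symm, hRy]
    have h3 : ⟪inl x, P (inl y)⟫_ℂ = ⟪x, R y⟫_ℂ := by rw [inner_inl, hRy]
    exact h2.symm.trans (h1.trans h3)
  · rintro ⟨g, hg, h⟩
    -- the difference of two solutions is orthogonal to itself
    have hm := T.graph.sub_mem (hmem (x + w)) hg
    have e1 := hspec (x + w) _ hm
    have e2 := h _ hm
    simp only [Prod.mk_sub_mk] at e1 e2
    set u := R (x + w) - x with hu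
    set v := (P (inl (x + w))).snd - g with hv
    have e3 : ⟪u, u⟫_ℂ + ⟪v, v⟫_ℂ = 0 := by
      have i1 : x + w - R (x + w) = w - u := by rw [hu]; abel
      have i2 : (P (inl (x + w))).snd = g + v := by rw [hv]; abel
      rw [i1, i2, inner_sub_left, inner_add_left, e2] at e1
      linear_combination -e1
    have e4 : ‖u‖ ^ 2 + ‖v‖ ^ 2 = 0 := by
      have := congrArg Complex.re e3
      rw [inner_self_eq_norm_sq_to_K, inner_self_eq_norm_sq_to_K] at this
      norm_cast at this
    have e5 : ‖u‖ = 0 := by nlinarith [sq_nonneg ‖u‖, sq_nonneg ‖v‖]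
    exact sub_eq_zero.1 (norm_eq_zero.1 e5)
  · have hm := hmem (x + w)
    rw [h] at hm
    refine ⟨(P (inl (x + w))).snd, hm, fun p hp => ?_⟩
    have := hspec (x + w) p hp
    rwa [h, add_sub_cancel_left] at this
  · intro p hp ε hε
    -- a vector of the graph orthogonal to the range of `P ∘ inl` vanishes
    set S : Submodule ℂ (WithLp 2 (H × F)) := (P.comp inl).range.topologicalClosure with hS
    have hSG : S ≤ G := by
      refine Submodule.topologicalClosure_minimal _ ?_
        (IsClosed.preimage (WithLp.prod_continuous_ofLp 2 H F) hT)
      rintro _ ⟨y, rfl⟩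
      exact G.starProjection_apply_mem (inl y)
    have hcs : CompleteSpace S :=
      (Submodule.isClosed_topologicalClosure _).completeSpace_coe
    set q : WithLp 2 (H × F) := WithLp.toLp 2 p with hq
    have hqG : q ∈ G := hp
    set r := q - S.starProjection q with hr
    have hrG : r ∈ G := G.sub_mem hqG (hSG (S.starProjection_apply_mem q))
    have hr1 : r.fst = 0 := by
      refine ext_inner_left ℂ fun y => ?_
      rw [← inner_inl, inner_zero_right]
      have h1 : ⟪P (inl y), r⟫_ℂ = 0 :=
        (S.sub_starProjection_mem_orthogonal q) _
          (Submodule.le_topologicalClosure _ ⟨y, rfl⟩)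
      have h2 := G.inner_starProjection_left_eq_right (inl y) r
      rw [G.starProjection_eq_self_iff.2 hrG] at h2
      exact h2.symm.trans h1
    have hr2 : r.snd = 0 := by
      have : (r.fst, r.snd) ∈ T.graph := hrG
      rw [hr1] at this
      exact snd_eq_zero_of_mem_graph this
    have hr0 : ‖r‖ = 0 := by
      have := WithLp.prod_norm_sq_eq_of_L2 r
      rw [hr1, hr2, norm_zero, norm_zero] at this
      nlinarith
    have hqS : q ∈ S := by
      rw [sub_eq_zero.1 (norm_eq_zero.1 hr0)]
      exact S.starProjection_apply_mem q
    obtain ⟨_, ⟨y, rfl⟩, hy⟩ := Metric.mem_closure_iff.1 hqS ε hε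
    rw [dist_comm, dist_eq_norm] at hy
    exact ⟨y, (P (inl y)).snd, hmem y, (WithLp.norm_fst_le _ _).trans_lt hy,
      (WithLp.norm_snd_le _ _).trans_lt hy⟩

variable (T : H →ₗ.[ℂ] F)

theorem mem_smul_graph_iff {c : ℂ} (hc : c ≠ 0) (x : H) (y : F) :
    (x, y) ∈ (c • T).graph ↔ (x, c⁻¹ • y) ∈ T.graph := by
  rw [LinearPMap.mem_graph_iff, LinearPMap.mem_graph_iff]
  constructor
  · rintro ⟨z, h1, h2⟩
    refine ⟨z, h1, ?_⟩
    dsimp only at h2 ⊢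
    rw [← h2, LinearPMap.smul_apply, smul_smul, inv_mul_cancel₀ hc, one_smul]
  · rintro ⟨z, h1, h2⟩
    refine ⟨z, h1, ?_⟩
    dsimp only at h2 ⊢
    rw [LinearPMap.smul_apply, h2, smul_smul, mul_inv_cancel₀ hc, one_smul]

variable {T}

theorem smul_isClosed (hT : T.IsClosed) {c : ℂ} (hc : c ≠ 0) : (c • T).IsClosed := by
  have e : ((c • T).graph : Set (H × F)) = (fun p : H × F => (p.1, c⁻¹ • p.2)) ⁻¹' T.graph := by
    ext ⟨x, y⟩
    exact mem_smul_graph_iff T hc x y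
  rw [LinearPMap.IsClosed, e]
  exact IsClosed.preimage (by fun_prop) hT

theorem smul_hasCore (hT : T.IsClosed) {c : ℂ} (hc : c ≠ 0) {S : Submodule ℂ H}
    (hS : T.HasCore S) : (c • T).HasCore S := by
  rw [LinearPMap.hasCore_iff hT] at hS
  rw [LinearPMap.hasCore_iff (smul_isClosed hT hc)]
  refine ⟨hS.1, fun ⟨x, y⟩ hp ε hε => ?_⟩
  have hc0 : 0 < ‖c‖ := norm_pos_iff.2 hc
  obtain ⟨⟨x', y'⟩, h1, h2, h3, h4⟩ := hS.2 _ ((mem_smul_graph_iff T hc x y).1 hp)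
    (min ε (ε / ‖c‖)) (lt_min hε (by positivity))
  refine ⟨(x', c • y'), (mem_smul_graph_iff T hc _ _).2 ?_, h2, h3.trans_le (min_le_left _ _), ?_⟩
  · rwa [smul_smul, inv_mul_cancel₀ hc, one_smul]
  · have e : c • y' - y = c • (y' - c⁻¹ • y) := by
      rw [smul_sub, smul_smul, mul_inv_cancel₀ hc, one_smul]
    dsimp only at h4 ⊢
    rw [e, norm_smul, mul_comm, ← lt_div_iff₀ hc0]
    exact h4.trans_le (min_le_right _ _)

/-- If `E` is the spectral measure of the operator associated with the form `⟪T f, T g⟫`, then `T`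
and `∫ √t dE(t)` have the same cores. -/
theorem hasCore_integral_sqrt [CompleteSpace H] [CompleteSpace F] (hT : T.IsClosed) {R : H →L[ℂ] H}
    (hR : ∀ x w, IsFormPair T x w ↔ R (x + w) = x)
    (hden : ∀ p ∈ T.graph, ∀ ε : ℝ, 0 < ε → ∃ y g, (R y, g) ∈ T.graph ∧
        ‖R y - p.1‖ < ε ∧ ‖g - p.2‖ < ε)
    (E : SpectralMeasure H) (hE : ∀ x w, (x, w) ∈ (E.integral fun t => t).graph ↔ IsFormPair T x w)
    {S : Submodule ℂ H} (hS : T.HasCore S) : (E.integral Real.sqrt).HasCore S := by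
  have hid : Measurable fun t : ℝ => t := measurable_id
  have hpos : ∀ x y, E.calculus.Rep (fun t => t) x y → 0 ≤ RCLike.re ⟪x, y⟫_ℂ := fun x y h => by
    obtain ⟨g, h1, h2⟩ := (hE x y).1 ((E.mem_integral_graph_iff hid x y).2 h)
    rw [← inner_conj_symm, h2 _ h1, RCLike.conj_re]
    exact inner_self_nonneg
  have hDE : (E.integral Real.sqrt).HasCore (E.integral fun t => t).domain := by
    refine E.hasCore_of_le Real.continuous_sqrt.measurable hid (c := 1) (fun t => ?_)
      (LinearPMap.hasCore_domain (E.integral_isClosed hid))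
    rw [one_mul, abs_of_nonneg (Real.sqrt_nonneg t), Real.sqrt_le_left (by positivity)]
    nlinarith [le_abs_self t, abs_nonneg t]
  -- the domain of the operator is a core of `T` and of `∫ √t dE(t)`, and there `⟪A x, x⟫` is the
  -- square of the norm of the value of either operator
  have hDT : T.HasCore (E.integral fun t => t).domain := by
    rw [LinearPMap.hasCore_iff hT]
    have hdom : ∀ x w, IsFormPair T x w → x ∈ (E.integral fun t => t).domain := fun x w h =>
      LinearPMap.mem_domain_of_mem_graph ((hE x w).2 h)
    refine ⟨fun x hx => ?_, fun p hp ε hε => ?_⟩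
    · obtain ⟨w, hw⟩ := LinearPMap.mem_domain_iff.1 hx
      obtain ⟨g, hg, -⟩ := (hE x w).1 hw
      exact LinearPMap.mem_domain_of_mem_graph hg
    · obtain ⟨y, g, h1, h2, h3⟩ := hden p hp ε hε
      exact ⟨(R y, g), h1, hdom _ (y - R y) ((hR _ _).2 (by rw [add_sub_cancel])), h2, h3⟩
  refine hDT.congr_norm hT (E.integral_isClosed Real.continuous_sqrt.measurable) hDE ?_ hS
  intro x hx g z hg hz
  obtain ⟨w, hw⟩ := LinearPMap.mem_domain_iff.1 hx
  obtain ⟨g', hg', h⟩ := (hE x w).1 hw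
  have hgg : g = g' := by
    have := T.graph.sub_mem hg hg'
    rw [Prod.mk_sub_mk, sub_self] at this
    exact sub_eq_zero.1 (snd_eq_zero_of_mem_graph this)
  subst hgg
  have hrep := (E.mem_integral_graph_iff hid x w).1 hw
  have e1 := h _ hg
  obtain ⟨z', hz', e2⟩ := E.exists_rep_sqrt hid (E.ae_nonneg hpos x) hrep
  have hz2 := (E.mem_integral_graph_iff Real.continuous_sqrt.measurable x z).1 hz
  have hzz : z = z' := hz2.unique Real.continuous_sqrt.measurable.aestronglyMeasurable hz'
    (ae_eq_refl _)
  subst hzz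
  dsimp only at e1
  rw [← inner_conj_symm, e2] at e1
  have e3 := congrArg RCLike.re e1
  rw [RCLike.conj_re, inner_self_eq_norm_sq, inner_self_eq_norm_sq] at e3
  exact ((sq_eq_sq₀ (norm_nonneg _) (norm_nonneg _)).1 e3).symm

end FormOperator

/-! ### Bernstein functions grow at most linearly -/

section Bernstein

variable {Ψ : ℝ → ℝ}

theorem IsBernsteinZero.concaveOn (hΨ : IsBernsteinZero Ψ) : ConcaveOn ℝ (Ioi 0) Ψ := by
  have hcd : ContDiffOn ℝ ∞ Ψ (Ioi 0) := hΨ.contDiffOn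
  have hd : ContDiffOn ℝ 1 (deriv Ψ) (Ioi 0) := hcd.deriv_of_isOpen isOpen_Ioi (by norm_cast)
  refine concaveOn_of_deriv2_nonpos (convex_Ioi 0) hcd.continuousOn ?_ ?_ ?_
  · rw [interior_Ioi]
    exact hcd.differentiableOn (by simp)
  · rw [interior_Ioi]
    exact hd.differentiableOn (by simp)
  · rw [interior_Ioi]
    intro x hx
    have := hΨ.deriv_sign 2 (by norm_num) x hx
    rwa [even_two.neg_one_pow, one_mul, iteratedDeriv_eq_iterate] at this

/-- Bernstein functions grow at most linearly, since they are concave and non-negative. -/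
theorem IsBernsteinZero.exists_le (hΨ : IsBernsteinZero Ψ) :
    ∃ c : ℝ, 0 ≤ c ∧ ∀ u, 0 < u → Ψ u ≤ c * (1 + u) := by
  have hc := hΨ.concaveOn
  have h2 := hΨ.nonneg (1 / 2) (by norm_num)
  have h3 := hΨ.nonneg 2 (by norm_num)
  have h1 := hΨ.nonneg 1 one_pos
  refine ⟨2 * Ψ 1, by linarith, fun u hu => ?_⟩
  rcases lt_trichotomy u 1 with h | rfl | h
  · have := hc.slope_anti_adjacent (x := u) (y := 1) (z := 2) hu (by norm_num) h (by norm_num)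
    rw [div_le_div_iff₀ (by norm_num) (by linarith)] at this
    nlinarith
  · linarith
  · have := hc.slope_anti_adjacent (x := 1 / 2) (y := 1) (z := u) (by norm_num) hu (by norm_num) h
    rw [div_le_div_iff₀ (by linarith) (by norm_num)] at this
    nlinarith

theorem IsBernsteinZero.measurable_indicator (hΨ : IsBernsteinZero Ψ) :
    Measurable ((Ioi 0).indicator Ψ) := by
  have := hΨ.contDiffOn.continuousOn
  rw [← piecewise_eq_indicator]
  exact this.measurable_piecewise continuousOn_const measurableSet_Ioi

theorem IsBernsteinZero.indicator_nonneg (hΨ : IsBernsteinZero Ψ) (t : ℝ) :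
    0 ≤ (Ioi 0).indicator Ψ t :=
  Set.indicator_nonneg (fun u hu => hΨ.nonneg u hu) t

end Bernstein

/-! ### Reduction to cores of the magnetic Schrödinger operator -/

section Reduction

variable {d : ℕ} {a : EucSp d → EucSp d}

theorem dense_testSubspace : Dense (testSubspace d : Set (L2Sp d)) := by
  refine (Lp.dense_hasCompactSupport_contDiff (p := 2) (by simp)).mono ?_
  rintro f ⟨η, h1, h2, h3⟩
  exact ⟨η, h3, h2, h1⟩

/-- The covariant gradient with the normalization `q(f, f) = ‖T f‖²`. -/
def halfGrad (a : EucSp d → EucSp d) (ha : AssumptionA1 a) : L2Sp d →ₗ.[ℂ] L2Vec d :=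
  ((√2 : ℝ) : ℂ)⁻¹ • covGrad a ha

theorem sqrtTwo_ne_zero : ((√2 : ℝ) : ℂ)⁻¹ ≠ 0 := by
  simp

theorem halfGrad_isClosed (ha : AssumptionA1 a) : (halfGrad a ha).IsClosed :=
  smul_isClosed (covGrad_isClosed ha) sqrtTwo_ne_zero

theorem halfGrad_hasCore_test (ha : AssumptionA1 a) : (halfGrad a ha).HasCore (testSubspace d) :=
  smul_hasCore (covGrad_isClosed ha) sqrtTwo_ne_zero (covGrad_hasCore_test ha)

theorem isFormPair_halfGrad_iff (ha : AssumptionA1 a) (f w : L2Sp d) :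
    IsFormPair (halfGrad a ha) f w ↔ (f, w) ∈ magneticGraph a ha := by
  have hmem : ∀ (f : L2Sp d) g, (f, g) ∈ (halfGrad a ha).graph ↔
      (f, ((√2 : ℝ) : ℂ) • g) ∈ covGradGraph a ha := fun f g => by
    rw [halfGrad, mem_smul_graph_iff _ sqrtTwo_ne_zero, inv_inv, mem_covGrad_graph_iff]
  have hs : ((√2 : ℝ) : ℂ) * ((√2 : ℝ) : ℂ) = 2 := by
    rw [← Complex.ofReal_mul, Real.mul_self_sqrt (by norm_num)]
    norm_num
  have hs0 : ((√2 : ℝ) : ℂ) ≠ 0 := by simp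
  have hin : ∀ g g' : L2Vec d, (1 / 2 : ℂ) * ⟪((√2 : ℝ) : ℂ) • g, ((√2 : ℝ) : ℂ) • g'⟫_ℂ =
      ⟪g, g'⟫_ℂ := fun g g' => by
    rw [inner_smul_left, inner_smul_right, Complex.conj_ofReal]
    linear_combination (1 / 2) * ⟪g, g'⟫_ℂ * hs
  rw [mem_magneticGraph_iff]
  constructor
  · rintro ⟨g, hg, h⟩
    refine ⟨_, (hmem f g).1 hg, fun f' g' h' => ?_⟩
    have e : ((√2 : ℝ) : ℂ) • ((√2 : ℝ) : ℂ)⁻¹ • g' = g' := by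
      rw [smul_smul, mul_inv_cancel₀ hs0, one_smul]
    rw [← e, hin]
    exact h (f', ((√2 : ℝ) : ℂ)⁻¹ • g') ((hmem _ _).2 (e.symm ▸ h'))
  · rintro ⟨g, hg, h⟩
    have e : ((√2 : ℝ) : ℂ) • ((√2 : ℝ) : ℂ)⁻¹ • g = g := by
      rw [smul_smul, mul_inv_cancel₀ hs0, one_smul]
    refine ⟨((√2 : ℝ) : ℂ)⁻¹ • g, (hmem _ _).2 (e.symm ▸ hg), fun p hp => ?_⟩
    rw [h p.1 _ ((hmem p.1 p.2).1 hp), ← hin (_ • g), e]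

/-- The resolvent `(h + 1)⁻¹`. -/
theorem exists_magneticResolvent (ha : AssumptionA1 a) :
    ∃ R : L2Sp d →L[ℂ] L2Sp d, IsSelfAdjoint R ∧ (∀ x, R x = 0 → x = 0) ∧
      (∀ x w, (x, w) ∈ magneticGraph a ha ↔ R (x + w) = x) ∧
      ∀ p ∈ (halfGrad a ha).graph, ∀ ε : ℝ, 0 < ε → ∃ y g, (R y, g) ∈ (halfGrad a ha).graph ∧
        ‖R y - p.1‖ < ε ∧ ‖g - p.2‖ < ε := by
  obtain ⟨R, h1, h2, h3, h4⟩ := exists_formResolvent (halfGrad_isClosed ha)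
    (dense_testSubspace.mono
      ((LinearPMap.hasCore_iff (halfGrad_isClosed ha)).1 (halfGrad_hasCore_test ha)).1)
  exact ⟨R, h1, h2, fun x w => (isFormPair_halfGrad_iff ha x w).symm.trans (h3 x w), h4⟩

/-- The relation that defines `½ (p - a)²` is single-valued, so no junk enters its graph. -/
theorem mem_magneticSchrodinger_graph_iff (ha : AssumptionA1 a) (p : L2Sp d × L2Sp d) :
    p ∈ (magneticSchrodinger a ha).graph ↔ p ∈ magneticGraph a ha := by
  obtain ⟨R, -, h2, h3, -⟩ := exists_magneticResolvent ha
  rw [magneticSchrodinger, Submodule.toLinearPMap_graph_eq]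
  rintro ⟨x, w⟩ hx h0
  obtain rfl : x = 0 := h0
  have := (h3 0 w).1 hx
  rw [zero_add] at this
  exact h2 w this

theorem exists_spectralMeasure_magnetic (ha : AssumptionA1 a) :
    ∃ E : SpectralMeasure (L2Sp d), E.integral (fun t => t) = magneticSchrodinger a ha := by
  obtain ⟨R, h1, h2, h3, -⟩ := exists_magneticResolvent ha
  exact exists_spectralMeasure_of_resolvent h1 h2 fun x y =>
    (mem_magneticSchrodinger_graph_iff ha (x, y)).trans (h3 x y)

/-- The form core of the closed magnetic form is a core of the square root of its operator. -/
theorem hasCore_sqrt_magnetic (ha : AssumptionA1 a) (E : SpectralMeasure (L2Sp d))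
    (hE : E.integral (fun t => t) = magneticSchrodinger a ha) :
    (E.integral Real.sqrt).HasCore (testSubspace d) := by
  obtain ⟨R, -, -, h3, h4⟩ := exists_magneticResolvent ha
  refine hasCore_integral_sqrt (halfGrad_isClosed ha)
    (fun x w => (isFormPair_halfGrad_iff ha x w).trans (h3 x w)) h4 E (fun x w => ?_)
    (halfGrad_hasCore_test ha)
  rw [hE, mem_magneticSchrodinger_graph_iff, isFormPair_halfGrad_iff]

theorem magneticSchrodinger_isClosed (ha : AssumptionA1 a) :
    (magneticSchrodinger a ha).IsClosed := by
  obtain ⟨E, hE⟩ := exists_spectralMeasure_magnetic ha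
  exact hE ▸ E.integral_isClosed measurable_id

theorem bernsteinCalculus_hasCore (ha : AssumptionA1 a) {Ψ : ℝ → ℝ} (hΨ : IsBernsteinZero Ψ)
    {S : Submodule ℂ (L2Sp d)} (hS : (magneticSchrodinger a ha).HasCore S) :
    (bernsteinCalculus Ψ (magneticSchrodinger a ha)).HasCore S := by
  have hex := exists_spectralMeasure_magnetic ha
  obtain ⟨c, hc0, hc⟩ := hΨ.exists_le
  rw [bernsteinCalculus, spectralCalculus, dif_pos hex]
  refine hex.choose.hasCore_of_le hΨ.measurable_indicator measurable_id (c := c) (fun t => ?_)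
    (hex.choose_spec.symm ▸ hS)
  rw [abs_of_nonneg (hΨ.indicator_nonneg t)]
  by_cases ht : 0 < t
  · rw [indicator_of_mem (mem_Ioi.2 ht), id_eq, abs_of_pos ht]
    exact hc t ht
  · rw [indicator_of_notMem (by simpa using ht)]
    positivity

theorem bernsteinCalculus_isFormCore (ha : AssumptionA1 a) {Ψ : ℝ → ℝ} (hΨ : IsBernsteinZero Ψ) :
    IsFormCore (bernsteinCalculus Ψ (magneticSchrodinger a ha)) (testSubspace d) := by
  have hex := exists_spectralMeasure_magnetic ha
  obtain ⟨c, hc0, hc⟩ := hΨ.exists_le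
  rw [bernsteinCalculus, spectralCalculus, dif_pos hex]
  refine hex.choose.isFormCore_integral hΨ.measurable_indicator
    (fun x => ae_of_all _ hΨ.indicator_nonneg) ?_
  refine hex.choose.hasCore_of_le hΨ.measurable_indicator.sqrt Real.continuous_sqrt.measurable
    (c := √c) (fun t => ?_) (hasCore_sqrt_magnetic ha _ hex.choose_spec)
  rw [abs_of_nonneg (Real.sqrt_nonneg _), abs_of_nonneg (Real.sqrt_nonneg _)]
  by_cases ht : 0 < t
  · rw [indicator_of_mem (mem_Ioi.2 ht)]
    calc √(Ψ t) ≤ √(c * (1 + t)) := Real.sqrt_le_sqrt (hc t ht)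
      _ = √c * √(1 + t) := Real.sqrt_mul hc0 _
      _ ≤ √c * (1 + √t) := by
          gcongr
          rw [Real.sqrt_le_left (by positivity)]
          nlinarith [Real.sq_sqrt ht.le, Real.sqrt_nonneg t]
  · rw [indicator_of_notMem (by simpa using ht), Real.sqrt_zero]
    positivity

end Reduction

/-! ### Interpolation of gradients -/

section Interpolation

variable {d : ℕ}

theorem partialDeriv_comm {μ ν : Fin d} {z : EucSp d → ℂ} (hz : ContDiff ℝ ∞ z) (x : EucSp d) :
    partialDeriv μ (partialDeriv ν z) x = partialDeriv ν (partialDeriv μ z) x := by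
  have hd : Differentiable ℝ (fderiv ℝ z) :=
    (hz.fderiv_right (m := ∞) (by simp)).differentiable (by simp)
  have key : ∀ μ ν : Fin d, partialDeriv μ (partialDeriv ν z) x =
      fderiv ℝ (fderiv ℝ z) x (EuclideanSpace.single μ 1) (EuclideanSpace.single ν 1) := by
    intro μ ν
    have h : HasFDerivAt (partialDeriv ν z) _ x :=
      (hd x).hasFDerivAt.clm_apply (hasFDerivAt_const (EuclideanSpace.single ν (1 : ℝ)) x)
    rw [partialDeriv, h.fderiv]
    simp
  rw [key, key]
  exact ((contDiff_infty.1 hz 2).contDiffAt.isSymmSndFDerivAt (by simp)).eq _ _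

theorem contDiff_star {z : EucSp d → ℂ} (hz : ContDiff ℝ ∞ z) :
    ContDiff ℝ ∞ fun x => starRingEnd ℂ (z x) :=
  Complex.conjCLE.contDiff.comp hz

theorem hasCompactSupport_star {z : EucSp d → ℂ} (hz : HasCompactSupport z) :
    HasCompactSupport fun x => starRingEnd ℂ (z x) :=
  hz.comp_left (g := starRingEnd ℂ) (map_zero _)

theorem partialDeriv_star {μ : Fin d} {z : EucSp d → ℂ} {x : EucSp d}
    (hz : DifferentiableAt ℝ z x) :
    partialDeriv μ (fun x => starRingEnd ℂ (z x)) x = starRingEnd ℂ (partialDeriv μ z x) :=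
  partialDeriv_clm_comp (Complex.conjCLE : ℂ →L[ℝ] ℂ) hz

theorem partialDeriv_star' {μ : Fin d} {z : EucSp d → ℂ} (hz : ContDiff ℝ ∞ z) :
    partialDeriv μ (fun x => starRingEnd ℂ (z x)) = fun x => starRingEnd ℂ (partialDeriv μ z x) :=
  funext fun x => partialDeriv_star (hz.differentiable (by simp) x)

theorem enorm_integral_mul_star (f : EucSp d → ℂ) (hf : MemLp f 2) :
    ENNReal.ofReal ((∫ x, f x * starRingEnd ℂ (f x)).re) = eLpNorm f 2 ^ 2 := by
  have e : ∀ x, f x * starRingEnd ℂ (f x) = ((‖f x‖ ^ 2 : ℝ) : ℂ) := fun x => by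
    rw [Complex.mul_conj, Complex.normSq_eq_norm_sq]
  simp only [e]
  rw [integral_complex_ofReal, Complex.ofReal_re,
    ofReal_integral_eq_lintegral_ofReal hf.norm.integrable_sq (ae_of_all _ fun x => by positivity),
    eLpNorm_eq_lintegral_rpow_enorm_toReal (by simp) (by simp)]
  simp only [ENNReal.toReal_ofNat]
  rw [← ENNReal.rpow_natCast, ← ENNReal.rpow_mul]
  norm_num

/-- The Laplacian `∑_μ ∂_μ² z`. -/
def lap (z : EucSp d → ℂ) (x : EucSp d) : ℂ := ∑ μ, partialDeriv μ (partialDeriv μ z) x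

theorem contDiff_lap {z : EucSp d → ℂ} (hz : ContDiff ℝ ∞ z) : ContDiff ℝ ∞ (lap z) :=
  ContDiff.sum fun _ _ => contDiff_partialDeriv (contDiff_partialDeriv hz)

theorem hasCompactSupport_lap {z : EucSp d → ℂ} (hz : HasCompactSupport z) :
    HasCompactSupport (lap z) :=
  HasCompactSupport.intro hz fun x hx => Finset.sum_eq_zero fun μ _ => by
    have h1 : tsupport (partialDeriv μ (partialDeriv μ z)) ⊆ tsupport z := by
      refine (tsupport_comp_subset (g := fun L : EucSp d →L[ℝ] ℂ => L (EuclideanSpace.single μ 1))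
        rfl _).trans ((tsupport_fderiv_subset ℝ).trans ?_)
      exact (tsupport_comp_subset
        (g := fun L : EucSp d →L[ℝ] ℂ => L (EuclideanSpace.single μ 1)) rfl _).trans
          (tsupport_fderiv_subset ℝ)
    exact image_eq_zero_of_notMem_tsupport fun h => hx (h1 h)

theorem integral_mul_partialDeriv {μ : Fin d} {f η : EucSp d → ℂ} (hf : ContDiff ℝ ∞ f)
    (hη : ContDiff ℝ ∞ η) (hc : HasCompactSupport η) :
    ∫ x, f x * partialDeriv μ η x = -∫ x, partialDeriv μ f x * η x :=
  hasWeakPartial_of_contDiff (hf.of_le (by simp)) η hη hc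

/-- Pure second derivatives are controlled by the Laplacian: both sides are compared through
`∫ |Δz|² = ∑_{μν} ∫ |∂_μ ∂_ν z|²`. -/
theorem eLpNorm_partialDeriv_partialDeriv_le {z : EucSp d → ℂ} (hz : ContDiff ℝ ∞ z)
    (hc : HasCompactSupport z) (μ : Fin d) :
    eLpNorm (partialDeriv μ (partialDeriv μ z)) 2 ≤ eLpNorm (lap z) 2 := by
  have hP : ∀ μ, ContDiff ℝ ∞ (partialDeriv μ z) := fun μ => contDiff_partialDeriv hz
  have hPP : ∀ μ ν, ContDiff ℝ ∞ (partialDeriv μ (partialDeriv ν z)) := fun μ ν =>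
    contDiff_partialDeriv (hP ν)
  have hcP : ∀ μ, HasCompactSupport (partialDeriv μ z) := fun μ => hasCompactSupport_partialDeriv hc
  have hcPP : ∀ μ ν, HasCompactSupport (partialDeriv μ (partialDeriv ν z)) := fun μ ν =>
    hasCompactSupport_partialDeriv (hcP ν)
  have key : ∀ μ ν, ∫ x, partialDeriv μ (partialDeriv μ z) x *
      starRingEnd ℂ (partialDeriv ν (partialDeriv ν z) x) =
      ∫ x, partialDeriv μ (partialDeriv ν z) x *
        starRingEnd ℂ (partialDeriv μ (partialDeriv ν z) x) := by
    intro μ ν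
    have e1 := integral_mul_partialDeriv (μ := μ) (hP μ) (contDiff_star (hPP ν ν))
      (hasCompactSupport_star (hcPP ν ν))
    have e2 := integral_mul_partialDeriv (μ := ν) (hP μ) (contDiff_star (hPP μ ν))
      (hasCompactSupport_star (hcPP μ ν))
    have e3 : partialDeriv μ (fun x => starRingEnd ℂ (partialDeriv ν (partialDeriv ν z) x)) =
        partialDeriv ν (fun x => starRingEnd ℂ (partialDeriv μ (partialDeriv ν z) x)) := by
      rw [partialDeriv_star' (hPP ν ν), partialDeriv_star' (hPP μ ν)]
      ext x
      rw [partialDeriv_comm (hP ν)]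
    rw [e3, e2, neg_inj] at e1
    rw [← e1]
    refine integral_congr_ae (ae_of_all _ fun x => ?_)
    dsimp only
    rw [partialDeriv_comm hz]
  have hint : ∀ μ ν, Integrable fun x => partialDeriv μ (partialDeriv μ z) x *
      starRingEnd ℂ (partialDeriv ν (partialDeriv ν z) x) := fun μ ν =>
    ((hPP μ μ).mul (contDiff_star (hPP ν ν))).continuous.integrable_of_hasCompactSupport
      (hasCompactSupport_star (hcPP ν ν)).mul_left
  have hm : ∀ μ ν, MemLp (partialDeriv μ (partialDeriv ν z)) 2 := fun μ ν =>
    (hPP μ ν).continuous.memLp_of_hasCompactSupport (hcPP μ ν)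
  have hml : MemLp (lap z) 2 :=
    (contDiff_lap hz).continuous.memLp_of_hasCompactSupport (hasCompactSupport_lap hc)
  have hsum : ∫ x, lap z x * starRingEnd ℂ (lap z x) =
      ∑ μ, ∑ ν, ∫ x, partialDeriv μ (partialDeriv ν z) x *
        starRingEnd ℂ (partialDeriv μ (partialDeriv ν z) x) := by
    simp only [← key]
    simp only [fun μ => (integral_finsetSum Finset.univ fun ν _ => hint μ ν).symm]
    rw [← integral_finsetSum _ fun μ _ => integrable_finsetSum _ fun ν _ => hint μ ν]
    refine integral_congr_ae (ae_of_all _ fun x => ?_)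
    simp only [lap, map_sum, Finset.sum_mul_sum]
  have hpos : ∀ f : EucSp d → ℂ, 0 ≤ (∫ x, f x * starRingEnd ℂ (f x)).re := fun f => by
    have e : ∀ x, f x * starRingEnd ℂ (f x) = ((‖f x‖ ^ 2 : ℝ) : ℂ) := fun x => by
      rw [Complex.mul_conj, Complex.normSq_eq_norm_sq]
    simp only [e]
    rw [integral_complex_ofReal, Complex.ofReal_re]
    positivity
  have hle : (∫ x, partialDeriv μ (partialDeriv μ z) x *
      starRingEnd ℂ (partialDeriv μ (partialDeriv μ z) x)).re ≤
      (∫ x, lap z x * starRingEnd ℂ (lap z x)).re := by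
    rw [hsum, Complex.re_sum]
    simp only [Complex.re_sum]
    refine le_trans ?_ (Finset.single_le_sum (f := fun μ => ∑ ν, _)
      (fun μ _ => Finset.sum_nonneg fun ν _ => hpos _) (Finset.mem_univ μ))
    exact Finset.single_le_sum (f := fun ν => (∫ x, partialDeriv μ (partialDeriv ν z) x *
      starRingEnd ℂ (partialDeriv μ (partialDeriv ν z) x)).re)
      (fun ν _ => hpos _) (Finset.mem_univ μ)
  have := ENNReal.ofReal_le_ofReal hle
  rw [enorm_integral_mul_star _ (hm μ μ), enorm_integral_mul_star _ hml] at this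
  exact (ENNReal.pow_le_pow_left_iff two_ne_zero).1 this

theorem integral_mul_star_sq (p : EucSp d → ℂ) :
    ∫ x, p x * (starRingEnd ℂ (p x) * (starRingEnd ℂ (p x) * p x)) =
      ((∫ x, ‖p x‖ ^ 4 : ℝ) : ℂ) := by
  have hx : ∀ x, p x * (starRingEnd ℂ (p x) * (starRingEnd ℂ (p x) * p x)) =
      ((‖p x‖ ^ 4 : ℝ) : ℂ) := fun x => by
    have h1 : p x * starRingEnd ℂ (p x) = ((‖p x‖ ^ 2 : ℝ) : ℂ) := by
      rw [Complex.mul_conj, Complex.normSq_eq_norm_sq]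
    have h2 : p x * (starRingEnd ℂ (p x) * (starRingEnd ℂ (p x) * p x)) =
        (p x * starRingEnd ℂ (p x)) * (p x * starRingEnd ℂ (p x)) := by ring
    have h3 : ‖p x‖ ^ 4 = ‖p x‖ ^ 2 * ‖p x‖ ^ 2 := by ring
    rw [h2, h1, h3, Complex.ofReal_mul]
  simp only [hx]
  exact integral_complex_ofReal

theorem norm_partialDeriv_star_mul_sq_le {p : EucSp d → ℂ} (hp : ContDiff ℝ ∞ p) (μ : Fin d)
    (x : EucSp d) :
    ‖partialDeriv μ (fun x => starRingEnd ℂ (p x) * (starRingEnd ℂ (p x) * p x)) x‖ ≤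
      3 * (‖p x‖ ^ 2 * ‖partialDeriv μ p x‖) := by
  have d1 : DifferentiableAt ℝ p x := hp.differentiable (by simp) x
  have d2 : DifferentiableAt ℝ (fun x => starRingEnd ℂ (p x)) x :=
    (contDiff_star hp).differentiable (by simp) x
  have d3 : DifferentiableAt ℝ (fun x => starRingEnd ℂ (p x) * p x) x := d2.mul d1
  rw [partialDeriv_mul d2 d3, partialDeriv_mul d2 d1, partialDeriv_star d1]
  generalize partialDeriv μ p x = q
  generalize p x = r
  calc _ ≤ ‖starRingEnd ℂ r‖ * (‖starRingEnd ℂ r‖ * ‖q‖ + ‖starRingEnd ℂ q‖ * ‖r‖) +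
        ‖starRingEnd ℂ q‖ * (‖starRingEnd ℂ r‖ * ‖r‖) := by
          refine (norm_add_le _ _).trans (add_le_add ?_ ?_)
          · rw [norm_mul]
            refine mul_le_mul_of_nonneg_left ((norm_add_le _ _).trans_eq ?_) (norm_nonneg _)
            rw [norm_mul, norm_mul]
          · rw [norm_mul, norm_mul]
    _ = 3 * (‖r‖ ^ 2 * ‖q‖) := by rw [RCLike.norm_conj, RCLike.norm_conj]; ring

theorem lintegral_enorm_pow_four (p : EucSp d → ℂ) : ∫⁻ x, ‖p x‖ₑ ^ 4 = eLpNorm p 4 ^ 4 := by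
  rw [eLpNorm_eq_lintegral_rpow_enorm_toReal (by simp) (by simp)]
  simp only [ENNReal.toReal_ofNat]
  rw [← ENNReal.rpow_natCast, ← ENNReal.rpow_mul]
  norm_num

theorem lintegral_sq_mul_le {p q : EucSp d → ℂ} (hp : Continuous p) (hq : Continuous q) :
    ∫⁻ x, ‖p x‖ₑ ^ 2 * ‖q x‖ₑ ≤ eLpNorm p 4 ^ 2 * eLpNorm q 2 := by
  refine (ENNReal.lintegral_mul_le_Lp_mul_Lq volume (p := 2) (q := 2)
    Real.HolderConjugate.two_two
    (hp.enorm.measurable.pow_const 2).aemeasurable hq.enorm.aemeasurable).trans ?_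
  refine mul_le_mul' (le_of_eq ?_) (le_of_eq ?_)
  · have : ∀ x, (‖p x‖ₑ ^ 2) ^ (2 : ℝ) = ‖p x‖ₑ ^ 4 := fun x => by
      rw [← ENNReal.rpow_natCast, ← ENNReal.rpow_mul, ← ENNReal.rpow_natCast]
      norm_num
    simp only [this]
    rw [lintegral_enorm_pow_four, ← ENNReal.rpow_natCast, ← ENNReal.rpow_natCast,
      ← ENNReal.rpow_mul]
    norm_num
  · rw [eLpNorm_eq_lintegral_rpow_enorm_toReal (by simp) (by simp)]
    simp

theorem HasWeakPartial.lintegral_pow_four_le {z p : EucSp d → ℂ} {μ : Fin d}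
    (hzp : HasWeakPartial μ z p) (hps : ContDiff ℝ ∞ p) (hpc : HasCompactSupport p) {M : ℝ}
    (hM : ∀ x, ‖z x‖ ≤ M) : ∫⁻ x, ‖p x‖ₑ ^ 4 ≤ ENNReal.ofReal (3 * M) *
      ∫⁻ x, ‖p x‖ₑ ^ 2 * ‖partialDeriv μ p x‖ₑ := by
  have hM0 : 0 ≤ M := (norm_nonneg _).trans (hM 0)
  have e1 := hzp (fun x => starRingEnd ℂ (p x) * (starRingEnd ℂ (p x) * p x))
    ((contDiff_star hps).mul ((contDiff_star hps).mul hps)) hpc.mul_left.mul_left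
  have hη := norm_partialDeriv_star_mul_sq_le hps μ
  have e2 := integral_mul_star_sq p
  have hp4 : MemLp p (4 : ℕ) := hps.continuous.memLp_of_hasCompactSupport hpc
  have i4 : Integrable fun x => ‖p x‖ ^ 4 := hp4.integrable_norm_pow (by norm_num)
  have s1 : ∫⁻ x, ‖p x‖ₑ ^ 4 = ENNReal.ofReal (∫ x, ‖p x‖ ^ 4) := by
    rw [ofReal_integral_eq_lintegral_ofReal i4 (ae_of_all _ fun x => pow_nonneg (norm_nonneg _) 4)]
    refine lintegral_congr fun x => ?_
    rw [ENNReal.ofReal_pow (norm_nonneg _), ofReal_norm]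
  have s2 : ENNReal.ofReal (∫ x, ‖p x‖ ^ 4) = ‖∫ x, z x * partialDeriv μ
      (fun x => starRingEnd ℂ (p x) * (starRingEnd ℂ (p x) * p x)) x‖ₑ := by
    have e3 := e1.trans (congrArg Neg.neg e2)
    rw [e3, enorm_neg, ← ofReal_norm, Complex.norm_real, Real.norm_of_nonneg]
    exact integral_nonneg fun x => pow_nonneg (norm_nonneg _) 4
  have s3 : ∀ x, ‖z x * partialDeriv μ
      (fun x => starRingEnd ℂ (p x) * (starRingEnd ℂ (p x) * p x)) x‖ₑ ≤
      ENNReal.ofReal (3 * M) * (‖p x‖ₑ ^ 2 * ‖partialDeriv μ p x‖ₑ) := fun x => by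
    have h := mul_le_mul (hM x) (hη x) (norm_nonneg _) hM0
    rw [← norm_mul, mul_left_comm, ← mul_assoc] at h
    have := ENNReal.ofReal_le_ofReal h
    rwa [ENNReal.ofReal_mul (p := 3 * M) (by positivity),
      ENNReal.ofReal_mul (p := ‖p x‖ ^ 2) (by positivity),
      ENNReal.ofReal_pow (norm_nonneg _), ofReal_norm, ofReal_norm, ofReal_norm] at this
  rw [s1, s2, ← lintegral_const_mul' _ _ ENNReal.ofReal_ne_top]
  exact (enorm_integral_le_lintegral_enorm _).trans (lintegral_mono s3)

theorem HasWeakPartial.eLpNorm_four_sq_le {z p : EucSp d → ℂ} {μ : Fin d}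
    (hzp : HasWeakPartial μ z p) (hps : ContDiff ℝ ∞ p) (hpc : HasCompactSupport p) {M : ℝ}
    (hM : ∀ x, ‖z x‖ ≤ M) :
    eLpNorm p 4 ^ 2 ≤ ENNReal.ofReal (3 * M) * eLpNorm (partialDeriv μ p) 2 := by
  have hp4 : MemLp p 4 := hps.continuous.memLp_of_hasCompactSupport hpc
  have h1 := hzp.lintegral_pow_four_le hps hpc hM
  have h2 := lintegral_sq_mul_le hps.continuous (contDiff_partialDeriv (μ := μ) hps).continuous
  rw [lintegral_enorm_pow_four] at h1
  have h3 : eLpNorm p 4 ^ 4 ≤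
      ENNReal.ofReal (3 * M) * (eLpNorm p 4 ^ 2 * eLpNorm (partialDeriv μ p) 2) :=
    h1.trans (mul_le_mul' le_rfl h2)
  rw [mul_left_comm, show 4 = 2 + 2 from rfl, pow_add] at h3
  by_cases h0 : eLpNorm p 4 ^ 2 = 0
  · rw [h0]; exact zero_le
  · exact (ENNReal.mul_le_mul_iff_right h0 (ENNReal.pow_ne_top hp4.2.ne)).1 h3

/-- The Gagliardo–Nirenberg inequality `‖∂_μ z‖₄² ≤ 3 ‖z‖_∞ ‖∂_μ² z‖₂`, by one integration by
parts in `∫ |∂_μ z|⁴`. -/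
theorem eLpNorm_partialDeriv_four_sq_le {z : EucSp d → ℂ} (hz : ContDiff ℝ ∞ z)
    (hc : HasCompactSupport z) {M : ℝ} (hM : ∀ x, ‖z x‖ ≤ M) (μ : Fin d) :
    eLpNorm (partialDeriv μ z) 4 ^ 2 ≤
      ENNReal.ofReal (3 * M) * eLpNorm (partialDeriv μ (partialDeriv μ z)) 2 := by
  have hps : ContDiff ℝ ∞ (partialDeriv μ z) := contDiff_partialDeriv hz
  have hpc : HasCompactSupport (partialDeriv μ z) := hasCompactSupport_partialDeriv hc
  have hzp : HasWeakPartial μ z (partialDeriv μ z) :=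
    hasWeakPartial_of_contDiff (hz.of_le (by simp))
  exact hzp.eLpNorm_four_sq_le hps hpc hM

end Interpolation

/-! ### The action of the magnetic Schrödinger operator on test functions -/

section TestFunctions

variable {d : ℕ} {a : EucSp d → EucSp d}

/-- The expression `½ (-Δ s + 2i b·∇s + i v s + |b|² s)`, which is `½ (p - b)² s` if `v` is the
divergence of `b`. -/
def magTest (b : EucSp d → EucSp d) (v : EucSp d → ℝ) (s : EucSp d → ℂ) (x : EucSp d) : ℂ :=
  (1 / 2) * (-lap s x + (∑ μ, (2 * Complex.I * (b x μ * partialDeriv μ s x) +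
    ((b x μ ^ 2 : ℝ) : ℂ) * s x)) + Complex.I * (v x * s x))

theorem holderTriple_four : ENNReal.HolderTriple 4 4 2 := ⟨by
  have h : (4 : ℝ≥0∞) = 2 * 2 := by norm_num
  rw [h, ENNReal.mul_inv (by simp) (by simp), ← mul_add, ENNReal.inv_two_add_inv_two, mul_one]⟩

theorem MemLpLocal.sq {b : EucSp d → ℝ} (hb : MemLpLocal b 4) :
    MemLpLocal (fun x => b x ^ 2) 2 := fun K hK => by
  have := holderTriple_four
  have h : MemLp (fun x => b x * b x) 2 (volume.restrict K) :=
    MemLp.mul (p := 4) (q := 4) (hb K hK) (hb K hK)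
  simpa only [pow_two] using h

theorem memLp_magTest (ha : AssumptionA1 a) (h4 : ∀ μ, MemLpLocal (fun x => a x μ) 4)
    {v : EucSp d → ℝ} (hv : MemLpLocal v 2) {s : EucSp d → ℂ} (hs : ContDiff ℝ ∞ s)
    (hc : HasCompactSupport s) : MemLp (magTest a v s) 2 := by
  have h1 : MemLp (fun x => -lap s x) 2 :=
    ((contDiff_lap hs).continuous.memLp_of_hasCompactSupport (hasCompactSupport_lap hc)).neg
  have h2 : ∀ μ, MemLp (fun x => 2 * Complex.I * ((a x μ : ℂ) * partialDeriv μ s x)) 2 volume :=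
    fun μ => ((ha μ).memLp_mul_test (contDiff_partialDeriv hs).continuous
      (hasCompactSupport_partialDeriv hc)).const_mul _
  have h3 : ∀ μ, MemLp (fun x => ((a x μ ^ 2 : ℝ) : ℂ) * s x) 2 volume :=
    fun μ => (h4 μ).sq.memLp_mul_test hs.continuous hc
  have h5 : MemLp (fun x => Complex.I * ((v x : ℂ) * s x)) 2 :=
    (hv.memLp_mul_test hs.continuous hc).const_mul _
  have h6 : MemLp (fun x => ∑ μ, (2 * Complex.I * ((a x μ : ℂ) * partialDeriv μ s x) +
      ((a x μ ^ 2 : ℝ) : ℂ) * s x)) 2 volume :=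
    memLp_finsetSum Finset.univ (f := fun μ x =>
      2 * Complex.I * ((a x μ : ℂ) * partialDeriv μ s x) +
      ((a x μ ^ 2 : ℝ) : ℂ) * s x) fun μ _ => (h2 μ).add (h3 μ)
  have h7 := ((h1.add h6).add h5).const_mul (1 / 2 : ℂ)
  exact h7

theorem MemLpLocal.locallyIntegrable_ofReal {b : EucSp d → ℝ} (hb : MemLpLocal b 2) :
    LocallyIntegrable fun x => (b x : ℂ) :=
  (hb.locallyIntegrable (by norm_num)).mono (Complex.continuous_ofReal.comp_aestronglyMeasurable
    (hb.aestronglyMeasurable (by norm_num))) (ae_of_all _ fun x => by rw [Complex.norm_real])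

/-- A weak divergence may be tested with complex valued functions. -/
theorem IsWeakDivergence.hasWeakDiv (ha : AssumptionA1 a) {v : EucSp d → ℝ}
    (hv : MemLpLocal v 2) (h : IsWeakDivergence a v) :
    HasWeakDiv (fun μ x => (a x μ : ℂ)) fun x => (v x : ℂ) := by
  intro η h1 h2
  have hη' : ∀ μ, Continuous (partialDeriv μ η) := fun μ => (contDiff_partialDeriv h1).continuous
  have i1 : ∀ μ, Integrable fun x => (a x μ : ℂ) * partialDeriv μ η x := fun μ =>
    integrable_mul_of_locallyIntegrable (ha μ).locallyIntegrable_ofReal (hη' μ)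
      (hasCompactSupport_partialDeriv h2)
  have i2 : Integrable fun x => (v x : ℂ) * η x :=
    integrable_mul_of_locallyIntegrable hv.locallyIntegrable_ofReal h1.continuous h2
  have key : ∀ L : ℂ →L[ℝ] ℝ, L (∑ μ, ∫ x, (a x μ : ℂ) * partialDeriv μ η x) =
      L (-∫ x, (v x : ℂ) * η x) := fun L => by
    have hL : ∀ (r : ℝ) (z : ℂ), L ((r : ℂ) * z) = r * L z := fun r z => by
      rw [← Complex.real_smul, map_smul, smul_eq_mul]
    have e := h (fun x => L (η x)) (L.contDiff.comp h1) (h2.comp_left (g := L) (map_zero L))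
    have hp : ∀ μ x, partialDeriv μ (fun x => L (η x)) x = L (partialDeriv μ η x) := fun μ x =>
      partialDeriv_clm_comp L (h1.differentiable (by simp) x)
    simp only [hp] at e
    rw [map_neg, ← L.integral_comp_comm i2, ← integral_finsetSum _ fun μ _ => i1 μ,
      ← L.integral_comp_comm (integrable_finsetSum _ fun μ _ => i1 μ)]
    simpa only [map_sum, hL] using e
  exact Complex.ext (key Complex.reCLM) (key Complex.imCLM)

/-- Integration by parts: `magTest a v s` represents the form `q(s, ·)` on test functions. The
divergence of `a` enters through the test function `conj s * η`. -/
theorem integral_magTest_mul (ha : AssumptionA1 a) (h4 : ∀ μ, MemLpLocal (fun x => a x μ) 4)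
    {v : EucSp d → ℝ} (hv : MemLpLocal v 2) (h : IsWeakDivergence a v) {s η : EucSp d → ℂ}
    (hs : ContDiff ℝ ∞ s) (hη : ContDiff ℝ ∞ η) (hc : HasCompactSupport η) :
    ∫ x, starRingEnd ℂ (magTest a v s x) * η x =
      (1 / 2) * ∑ μ, ∫ x, starRingEnd ℂ (covTest a μ s x) * covTest a μ η x := by
  have hss : ContDiff ℝ ∞ fun x => starRingEnd ℂ (s x) := contDiff_star hs
  obtain ⟨t, ht⟩ : ∃ t : EucSp d → ℂ, t = fun x => starRingEnd ℂ (s x) := ⟨_, rfl⟩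
  have hts : ContDiff ℝ ∞ t := ht ▸ hss
  have htx : ∀ x, starRingEnd ℂ (s x) = t x := fun x => by rw [ht]
  have htp : ∀ μ, (fun x => starRingEnd ℂ (partialDeriv μ s x)) = partialDeriv μ t := fun μ => by
    rw [ht, partialDeriv_star' hs]
  have htp' : ∀ μ x, starRingEnd ℂ (partialDeriv μ s x) = partialDeriv μ t x := fun μ x =>
    congrFun (htp μ) x
  have htpp : ∀ μ x, starRingEnd ℂ (partialDeriv μ (partialDeriv μ s) x) =
      partialDeriv μ (partialDeriv μ t) x := fun μ x => by
    rw [← htp μ, partialDeriv_star' (contDiff_partialDeriv hs)]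
  have hm : ∀ x, starRingEnd ℂ (magTest a v s x) * η x = (1 / 2) *
      ((∑ μ, (-(partialDeriv μ (partialDeriv μ t) x * η x) -
        2 * Complex.I * (a x μ * (partialDeriv μ t x * η x)) +
        ((a x μ ^ 2 : ℝ) : ℂ) * (t x * η x))) - Complex.I * (v x * (t x * η x))) := fun x => by
    simp only [magTest, lap, map_mul, map_add, map_neg, map_sum, htp', htpp, htx, Complex.conj_I,
      Complex.conj_ofReal, map_div₀, map_one, map_ofNat, Finset.sum_add_distrib,
      Finset.sum_sub_distrib, Finset.sum_neg_distrib, ← Finset.mul_sum, ← Finset.sum_mul,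
      mul_neg, neg_mul]
    have e1 : ∑ μ, (a x μ : ℂ) * (partialDeriv μ t x * η x) =
        (∑ μ, (a x μ : ℂ) * partialDeriv μ t x) * η x := by
      rw [Finset.sum_mul]
      exact Finset.sum_congr rfl fun μ _ => by ring
    rw [e1]
    ring
  have hD : ∀ μ x, starRingEnd ℂ (covTest a μ s x) * covTest a μ η x =
      partialDeriv μ t x * partialDeriv μ η x -
        2 * Complex.I * (a x μ * (partialDeriv μ t x * η x)) +
        Complex.I * (a x μ * partialDeriv μ (fun x => t x * η x) x) +
        ((a x μ ^ 2 : ℝ) : ℂ) * (t x * η x) := fun μ x => by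
    rw [partialDeriv_mul (hts.differentiable (by simp) x) (hη.differentiable (by simp) x)]
    simp only [covTest, map_sub, map_mul, map_neg, htp', htx, Complex.conj_I, Complex.conj_ofReal,
      Complex.ofReal_pow]
    linear_combination (-partialDeriv μ t x * partialDeriv μ η x) * Complex.I_mul_I
  have hc1 : HasCompactSupport fun x => t x * η x := hc.mul_left
  have hs1 : ContDiff ℝ ∞ fun x => t x * η x := hts.mul hη
  have j1 : ∀ μ, Integrable fun x => partialDeriv μ (partialDeriv μ t) x * η x := fun μ =>
    ((contDiff_partialDeriv (contDiff_partialDeriv hts)).continuous.mul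
      hη.continuous).integrable_of_hasCompactSupport hc.mul_left
  have j1' : ∀ μ, Integrable fun x => partialDeriv μ t x * partialDeriv μ η x := fun μ =>
    ((contDiff_partialDeriv hts).continuous.mul
      (contDiff_partialDeriv hη).continuous).integrable_of_hasCompactSupport
      (hasCompactSupport_partialDeriv hc).mul_left
  have j2 : ∀ μ, Integrable fun x => 2 * Complex.I * ((a x μ : ℂ) * (partialDeriv μ t x * η x)) :=
    fun μ => (integrable_mul_of_locallyIntegrable (ha μ).locallyIntegrable_ofReal
      ((contDiff_partialDeriv hts).mul hη).continuous hc.mul_left).const_mul _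
  have j3 : ∀ μ, Integrable fun x => ((a x μ ^ 2 : ℝ) : ℂ) * (t x * η x) := fun μ =>
    integrable_mul_of_locallyIntegrable (h4 μ).sq.locallyIntegrable_ofReal hs1.continuous hc1
  have j4 : ∀ μ, Integrable fun x =>
      Complex.I * ((a x μ : ℂ) * partialDeriv μ (fun x => t x * η x) x) := fun μ =>
    (integrable_mul_of_locallyIntegrable (ha μ).locallyIntegrable_ofReal
      (contDiff_partialDeriv hs1).continuous (hasCompactSupport_partialDeriv hc1)).const_mul _
  have j5 : Integrable fun x => Complex.I * ((v x : ℂ) * (t x * η x)) :=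
    (integrable_mul_of_locallyIntegrable hv.locallyIntegrable_ofReal hs1.continuous
      hc1).const_mul _
  have e1 : ∀ μ, ∫ x, partialDeriv μ t x * partialDeriv μ η x =
      -∫ x, partialDeriv μ (partialDeriv μ t) x * η x := fun μ =>
    integral_mul_partialDeriv (contDiff_partialDeriv hts) hη hc
  -- the first order terms differ by `i ∑_μ a_μ ∂_μ (t η)`, which integrates to `-i ∫ v t η`
  have e2 := h.hasWeakDiv ha hv _ hs1 hc1
  have j6 : ∀ μ, Integrable fun x => -(partialDeriv μ (partialDeriv μ t) x * η x) -
      2 * Complex.I * (a x μ * (partialDeriv μ t x * η x)) := fun μ => (j1 μ).neg.sub (j2 μ)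
  have j7 : ∀ μ, Integrable fun x => -(partialDeriv μ (partialDeriv μ t) x * η x) -
      2 * Complex.I * (a x μ * (partialDeriv μ t x * η x)) +
      ((a x μ ^ 2 : ℝ) : ℂ) * (t x * η x) := fun μ => (j6 μ).add (j3 μ)
  have j8 : ∀ μ, Integrable fun x => partialDeriv μ t x * partialDeriv μ η x -
      2 * Complex.I * (a x μ * (partialDeriv μ t x * η x)) := fun μ => (j1' μ).sub (j2 μ)
  have j9 : ∀ μ, Integrable fun x => partialDeriv μ t x * partialDeriv μ η x -
      2 * Complex.I * (a x μ * (partialDeriv μ t x * η x)) +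
      Complex.I * (a x μ * partialDeriv μ (fun x => t x * η x) x) := fun μ => (j8 μ).add (j4 μ)
  simp only [hm, hD]
  rw [integral_const_mul, integral_sub (integrable_finsetSum _ fun μ _ => j7 μ) j5,
    integral_finsetSum _ fun μ _ => j7 μ]
  have e3 : ∀ μ, ∫ x, (-(partialDeriv μ (partialDeriv μ t) x * η x) -
        2 * Complex.I * (a x μ * (partialDeriv μ t x * η x)) +
        ((a x μ ^ 2 : ℝ) : ℂ) * (t x * η x)) =
      -(∫ x, partialDeriv μ (partialDeriv μ t) x * η x) -
        (∫ x, 2 * Complex.I * (a x μ * (partialDeriv μ t x * η x))) +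
        ∫ x, ((a x μ ^ 2 : ℝ) : ℂ) * (t x * η x) := fun μ => by
    rw [integral_add (j6 μ) (j3 μ), integral_sub (j1 μ).fun_neg (j2 μ), integral_neg]
  have e4 : ∀ μ, ∫ x, (partialDeriv μ t x * partialDeriv μ η x -
        2 * Complex.I * (a x μ * (partialDeriv μ t x * η x)) +
        Complex.I * (a x μ * partialDeriv μ (fun x => t x * η x) x) +
        ((a x μ ^ 2 : ℝ) : ℂ) * (t x * η x)) =
      -(∫ x, partialDeriv μ (partialDeriv μ t) x * η x) -
        (∫ x, 2 * Complex.I * (a x μ * (partialDeriv μ t x * η x))) +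
        Complex.I * (∫ x, (a x μ : ℂ) * partialDeriv μ (fun x => t x * η x) x) +
        ∫ x, ((a x μ ^ 2 : ℝ) : ℂ) * (t x * η x) := fun μ => by
    rw [integral_add (j9 μ) (j3 μ), integral_add (j8 μ) (j4 μ),
      integral_sub (j1' μ) (j2 μ), e1 μ, integral_const_mul Complex.I]
  simp only [e3, e4, Finset.sum_add_distrib, ← Finset.mul_sum]
  rw [e2, integral_const_mul Complex.I]
  ring

/-- Test functions are in the domain of the magnetic Schrödinger operator under (A3). -/
theorem mem_magneticGraph_magTest (ha : AssumptionA1 a)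
    (h4 : ∀ μ, MemLpLocal (fun x => a x μ) 4) {v : EucSp d → ℝ} (hv : MemLpLocal v 2)
    (h : IsWeakDivergence a v) {s : EucSp d → ℂ} (hs : ContDiff ℝ ∞ s) (hc : HasCompactSupport s) :
    ((hs.continuous.memLp_of_hasCompactSupport hc : MemLp s 2 volume).toLp s,
      (memLp_magTest ha h4 hv hs hc).toLp (magTest a v s)) ∈ magneticGraph a ha := by
  have hm : MemLp s 2 volume := hs.continuous.memLp_of_hasCompactSupport hc
  have hcov := fun μ => isCovDeriv_covTest ha μ hs hc
  obtain ⟨g, hg⟩ : ∃ g : L2Vec d, ∀ μ, g μ =ᵐ[volume] covTest a μ s :=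
    ⟨WithLp.toLp 2 fun μ => (hcov μ).memLp'.toLp _, fun μ => MemLp.coeFn_toLp (hcov μ).memLp'⟩
  rw [mem_magneticGraph_iff]
  refine ⟨g, (mem_covGradGraph_iff ha _ _).2 fun μ =>
    (hcov μ).congr_ae (MemLp.coeFn_toLp hm).symm (hg μ).symm, fun f' g' hp => ?_⟩
  obtain ⟨W, hW⟩ : ∃ W : L2Sp d, W = (memLp_magTest ha h4 hv hs hc).toLp (magTest a v s) :=
    ⟨_, rfl⟩
  rw [← hW]
  have hWx : W =ᵐ[volume] magTest a v s := hW ▸ MemLp.coeFn_toLp _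
  have hcl : IsClosed {p : L2Sp d × L2Vec d | ⟪W, p.1⟫_ℂ = (1 / 2) * ⟪g, p.2⟫_ℂ} :=
    isClosed_eq (by fun_prop) (by fun_prop)
  have hmem : ((f', g') : L2Sp d × L2Vec d) ∈
      closure {p : L2Sp d × L2Vec d | ⟪W, p.1⟫_ℂ = (1 / 2) * ⟪g, p.2⟫_ℂ} := by
    rw [Metric.mem_closure_iff]
    intro ε hε
    obtain ⟨p, h1, ⟨η, hη, hηc, hp1⟩, h3, h4'⟩ := ((LinearPMap.hasCore_iff (covGrad_isClosed ha)).1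
      (covGrad_hasCore_test ha)).2 _ ((mem_covGrad_graph_iff ha _).2 hp) ε hε
    refine ⟨p, ?_, ?_⟩
    · have hp2 : ∀ μ, p.2 μ =ᵐ[volume] covTest a μ η := fun μ => by
        have e1 := (mem_covGradGraph ha p).1 ((mem_covGrad_graph_iff ha _).1 h1) μ
        have e2 := (mem_covDerivGraph_toLp_iff ha μ (isCovDeriv_covTest ha μ hη hηc).memLp
          (isCovDeriv_covTest ha μ hη hηc).memLp').2 (isCovDeriv_covTest ha μ hη hηc)
        have e3 : p.1 = (isCovDeriv_covTest ha μ hη hηc).memLp.toLp η :=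
          Lp.ext (hp1.trans (MemLp.coeFn_toLp _).symm)
        have e4 := (covDerivGraph a ha μ).sub_mem e1 (e3 ▸ e2)
        rw [Prod.mk_sub_mk, sub_self] at e4
        rw [sub_eq_zero.1 (covDerivGraph_functional ha μ e4)]
        exact MemLp.coeFn_toLp _
      have e1 : ⟪W, p.1⟫_ℂ = ∫ x, starRingEnd ℂ (magTest a v s x) * η x := by
        rw [L2.inner_def]
        refine integral_congr_ae ?_
        filter_upwards [hWx, hp1] with x k1 k2
        rw [RCLike.inner_apply, k1, k2, mul_comm]
      have e2 : ⟪g, p.2⟫_ℂ = ∑ μ, ∫ x, starRingEnd ℂ (covTest a μ s x) * covTest a μ η x := by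
        rw [PiLp.inner_apply]
        refine Finset.sum_congr rfl fun μ _ => ?_
        rw [L2.inner_def]
        refine integral_congr_ae ?_
        filter_upwards [hg μ, hp2 μ] with x k1 k2
        rw [RCLike.inner_apply, k1, k2, mul_comm]
      change ⟪W, p.1⟫_ℂ = (1 / 2) * ⟪g, p.2⟫_ℂ
      rw [e1, e2, integral_magTest_mul ha h4 hv h hs hη hηc]
    · rw [Prod.dist_eq, dist_comm, dist_eq_norm, dist_comm, dist_eq_norm]
      exact max_lt h3 h4'
  rw [hcl.closure_eq] at hmem
  exact hmem

end TestFunctions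

/-! ### The resolvent is a contraction of `L^∞` -/

section Bounded

variable {d : ℕ} {a : EucSp d → EucSp d}

theorem re_conj_mul_fderiv_radialMul_nonneg (α : ℝ) {β : ℝ} (hβ : 0 ≤ β) (z w : ℂ) :
    0 ≤ (starRingEnd ℂ w * (-Complex.I * fderiv ℝ (radialMul α β) z (Complex.I * w))).re := by
  have h1 : ⟪z, Complex.I * w⟫_ℝ = z.im * w.re - z.re * w.im := by
    rw [Complex.inner]
    simp
    ring
  have h2 : 0 ≤ deriv Real.smoothTransition (α + β * ‖z‖ ^ 2) :=
    Real.smoothTransition.monotone.deriv_nonneg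
  have h3 := Real.smoothTransition.nonneg (α + β * ‖z‖ ^ 2)
  have e : (starRingEnd ℂ w * (-Complex.I * fderiv ℝ (radialMul α β) z (Complex.I * w))).re =
      Real.smoothTransition (α + β * ‖z‖ ^ 2) * (w.re ^ 2 + w.im ^ 2) +
      2 * β * deriv Real.smoothTransition (α + β * ‖z‖ ^ 2) *
        (z.im * w.re - z.re * w.im) ^ 2 := by
    rw [fderiv_radialMul, h1]
    simp
    ring
  rw [e]
  positivity

/-- If `(h + 1) u = φ` with `|φ| ≤ M`, then `|u| ≤ M`: test the equation with `F(u)`, where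
`F(z) = τ(|z|² - M²) z` vanishes for `|z| ≤ M`. -/
theorem norm_le_of_mem_magneticGraph (ha : AssumptionA1 a) {u w : L2Sp d}
    (h : (u, w) ∈ magneticGraph a ha) {M : ℝ} (hM0 : 0 ≤ M) {φ : EucSp d → ℂ}
    (hφ : (u + w : L2Sp d) =ᵐ[volume] φ) (hM : ∀ x, ‖φ x‖ ≤ M) : ∀ᵐ x, ‖u x‖ ≤ M := by
  obtain ⟨g, hg, hw⟩ := (mem_magneticGraph_iff ha u w).1 h
  have hcov := fun μ => ((mem_covGradGraph_iff ha u g).1 hg μ).radialMul ha (-M ^ 2) 1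
  have hF : MemLp (fun x => radialMul (-M ^ 2) 1 (u x)) 2 volume :=
    (Lp.memLp u).mono ((contDiff_radialMul _ _).continuous.comp_aestronglyMeasurable (Lp.memLp u).1)
      (ae_of_all _ fun x => norm_radialMul_le _ _ _)
  have hpair := hw (hF.toLp _) (WithLp.toLp 2 fun μ => (hcov μ).memLp'.toLp _)
    ((mem_covGradGraph_iff ha _ _).2 fun μ => (hcov μ).congr_ae (MemLp.coeFn_toLp hF).symm
      (MemLp.coeFn_toLp (hcov μ).memLp').symm)
  -- the form is non-negative on `(u, F(u))`, where `w = h u`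
  have hpos : 0 ≤ (⟪w, hF.toLp _⟫_ℂ).re := by
    rw [hpair, PiLp.inner_apply, Finset.mul_sum, Complex.re_sum]
    refine Finset.sum_nonneg fun μ _ => ?_
    rw [show (1 / 2 : ℂ) = ((1 / 2 : ℝ) : ℂ) by norm_num, Complex.re_ofReal_mul]
    refine mul_nonneg (by norm_num) ?_
    rw [L2.inner_def, ← RCLike.re_eq_complex_re, ← integral_re (L2.integrable_inner _ _)]
    refine integral_nonneg_of_ae ?_
    filter_upwards [MemLp.coeFn_toLp (hcov μ).memLp'] with x hx
    rw [RCLike.inner_apply, hx, mul_comm]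
    exact re_conj_mul_fderiv_radialMul_nonneg _ (by norm_num) _ _
  rw [L2.inner_def, ← RCLike.re_eq_complex_re, ← integral_re (L2.integrable_inner _ _)] at hpos
  -- on the other hand `w = φ - u`, so the integrand is non-positive, and negative where `|u| > M`
  have hle : ∀ᵐ x, RCLike.re ⟪w x, (hF.toLp _ : L2Sp d) x⟫_ℂ ≤
      Real.smoothTransition (-M ^ 2 + 1 * ‖u x‖ ^ 2) * (‖u x‖ * (M - ‖u x‖)) := by
    filter_upwards [MemLp.coeFn_toLp hF, hφ, Lp.coeFn_add u w] with x h1 h2 h3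
    have e : w x = φ x - u x := by
      rw [← h2, h3, Pi.add_apply, add_sub_cancel_left]
    rw [h1, e, radialMul, inner_smul_right_eq_smul, RCLike.smul_re, inner_sub_left, map_sub]
    refine mul_le_mul_of_nonneg_left ?_ (Real.smoothTransition.nonneg _)
    have h4 : RCLike.re ⟪φ x, u x⟫_ℂ ≤ ‖φ x‖ * ‖u x‖ := re_inner_le_norm _ _
    have h5 : RCLike.re ⟪u x, u x⟫_ℂ = ‖u x‖ ^ 2 := inner_self_eq_norm_sq _
    rw [h5]
    nlinarith [hM x, norm_nonneg (u x)]
  have hsgn : ∀ r : ℝ, 0 ≤ r → Real.smoothTransition (-M ^ 2 + 1 * r ^ 2) * (r * (M - r)) ≤ 0 :=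
    fun r hr => by
      by_cases hrM : r ≤ M
      · rw [Real.smoothTransition.zero_of_nonpos (by nlinarith), zero_mul]
      · exact mul_nonpos_of_nonneg_of_nonpos (Real.smoothTransition.nonneg _)
          (mul_nonpos_of_nonneg_of_nonpos hr (by linarith))
  have hint := (L2.integrable_inner (𝕜 := ℂ) w (hF.toLp _ : L2Sp d)).re
  have hzero : (fun x => -RCLike.re ⟪w x, (hF.toLp _ : L2Sp d) x⟫_ℂ) =ᵐ[volume] 0 := by
    have hnn : 0 ≤ᵐ[volume] fun x => -RCLike.re ⟪w x, (hF.toLp _ : L2Sp d) x⟫_ℂ := by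
      filter_upwards [hle] with x hx
      exact neg_nonneg.2 (hx.trans (hsgn _ (norm_nonneg _)))
    refine (integral_eq_zero_iff_of_nonneg_ae hnn hint.neg).1
      (le_antisymm ?_ (integral_nonneg_of_ae hnn))
    rw [integral_neg]
    exact neg_nonpos.2 hpos
  filter_upwards [hle, hzero] with x h1 h2
  by_contra! hlt
  have h3 : 0 < Real.smoothTransition (-M ^ 2 + 1 * ‖u x‖ ^ 2) :=
    Real.smoothTransition.pos_of_pos (by nlinarith)
  have h4 : RCLike.re ⟪w x, (hF.toLp _ : L2Sp d) x⟫_ℂ = 0 := neg_eq_zero.1 h2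
  rw [h4] at h1
  have h5 : ‖u x‖ * (M - ‖u x‖) < 0 := mul_neg_of_pos_of_neg (hM0.trans_lt hlt) (by linarith)
  nlinarith [mul_neg_of_pos_of_neg h3 h5]

/-- The weak solution `u` of `(h + 1) u = φ` for a bounded right hand side, with its covariant
derivatives `g`. -/
theorem exists_bounded_weakSolution (ha : AssumptionA1 a) {φ : EucSp d → ℂ}
    (hφ : MemLp φ 2 volume) {M : ℝ} (hM0 : 0 ≤ M) (hM : ∀ x, ‖φ x‖ ≤ M) :
    ∃ (u : EucSp d → ℂ) (g : Fin d → EucSp d → ℂ), (∀ μ, IsCovDeriv a μ u (g μ)) ∧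
      MemLp u 2 volume ∧ (∀ᵐ x, ‖u x‖ ≤ M) ∧ eLpNorm u 2 volume ≤ eLpNorm φ 2 volume ∧
      (∀ μ, eLpNorm (g μ) 2 volume ≤ eLpNorm φ 2 volume) ∧
      ∀ η : EucSp d → ℂ, ContDiff ℝ ∞ η → HasCompactSupport η →
        ∫ x, starRingEnd ℂ (φ x - u x) * η x =
          (1 / 2) * ∑ μ, ∫ x, starRingEnd ℂ (g μ x) * covTest a μ η x := by
  obtain ⟨R, -, -, hR, -⟩ := exists_magneticResolvent ha
  obtain ⟨y, hy⟩ : ∃ y : L2Sp d, y = hφ.toLp φ := ⟨_, rfl⟩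
  have hyφ : y =ᵐ[volume] φ := hy ▸ MemLp.coeFn_toLp _
  have hmem : (R y, y - R y) ∈ magneticGraph a ha := (hR _ _).2 (by rw [add_sub_cancel])
  obtain ⟨g, hg, hw⟩ := (mem_magneticGraph_iff ha _ _).1 hmem
  have hen : ‖R y‖ ^ 2 + ‖g‖ ^ 2 ≤ ‖y‖ ^ 2 := by
    have e1 := congrArg Complex.re (hw _ _ hg)
    rw [show (1 / 2 : ℂ) = ((1 / 2 : ℝ) : ℂ) by norm_num, Complex.re_ofReal_mul] at e1
    have e2 : (⟪g, g⟫_ℂ).re = ‖g‖ ^ 2 := inner_self_eq_norm_sq (𝕜 := ℂ) g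
    have e3 := norm_add_sq (𝕜 := ℂ) (y - R y) (R y)
    rw [sub_add_cancel, RCLike.re_eq_complex_re, e1, e2] at e3
    nlinarith [sq_nonneg ‖y - R y‖]
  have hnorm : ∀ z : L2Sp d, ‖z‖ ≤ ‖y‖ → eLpNorm z 2 volume ≤ eLpNorm φ 2 volume := fun z hz => by
    rw [← eLpNorm_congr_ae hyφ, ← Lp.enorm_def, ← Lp.enorm_def]
    exact enorm_le_iff_norm_le.2 hz
  have hgμ : ∀ μ, ‖g μ‖ ≤ ‖y‖ := fun μ => (PiLp.norm_apply_le g μ).trans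
    (pow_le_pow_iff_left₀ (norm_nonneg _) (norm_nonneg _) two_ne_zero |>.1
      (by nlinarith [sq_nonneg ‖R y‖]))
  refine ⟨R y, fun μ => g μ, (mem_covGradGraph_iff ha _ _).1 hg, Lp.memLp _,
    norm_le_of_mem_magneticGraph ha hmem hM0 ((add_sub_cancel (R y) y).symm ▸ hyφ) hM,
    hnorm _ ?_, fun μ => hnorm _ (hgμ μ), fun η hη hc => ?_⟩
  · exact pow_le_pow_iff_left₀ (norm_nonneg _) (norm_nonneg _) two_ne_zero |>.1
      (by nlinarith [sq_nonneg ‖g‖])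
  · have hcov := fun μ => isCovDeriv_covTest ha μ hη hc
    have hηm : MemLp η 2 volume := hη.continuous.memLp_of_hasCompactSupport hc
    have e := hw (hηm.toLp η) (WithLp.toLp 2 fun μ => (hcov μ).memLp'.toLp _)
      ((mem_covGradGraph_iff ha _ _).2 fun μ => (hcov μ).congr_ae (MemLp.coeFn_toLp hηm).symm
        (MemLp.coeFn_toLp (hcov μ).memLp').symm)
    rw [L2.inner_def, PiLp.inner_apply] at e
    calc _ = ∫ x, ⟪(y - R y : L2Sp d) x, (hηm.toLp η : L2Sp d) x⟫_ℂ := by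
          refine integral_congr_ae ?_
          filter_upwards [hyφ, Lp.coeFn_sub y (R y), MemLp.coeFn_toLp hηm] with x k1 k2 k3
          rw [RCLike.inner_apply, k2, k3, Pi.sub_apply, k1, mul_comm]
      _ = _ := by
          rw [e]
          congr 1
          refine Finset.sum_congr rfl fun μ _ => ?_
          rw [L2.inner_def]
          refine integral_congr_ae ?_
          filter_upwards [MemLp.coeFn_toLp (hcov μ).memLp'] with x k1
          rw [RCLike.inner_apply, k1, mul_comm]

end Bounded

/-! ### Smooth approximate solutions for smooth vector potentials -/

section SmoothPotential

variable {d : ℕ}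

/-- A sequence of functions that tends to `0` in `L²`. -/
def NullSeq (f : ℕ → EucSp d → ℂ) : Prop :=
  (∀ n, AEStronglyMeasurable (f n)) ∧ Tendsto (fun n => eLpNorm (f n) 2) atTop (𝓝 0)

theorem NullSeq.add {f g : ℕ → EucSp d → ℂ} (hf : NullSeq f) (hg : NullSeq g) :
    NullSeq fun n x => f n x + g n x := by
  refine ⟨fun n => (hf.1 n).add (hg.1 n), ?_⟩
  have h := hf.2.add hg.2
  rw [add_zero] at h
  exact tendsto_of_tendsto_of_tendsto_of_le_of_le tendsto_const_nhds h (fun _ => zero_le)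
    fun n => eLpNorm_add_le (hf.1 n) (hg.1 n) (by norm_num)

theorem NullSeq.sum {ι : Type*} (s : Finset ι) {f : ι → ℕ → EucSp d → ℂ}
    (hf : ∀ i, NullSeq (f i)) : NullSeq fun n x => ∑ i ∈ s, f i n x := by
  classical
  induction s using Finset.induction_on with
  | empty => exact ⟨fun n => by simpa using aestronglyMeasurable_const, by simp⟩
  | insert i s hi ih =>
    simp only [Finset.sum_insert hi]
    exact (hf i).add ih

theorem NullSeq.mul {f : ℕ → EucSp d → ℂ} (hf : NullSeq f) {c : EucSp d → ℂ} (hc : Continuous c)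
    {C : ℝ} (hC : ∀ x, ‖c x‖ ≤ C) : NullSeq fun n x => c x * f n x := by
  refine ⟨fun n => hc.aestronglyMeasurable.mul (hf.1 n), ?_⟩
  have h := ENNReal.Tendsto.const_mul hf.2 (Or.inr (ENNReal.ofReal_ne_top (r := C)))
  rw [mul_zero] at h
  refine tendsto_of_tendsto_of_tendsto_of_le_of_le tendsto_const_nhds h (fun _ => zero_le)
    fun n => eLpNorm_le_mul_eLpNorm_of_ae_le_mul (ae_of_all _ fun x => ?_) 2
  rw [norm_mul]
  exact mul_le_mul_of_nonneg_right (hC x) (norm_nonneg _)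

theorem NullSeq.const_mul {f : ℕ → EucSp d → ℂ} (hf : NullSeq f) (c : ℂ) :
    NullSeq fun n x => c * f n x :=
  hf.mul continuous_const fun _ => le_rfl

theorem nullSeq_mollify_sub {f : EucSp d → ℂ} (hf : MemLp f 2 volume) :
    NullSeq fun n x => mollify n f x - f x :=
  ⟨fun n =>
    (contDiff_mollify n (hf.locallyIntegrable (by norm_num))).continuous.aestronglyMeasurable.sub
    hf.1, tendsto_eLpNorm_mollify_sub (by norm_num) (by norm_num) hf⟩

theorem memLp_continuous_mul {f c : EucSp d → ℂ} (hf : MemLp f 2 volume) (hc : Continuous c)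
    {C : ℝ} (hC : ∀ x, ‖c x‖ ≤ C) : MemLp (fun x => c x * f x) 2 volume :=
  hf.of_le_mul (c := C) (hc.aestronglyMeasurable.mul hf.1) (ae_of_all _ fun x => by
    rw [norm_mul]
    exact mul_le_mul_of_nonneg_right (hC x) (norm_nonneg _))

variable {b : EucSp d → EucSp d} {v : EucSp d → ℝ}

/-- The Laplacian of a weak solution `u` of `½ (p - b)² u + u = φ`, where `g` are the covariant
derivatives of `u`. -/
theorem hasWeakDiv_of_weakSolution (hb : ∀ μ, ContDiff ℝ ∞ fun x => (b x μ : ℂ))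
    (hv : ∀ x, (v x : ℂ) = ∑ μ, partialDeriv μ (fun y => (b y μ : ℂ)) x) {u φ : EucSp d → ℂ}
    {g G : Fin d → EucSp d → ℂ} (hu : MemLp u 2 volume) (hφ : MemLp φ 2 volume)
    (hg : ∀ μ, MemLp (g μ) 2 volume) (hG : ∀ μ, MemLp (G μ) 2 volume)
    (hw : ∀ μ, HasWeakPartial μ u (G μ))
    (hgG : ∀ μ x, g μ x = -Complex.I * G μ x - b x μ * u x)
    (h : ∀ η : EucSp d → ℂ, ContDiff ℝ ∞ η → HasCompactSupport η →
        ∫ x, starRingEnd ℂ (φ x - u x) * η x =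
          (1 / 2) * ∑ μ, ∫ x, starRingEnd ℂ (g μ x) * covTest b μ η x) :
    HasWeakDiv G fun x => 2 * u x - 2 * φ x +
      (∑ μ, (2 * Complex.I * (b x μ * G μ x) + ((b x μ ^ 2 : ℝ) : ℂ) * u x) +
        Complex.I * (v x * u x)) := by
  intro η h1 h2
  have hint : ∀ {f θ : EucSp d → ℂ}, MemLp f 2 volume → Continuous θ → HasCompactSupport θ →
      Integrable fun x => f x * θ x := fun hf hθ hc =>
    integrable_mul_of_locallyIntegrable (hf.locallyIntegrable (by norm_num)) hθ hc
  have hη' : ∀ μ, Continuous (partialDeriv μ η) := fun μ => (contDiff_partialDeriv h1).continuous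
  have hηc' : ∀ μ, HasCompactSupport (partialDeriv μ η) := fun μ =>
    hasCompactSupport_partialDeriv h2
  have hb' : ∀ μ, Continuous (partialDeriv μ fun y => (b y μ : ℂ)) := fun μ =>
    (contDiff_partialDeriv (hb μ)).continuous
  have e : ∫ x, (φ x - u x) * η x =
      (1 / 2) * ∑ μ, ∫ x, g μ x * (Complex.I * partialDeriv μ η x - b x μ * η x) := by
    have := congrArg (starRingEnd ℂ) (h _ (contDiff_star h1) (hasCompactSupport_star h2))
    simp only [map_mul, map_sum, ← integral_conj, covTest, partialDeriv_star' h1, map_sub,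
      Complex.conj_conj, map_neg, Complex.conj_I, Complex.conj_ofReal, neg_neg, map_div₀, map_one,
      map_ofNat] at this
    exact this
  set k : Fin d → EucSp d → ℂ := fun μ x => g μ x * (b x μ * η x) -
    Complex.I * ((b x μ * G μ x + partialDeriv μ (fun y => (b y μ : ℂ)) x * u x) * η x) with hk
  have m1 : ∀ μ, Integrable fun x => g μ x * ((b x μ : ℂ) * η x) := fun μ =>
    hint (hg μ) ((hb μ).continuous.mul h1.continuous) h2.mul_left
  have m2 : ∀ μ, Integrable fun x =>
      ((b x μ : ℂ) * G μ x + partialDeriv μ (fun y => (b y μ : ℂ)) x * u x) * η x := fun μ => by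
    have i1 := hint (hG μ) ((hb μ).continuous.mul h1.continuous) h2.mul_left
    have i2 := hint hu ((hb' μ).mul h1.continuous) h2.mul_left
    refine (i1.add i2).congr (ae_of_all _ fun x => ?_)
    simp only [Pi.add_apply, Pi.mul_apply]
    ring
  have m3 : ∀ μ, Integrable (k μ) := fun μ => (m1 μ).sub ((m2 μ).const_mul _)
  have m4 : ∀ μ, Integrable fun x => g μ x * (Complex.I * partialDeriv μ η x - b x μ * η x) :=
    fun μ => hint (hg μ) ((continuous_const.mul (hη' μ)).sub ((hb μ).continuous.mul h1.continuous))
      (((hηc' μ).mul_left).sub h2.mul_left)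
  -- `G_μ = i (g_μ + b_μ u)`, and the product rule for the weak derivative of `b_μ u` moves the
  -- derivative in the second term from `η` to `b_μ u`
  have key : ∀ μ, ∫ x, G μ x * partialDeriv μ η x =
      (∫ x, g μ x * (Complex.I * partialDeriv μ η x - b x μ * η x)) + ∫ x, k μ x := fun μ => by
    have hbu := HasWeakPartial.mul_smooth (hu.locallyIntegrable (by norm_num))
      ((hG μ).locallyIntegrable (by norm_num)) (hw μ) (hb μ) η h1 h2
    have i3 : Integrable fun x => (b x μ : ℂ) * u x * partialDeriv μ η x := by
      refine (hint hu ((hb μ).continuous.mul (hη' μ)) (hηc' μ).mul_left).congr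
        (ae_of_all _ fun x => ?_)
      simp only [Pi.mul_apply]
      ring
    have i4 : Integrable fun x => g μ x * (Complex.I * partialDeriv μ η x) :=
      hint (hg μ) (continuous_const.mul (hη' μ)) (hηc' μ).mul_left
    calc ∫ x, G μ x * partialDeriv μ η x
        = ∫ x, (g μ x * (Complex.I * partialDeriv μ η x) +
            Complex.I * (b x μ * u x * partialDeriv μ η x)) := by
          refine integral_congr_ae (ae_of_all _ fun x => ?_)
          simp only [hgG]
          linear_combination (G μ x * partialDeriv μ η x) * Complex.I_mul_I
      _ = _ := by
          have e5 : ∀ x, g μ x * (Complex.I * partialDeriv μ η x - b x μ * η x) =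
            g μ x * (Complex.I * partialDeriv μ η x) - g μ x * (b x μ * η x) := fun x => by ring
          rw [integral_add i4 (i3.const_mul _), integral_const_mul, hbu]
          simp only [e5, hk]
          rw [integral_sub i4 (m1 μ), integral_sub (m1 μ) ((m2 μ).const_mul _), integral_const_mul]
          ring
  have m5 : Integrable fun x => (2 * u x - 2 * φ x) * η x :=
    hint ((hu.const_mul 2).sub (hφ.const_mul 2)) h1.continuous h2
  have e6 : ∀ x, (2 * u x - 2 * φ x + (∑ μ, (2 * Complex.I * (b x μ * G μ x) +
      ((b x μ ^ 2 : ℝ) : ℂ) * u x) + Complex.I * (v x * u x))) * η x =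
      (2 * u x - 2 * φ x) * η x - ∑ μ, k μ x := fun x => by
    rw [hv, Finset.sum_mul, Finset.mul_sum, ← Finset.sum_add_distrib, add_mul, Finset.sum_mul,
      sub_eq_add_neg _ (∑ μ, k μ x), ← Finset.sum_neg_distrib]
    congr 1
    refine Finset.sum_congr rfl fun μ _ => ?_
    simp only [hk, hgG]
    push_cast
    ring
  have e7 : ∀ x, (φ x - u x) * η x = (-1 / 2) * ((2 * u x - 2 * φ x) * η x) := fun x => by ring
  simp only [key, e6]
  rw [integral_sub m5 (integrable_finsetSum _ fun μ _ => m3 μ),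
    integral_finsetSum _ fun μ _ => m3 μ, Finset.sum_add_distrib]
  simp only [e7] at e
  rw [integral_const_mul] at e
  linear_combination (-2) * e

/-- For smooth `b` there are smooth approximate solutions of `½ (p - b)² w + w = φ`, with bounds
that do not depend on `b`. They are mollifications of the weak solution. -/
theorem exists_smooth_approxSolution (hb : ∀ μ, ContDiff ℝ ∞ fun x => (b x μ : ℂ))
    (hbc : ∀ μ, HasCompactSupport fun x => (b x μ : ℂ))
    (hv : ∀ x, (v x : ℂ) = ∑ μ, partialDeriv μ (fun y => (b y μ : ℂ)) x) {φ : EucSp d → ℂ}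
    (hφ : MemLp φ 2 volume) {M : ℝ} (hM0 : 0 ≤ M) (hM : ∀ x, ‖φ x‖ ≤ M) {δ : ℝ≥0∞} (hδ : 0 < δ) :
    ∃ w : EucSp d → ℂ, ContDiff ℝ ∞ w ∧ (∀ x, ‖w x‖ ≤ M) ∧
      eLpNorm (fun x => magTest b v w x + w x - φ x) 2 volume ≤ δ ∧
      eLpNorm w 2 volume ≤ eLpNorm φ 2 volume + δ ∧
      ∀ μ, eLpNorm (covTest b μ w) 2 volume ≤ eLpNorm φ 2 volume + δ := by
  have hbm : ∀ μ, Continuous fun x => b x μ := fun μ =>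
    Complex.continuous_re.comp (hb μ).continuous
  have ha : AssumptionA1 b := fun μ K hK => by
    have := (hbm μ).memLp_of_hasCompactSupport (μ := volume) (p := 2)
      ((hbc μ).comp_left (g := Complex.re) rfl)
    exact this.restrict K
  obtain ⟨u, g, hcov, hu, huM, hu2, hg2, hweak⟩ := exists_bounded_weakSolution ha hφ hM0 hM
  choose C hC using fun μ => (hb μ).continuous.bounded_above_of_compact_support (hbc μ)
  have hvc : Continuous fun x => (v x : ℂ) := by
    simp only [hv]
    exact continuous_finsetSum _ fun μ _ => (contDiff_partialDeriv (hb μ)).continuous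
  obtain ⟨Cv, hCv⟩ : ∃ Cv, ∀ x, ‖(v x : ℂ)‖ ≤ Cv := by
    choose D hD using fun μ => (contDiff_partialDeriv (μ := μ)
      (hb μ)).continuous.bounded_above_of_compact_support (hasCompactSupport_partialDeriv (hbc μ))
    refine ⟨∑ μ, D μ, fun x => ?_⟩
    rw [hv]
    exact (norm_sum_le _ _).trans (Finset.sum_le_sum fun μ _ => hD μ x)
  -- the weak derivatives `∂_μ u` and the weak Laplacian `L` of `u` are in `L²` since `b` and its
  -- divergence are bounded
  set G : Fin d → EucSp d → ℂ := fun μ x => Complex.I * (g μ x + b x μ * u x) with hGdef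
  have hG : ∀ μ, MemLp (G μ) 2 volume := fun μ =>
    (((hcov μ).memLp').add (memLp_continuous_mul hu (hb μ).continuous (hC μ))).const_mul _
  have hsq : ∀ μ, Continuous fun x => ((b x μ ^ 2 : ℝ) : ℂ) := fun μ =>
    Complex.continuous_ofReal.comp ((hbm μ).pow 2)
  have hsqC : ∀ μ x, ‖((b x μ ^ 2 : ℝ) : ℂ)‖ ≤ C μ ^ 2 := fun μ x => by
    rw [Complex.ofReal_pow, norm_pow]
    exact pow_le_pow_left₀ (norm_nonneg _) (hC μ x) 2
  set L : EucSp d → ℂ := fun x => 2 * u x - 2 * φ x +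
      (∑ μ, (2 * Complex.I * (b x μ * G μ x) + ((b x μ ^ 2 : ℝ) : ℂ) * u x) +
        Complex.I * (v x * u x)) with hLdef
  have hL : MemLp L 2 volume := by
    have h1 : MemLp (fun x => 2 * u x - 2 * φ x) 2 volume := (hu.const_mul 2).sub (hφ.const_mul 2)
    have h2 : ∀ μ, MemLp (fun x => 2 * Complex.I * ((b x μ : ℂ) * G μ x) +
        ((b x μ ^ 2 : ℝ) : ℂ) * u x) 2 volume := fun μ =>
      ((memLp_continuous_mul (hG μ) (hb μ).continuous (hC μ)).const_mul _).add
        (memLp_continuous_mul hu (hsq μ) (hsqC μ))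
    have h3 : MemLp (fun x => Complex.I * ((v x : ℂ) * u x)) 2 volume :=
      (memLp_continuous_mul hu hvc hCv).const_mul _
    exact h1.add ((memLp_finsetSum Finset.univ fun μ _ => h2 μ).add h3)
  have hdiv : HasWeakDiv G L := hasWeakDiv_of_weakSolution hb hv hu hφ
    (fun μ => (hcov μ).memLp') hG (fun μ => (hcov μ).weak) (fun μ x => by
      simp only [hGdef]
      linear_combination (g μ x + b x μ * u x) * Complex.I_mul_I) hweak
  have hul := hu.locallyIntegrable (by norm_num)
  have hGl : ∀ μ, LocallyIntegrable (G μ) := fun μ => (hG μ).locallyIntegrable (by norm_num)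
  -- mollification commutes with the weak derivatives, so every term of the equation converges
  have hp : ∀ n μ, partialDeriv μ (mollify n u) = mollify n (G μ) := fun n μ =>
    funext fun x => partialDeriv_mollify hul (hcov μ).weak n x
  have hlap : ∀ n x, lap (mollify n u) x = mollify n L x := fun n x => by
    simp only [lap, hp]
    exact sum_partialDeriv_mollify hGl hdiv n x
  have nu := nullSeq_mollify_sub hu
  have nG := fun μ => nullSeq_mollify_sub (hG μ)
  have nL := nullSeq_mollify_sub hL
  have n1 : NullSeq fun n x => magTest b v (mollify n u) x + mollify n u x - φ x := by
    have n2 := (((nL.const_mul (-1)).add ((NullSeq.sum Finset.univ fun μ =>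
      ((((nG μ).mul (hb μ).continuous (hC μ)).const_mul (2 * Complex.I)).add
        (nu.mul (hsq μ) (hsqC μ)))).add ((nu.mul hvc hCv).const_mul Complex.I))).const_mul
          (1 / 2)).add nu
    convert n2 using 3 with n x
    simp only [magTest, hlap, hp]
    have e : ∑ μ, (2 * Complex.I * ((b x μ : ℂ) * (mollify n (G μ) x - G μ x)) +
        ((b x μ ^ 2 : ℝ) : ℂ) * (mollify n u x - u x)) =
        ∑ μ, (2 * Complex.I * ((b x μ : ℂ) * mollify n (G μ) x) +
          ((b x μ ^ 2 : ℝ) : ℂ) * mollify n u x) -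
        ∑ μ, (2 * Complex.I * ((b x μ : ℂ) * G μ x) + ((b x μ ^ 2 : ℝ) : ℂ) * u x) := by
      rw [← Finset.sum_sub_distrib]
      exact Finset.sum_congr rfl fun μ _ => by ring
    rw [e]
    simp only [hLdef]
    ring
  have n3 : ∀ μ, NullSeq fun n x => covTest b μ (mollify n u) x - g μ x := fun μ => by
    have n4 := ((nG μ).const_mul (-Complex.I)).add
      ((nu.mul (hb μ).continuous (hC μ)).const_mul (-1))
    convert n4 using 3 with n x
    simp only [covTest, hp, hGdef]
    linear_combination -(g μ x + b x μ * u x) * Complex.I_mul_I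
  have ev := ((n1.2.eventually (Iic_mem_nhds hδ)).and (nu.2.eventually (Iic_mem_nhds hδ))).and
    (eventually_all.2 fun μ => (n3 μ).2.eventually (Iic_mem_nhds hδ))
  obtain ⟨n, ⟨k1, k2⟩, k3⟩ := ev.exists
  have hadd : ∀ {f f' : EucSp d → ℂ}, AEStronglyMeasurable (fun x => f x - f' x) →
      AEStronglyMeasurable f' → eLpNorm (fun x => f x - f' x) 2 volume ≤ δ →
      eLpNorm f' 2 volume ≤ eLpNorm φ 2 volume →
      eLpNorm f 2 volume ≤ eLpNorm φ 2 volume + δ := fun {f f'} h1 h2 h3 h4 => by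
    have h5 := eLpNorm_add_le (p := 2) (μ := volume) h2 h1 (by norm_num)
    have h6 : (f' + fun x => f x - f' x) = f := by
      ext x
      simp
    rw [h6] at h5
    exact h5.trans (add_le_add h4 h3)
  exact ⟨mollify n u, contDiff_mollify n hul, fun x => norm_mollify_le huM x, k1,
    hadd (nu.1 n) hu.1 k2 hu2, fun μ => hadd ((n3 μ).1 n) (hcov μ).memLp'.1 (k3 μ) (hg2 μ)⟩

end SmoothPotential

/-! ### A local `L⁴` bound for the gradient of approximate solutions -/

section GradientBound

variable {d : ℕ} {b : EucSp d → EucSp d} {v : EucSp d → ℝ}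

theorem partialDeriv_fun_mul {μ : Fin d} {ζ w : EucSp d → ℂ} (hζ : ContDiff ℝ ∞ ζ)
    (hw : ContDiff ℝ ∞ w) : partialDeriv μ (fun x => ζ x * w x) =
      fun x => ζ x * partialDeriv μ w x + partialDeriv μ ζ x * w x :=
  funext fun x => partialDeriv_mul (hζ.differentiable (by simp) x) (hw.differentiable (by simp) x)

theorem lap_mul {ζ w : EucSp d → ℂ} (hζ : ContDiff ℝ ∞ ζ) (hw : ContDiff ℝ ∞ w) (x : EucSp d) :
    lap (fun x => ζ x * w x) x =
      ζ x * lap w x + 2 * (∑ μ, partialDeriv μ ζ x * partialDeriv μ w x) + lap ζ x * w x := by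
  simp only [lap, Finset.mul_sum, Finset.sum_mul, ← Finset.sum_add_distrib]
  refine Finset.sum_congr rfl fun μ _ => ?_
  have hζ' : ContDiff ℝ ∞ (partialDeriv μ ζ) := contDiff_partialDeriv hζ
  have hw' : ContDiff ℝ ∞ (partialDeriv μ w) := contDiff_partialDeriv hw
  rw [partialDeriv_fun_mul hζ hw, partialDeriv_add ((hζ.mul hw').differentiable (by simp) x)
    ((hζ'.mul hw).differentiable (by simp) x), partialDeriv_fun_mul hζ hw',
    partialDeriv_fun_mul hζ' hw]
  ring

/-- The commutator with a cutoff function involves only covariant derivatives. -/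
theorem magTest_mul {ζ w : EucSp d → ℂ} (hζ : ContDiff ℝ ∞ ζ) (hw : ContDiff ℝ ∞ w)
    (x : EucSp d) : magTest b v (fun x => ζ x * w x) x = ζ x * magTest b v w x -
      (1 / 2) * (lap ζ x * w x) - ∑ μ, Complex.I * (partialDeriv μ ζ x * covTest b μ w x) := by
  have e : ∑ μ, Complex.I * (partialDeriv μ ζ x * covTest b μ w x) =
      ∑ μ, partialDeriv μ ζ x * partialDeriv μ w x -
        ∑ μ, Complex.I * (b x μ * (partialDeriv μ ζ x * w x)) := by
    rw [← Finset.sum_sub_distrib]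
    refine Finset.sum_congr rfl fun μ _ => ?_
    simp only [covTest]
    linear_combination (-(partialDeriv μ ζ x * partialDeriv μ w x)) * Complex.I_mul_I
  have e2 : ∑ μ, (2 * Complex.I * (b x μ * (ζ x * partialDeriv μ w x + partialDeriv μ ζ x * w x)) +
      ((b x μ ^ 2 : ℝ) : ℂ) * (ζ x * w x)) =
      ζ x * ∑ μ, (2 * Complex.I * (b x μ * partialDeriv μ w x) + ((b x μ ^ 2 : ℝ) : ℂ) * w x) +
      2 * ∑ μ, Complex.I * (b x μ * (partialDeriv μ ζ x * w x)) := by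
    rw [Finset.mul_sum, Finset.mul_sum, ← Finset.sum_add_distrib]
    exact Finset.sum_congr rfl fun μ _ => by ring
  simp only [magTest, lap_mul hζ hw, partialDeriv_fun_mul hζ hw]
  rw [e, e2]
  ring

theorem lap_eq_magTest (z : EucSp d → ℂ) (x : EucSp d) : lap z x = -2 * magTest b v z x +
    ((∑ μ, (2 * Complex.I * (b x μ * partialDeriv μ z x) + ((b x μ ^ 2 : ℝ) : ℂ) * z x)) +
      Complex.I * (v x * z x)) := by
  simp only [magTest]
  ring

/-- Absorption: a quadratic inequality bounds its solutions. -/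
theorem sum_le_of_sq_le {y : Fin d → ℝ} {p q : ℝ} (hp : 0 ≤ p) (hq : 0 ≤ q)
    (h : ∀ μ, y μ ^ 2 ≤ p + q * ∑ ν, y ν) : ∑ ν, y ν ≤ 1 + d ^ 2 * (p + q) := by
  by_contra! hlt
  have h1 : (∑ ν, y ν) ^ 2 ≤ d * ∑ ν, y ν ^ 2 := by
    simpa using sq_sum_le_card_mul_sum_sq (s := Finset.univ) (f := y)
  have h2 : ∑ ν, y ν ^ 2 ≤ d * (p + q * ∑ ν, y ν) := by
    have := Finset.sum_le_card_nsmul Finset.univ _ _ fun ν _ => h ν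
    rwa [Finset.card_univ, Fintype.card_fin, nsmul_eq_mul] at this
  have hd : (0 : ℝ) ≤ d := Nat.cast_nonneg d
  have h3 : (∑ ν, y ν) ^ 2 ≤ d ^ 2 * (p + q * ∑ ν, y ν) := by
    refine h1.trans ((mul_le_mul_of_nonneg_left h2 hd).trans_eq ?_)
    ring
  set s := ∑ ν, y ν with hs
  have h4 : 1 < s := by nlinarith [mul_nonneg (sq_nonneg (d : ℝ)) (add_nonneg hp hq)]
  have h5 : (1 + d ^ 2 * (p + q)) * s < s * s := mul_lt_mul_of_pos_right hlt (by linarith)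
  have h6 : (d : ℝ) ^ 2 * p ≤ d ^ 2 * p * s := le_mul_of_one_le_right (by positivity) h4.le
  nlinarith

theorem eLpNorm_mul_le_four {ν : Measure (EucSp d)} {f g : EucSp d → ℂ}
    (hf : AEStronglyMeasurable f ν) (hg : AEStronglyMeasurable g ν) :
    eLpNorm (fun x => f x * g x) 2 ν ≤ eLpNorm f 4 ν * eLpNorm g 4 ν := by
  have h4 := holderTriple_four
  have h : eLpNorm (f • g) 2 ν ≤ eLpNorm f 4 ν * eLpNorm g 4 ν :=
    eLpNorm_smul_le_mul_eLpNorm (f := g) (φ := f) (hpqr := h4) hg hf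
  rw [smul_eq_mul] at h
  exact h

theorem eLpNorm_mul_le_of_norm_le {ν : Measure (EucSp d)} {p : ℝ≥0∞} {f g : EucSp d → ℂ}
    {C : NNReal} (hf : ∀ x, ‖f x‖ ≤ C) :
    eLpNorm (fun x => f x * g x) p ν ≤ C * eLpNorm g p ν :=
  eLpNorm_le_nnreal_smul_eLpNorm_of_ae_le_mul (ae_of_all _ fun x => by
    rw [nnnorm_mul]
    exact mul_le_mul_of_nonneg_right (hf x) (zero_le)) p

theorem eLpNorm_mul_le_of_norm_le' {ν : Measure (EucSp d)} {p : ℝ≥0∞} {f g : EucSp d → ℂ}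
    {C : NNReal} (hg : ∀ x, ‖g x‖ ≤ C) :
    eLpNorm (fun x => f x * g x) p ν ≤ C * eLpNorm f p ν := by
  simpa only [mul_comm] using eLpNorm_mul_le_of_norm_le hg (g := f) (ν := ν) (p := p)

theorem eLpNorm_const_mul_le {ν : Measure (EucSp d)} {p : ℝ≥0∞} (f : EucSp d → ℂ) (c : ℂ)
    (C : NNReal) (hc : ‖c‖ ≤ C) : eLpNorm (fun x => c * f x) p ν ≤ C * eLpNorm f p ν :=
  eLpNorm_mul_le_of_norm_le fun _ => hc

theorem eLpNorm_fun_add_le {ν : Measure (EucSp d)} {f g : EucSp d → ℂ}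
    (hf : AEStronglyMeasurable f ν) (hg : AEStronglyMeasurable g ν) :
    eLpNorm (fun x => f x + g x) 2 ν ≤ eLpNorm f 2 ν + eLpNorm g 2 ν :=
  eLpNorm_add_le hf hg (by norm_num)

theorem eLpNorm_fun_sum_le {ν : Measure (EucSp d)} {f : Fin d → EucSp d → ℂ}
    (hf : ∀ μ, AEStronglyMeasurable (f μ) ν) :
    eLpNorm (fun x => ∑ μ, f μ x) 2 ν ≤ ∑ μ, eLpNorm (f μ) 2 ν := by
  have h := eLpNorm_sum_le (s := Finset.univ) (f := f) (fun μ _ => hf μ) (p := 2) (by norm_num)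
  have e : ∑ μ, f μ = fun x => ∑ μ, f μ x := funext fun x => Finset.sum_apply _ _ _
  rwa [e] at h

/-- The terms of lower order in the magnetic operator are controlled by the `L⁴` norm of the
gradient and by the supremum norm. -/
theorem eLpNorm_lowerOrder_le {ν : Measure (EucSp d)} {c γ : Fin d → EucSp d → ℂ}
    {κ z : EucSp d → ℂ} (hc : ∀ μ, AEStronglyMeasurable (c μ) ν)
    (hγ : ∀ μ, AEStronglyMeasurable (γ μ) ν) (hκ : AEStronglyMeasurable κ ν)
    (hz : ContDiff ℝ ∞ z) {M : NNReal} (hM : ∀ x, ‖z x‖ ≤ M) :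
    eLpNorm (fun x => (∑ μ, (2 * Complex.I * (c μ x * partialDeriv μ z x) + γ μ x * z x)) +
      Complex.I * (κ x * z x)) 2 ν ≤
    (∑ μ, (2 * (eLpNorm (c μ) 4 ν * eLpNorm (partialDeriv μ z) 4 ν) + M * eLpNorm (γ μ) 2 ν)) +
      M * eLpNorm κ 2 ν := by
  have hzm : AEStronglyMeasurable z ν := hz.continuous.aestronglyMeasurable
  have hz' : ∀ μ, AEStronglyMeasurable (partialDeriv μ z) ν := fun μ =>
    (contDiff_partialDeriv hz).continuous.aestronglyMeasurable
  have m1 : ∀ μ, AEStronglyMeasurable (fun x => 2 * Complex.I * (c μ x * partialDeriv μ z x)) ν :=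
    fun μ => ((hc μ).mul (hz' μ)).const_mul _
  have m2 : ∀ μ, AEStronglyMeasurable (fun x => γ μ x * z x) ν := fun μ => (hγ μ).mul hzm
  have m3 : AEStronglyMeasurable (fun x => Complex.I * (κ x * z x)) ν := (hκ.mul hzm).const_mul _
  have m4 : ∀ μ, AEStronglyMeasurable
      (fun x => 2 * Complex.I * (c μ x * partialDeriv μ z x) + γ μ x * z x) ν :=
    fun μ => (m1 μ).add (m2 μ)
  refine (eLpNorm_fun_add_le (Finset.aestronglyMeasurable_fun_sum _ fun μ _ => m4 μ) m3).trans
    (add_le_add ((eLpNorm_fun_sum_le m4).trans (Finset.sum_le_sum fun μ _ => ?_)) ?_)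
  · refine (eLpNorm_fun_add_le (m1 μ) (m2 μ)).trans
      (add_le_add ?_ (eLpNorm_mul_le_of_norm_le' hM))
    refine (eLpNorm_const_mul_le _ _ 2 (by simp)).trans ?_
    exact mul_le_mul_right (eLpNorm_mul_le_four (hc μ) (hz' μ)) _
  · refine (eLpNorm_const_mul_le _ _ 1 (by simp)).trans ?_
    rw [ENNReal.coe_one, one_mul]
    exact eLpNorm_mul_le_of_norm_le' hM

/-- The commutator of the magnetic operator with a cutoff function is small if the derivatives of
the cutoff function are. -/
theorem eLpNorm_commutator_le {ν : Measure (EucSp d)} {ζ w : EucSp d → ℂ} (hζ : ContDiff ℝ ∞ ζ)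
    (hw : ContDiff ℝ ∞ w) (hb : ∀ μ, AEStronglyMeasurable (fun x => (b x μ : ℂ)) ν) {C A : NNReal}
    (h1 : ∀ μ x, ‖partialDeriv μ ζ x‖ ≤ C) (h2 : ∀ x, ‖lap ζ x‖ ≤ C)
    (hwA : eLpNorm w 2 ν ≤ A) (hcov : ∀ μ, eLpNorm (covTest b μ w) 2 ν ≤ A) :
    eLpNorm (fun x => (-1 / 2) * (lap ζ x * w x) +
      ∑ μ, -Complex.I * (partialDeriv μ ζ x * covTest b μ w x)) 2 ν ≤ (d + 1) * (C * A) := by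
  have hwm : AEStronglyMeasurable w ν := hw.continuous.aestronglyMeasurable
  have hcm : ∀ μ, AEStronglyMeasurable (covTest b μ w) ν := fun μ =>
    ((contDiff_partialDeriv hw).continuous.aestronglyMeasurable.const_mul _).sub ((hb μ).mul hwm)
  have m1 : AEStronglyMeasurable (fun x => (-1 / 2) * (lap ζ x * w x)) ν :=
    ((contDiff_lap hζ).continuous.aestronglyMeasurable.mul hwm).const_mul _
  have m2 : ∀ μ, AEStronglyMeasurable
      (fun x => -Complex.I * (partialDeriv μ ζ x * covTest b μ w x)) ν := fun μ =>
    ((contDiff_partialDeriv hζ).continuous.aestronglyMeasurable.mul (hcm μ)).const_mul _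
  refine (eLpNorm_fun_add_le m1 (Finset.aestronglyMeasurable_fun_sum _ fun μ _ => m2 μ)).trans ?_
  have k1 : eLpNorm (fun x => (-1 / 2) * (lap ζ x * w x)) 2 ν ≤ C * A := by
    refine (eLpNorm_const_mul_le _ _ 1 (by norm_num)).trans ?_
    rw [ENNReal.coe_one, one_mul]
    exact (eLpNorm_mul_le_of_norm_le h2).trans (mul_le_mul_right hwA _)
  have k2 : ∀ μ, eLpNorm (fun x => -Complex.I * (partialDeriv μ ζ x * covTest b μ w x)) 2 ν ≤
      C * A := fun μ => by
    refine (eLpNorm_const_mul_le _ _ 1 (by simp)).trans ?_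
    rw [ENNReal.coe_one, one_mul]
    exact (eLpNorm_mul_le_of_norm_le (h1 μ)).trans (mul_le_mul_right (hcov μ) _)
  refine (add_le_add k1 ((eLpNorm_fun_sum_le m2).trans
    (Finset.sum_le_sum fun μ _ => k2 μ))).trans_eq
    ?_
  rw [Finset.sum_const, Finset.card_univ, Fintype.card_fin, nsmul_eq_mul]
  ring

theorem continuous_lowerOrder (hb : ∀ μ, Continuous fun x => (b x μ : ℂ))
    (hv : Continuous fun x => (v x : ℂ)) {z : EucSp d → ℂ} (hz : ContDiff ℝ ∞ z) :
    Continuous fun x => (∑ μ, (2 * Complex.I * (b x μ * partialDeriv μ z x) +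
        ((b x μ ^ 2 : ℝ) : ℂ) * z x)) + Complex.I * (v x * z x) := by
  simp only [Complex.ofReal_pow]
  exact (continuous_finsetSum _ fun μ _ => (continuous_const.mul ((hb μ).mul
    (contDiff_partialDeriv hz).continuous)).add (((hb μ).pow 2).mul hz.continuous)).add
      (continuous_const.mul (hv.mul hz.continuous))

theorem continuous_magTest (hb : ∀ μ, Continuous fun x => (b x μ : ℂ))
    (hv : Continuous fun x => (v x : ℂ)) {z : EucSp d → ℂ} (hz : ContDiff ℝ ∞ z) :
    Continuous (magTest b v z) := by
  have h := (continuous_const (y := (1 / 2 : ℂ))).mul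
    ((contDiff_lap hz).continuous.neg.add (continuous_lowerOrder hb hv hz))
  refine h.congr fun x => ?_
  simp only [magTest, add_assoc, Pi.mul_apply, Pi.add_apply, Pi.neg_apply]

theorem continuous_commutator (hb : ∀ μ, Continuous fun x => (b x μ : ℂ)) {ζ w : EucSp d → ℂ}
    (hζ : ContDiff ℝ ∞ ζ) (hw : ContDiff ℝ ∞ w) :
    Continuous fun x => (-1 / 2) * (lap ζ x * w x) +
        ∑ μ, -Complex.I * (partialDeriv μ ζ x * covTest b μ w x) :=
  (continuous_const.mul ((contDiff_lap hζ).continuous.mul hw.continuous)).add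
    (continuous_finsetSum _ fun μ _ => continuous_const.mul
      ((contDiff_partialDeriv hζ).continuous.mul
      ((continuous_const.mul (contDiff_partialDeriv hw).continuous).sub
        ((hb μ).mul hw.continuous))))

theorem tsupport_partialDeriv_subset (μ : Fin d) (z : EucSp d → ℂ) :
    tsupport (partialDeriv μ z) ⊆ tsupport z :=
  closure_minimal (fun x hx => support_fderiv_subset ℝ fun h => hx (by
    simp only [partialDeriv, h, zero_apply])) (isClosed_tsupport z)

theorem support_lap_subset (z : EucSp d → ℂ) : Function.support (lap z) ⊆ tsupport z :=
  fun x hx => by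
    obtain ⟨μ, -, hμ⟩ := Finset.exists_ne_zero_of_sum_ne_zero hx
    exact tsupport_partialDeriv_subset μ z (tsupport_partialDeriv_subset μ _ (subset_tsupport _ hμ))

/-- Let `½ (p - b)² w + w = F` and let `ζ` be a cutoff function. The `L⁴` norm of the gradient of
`ζ w` has a bound that depends on `b` only via norms of `b` in `L⁴` and of its divergence `v` in
`L²` on the support of `ζ`: by Hölder's inequality `‖Δ(ζ w)‖₂` grows at most linearly with that
norm, which by the Gagliardo–Nirenberg inequality is at most of the order of
`‖Δ(ζ w)‖₂ ^ (1 / 2)`. -/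
theorem exists_gradient_bound {ζ : EucSp d → ℂ} (hζ : ContDiff ℝ ∞ ζ) (hζc : HasCompactSupport ζ)
    (hζ1 : ∀ x, ‖ζ x‖ ≤ 1) (M A B : NNReal) : ∃ C : NNReal, ∀ (b : EucSp d → EucSp d)
    (v : EucSp d → ℝ) (w : EucSp d → ℂ), (∀ μ, Continuous fun x => (b x μ : ℂ)) →
    Continuous (fun x => (v x : ℂ)) → ContDiff ℝ ∞ w → (∀ x, ‖w x‖ ≤ M) →
    eLpNorm (fun x => magTest b v w x + w x) 2 volume ≤ A → eLpNorm w 2 volume ≤ A →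
    (∀ μ, eLpNorm (covTest b μ w) 2 volume ≤ A) →
    (∀ μ, eLpNorm (fun x => (b x μ : ℂ)) 4 (volume.restrict (tsupport ζ)) ≤ B) →
    eLpNorm (fun x => (v x : ℂ)) 2 (volume.restrict (tsupport ζ)) ≤ B →
    ∀ μ, eLpNorm (partialDeriv μ fun x => ζ x * w x) 4 volume ≤ C := by
  choose D hD using fun μ => (contDiff_partialDeriv (μ := μ)
    hζ).continuous.bounded_above_of_compact_support (hasCompactSupport_partialDeriv hζc)
  obtain ⟨D', hD'⟩ := (contDiff_lap hζ).continuous.bounded_above_of_compact_support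
    (hasCompactSupport_lap hζc)
  obtain ⟨K, hK1, hK2⟩ : ∃ K : NNReal, (∀ μ x, ‖partialDeriv μ ζ x‖ ≤ K) ∧
      ∀ x, ‖lap ζ x‖ ≤ K := by
    refine ⟨∑ μ, (D μ).toNNReal + D'.toNNReal, fun μ x => ?_, fun x => ?_⟩
    · refine (hD μ x).trans ((Real.le_coe_toNNReal _).trans (NNReal.coe_le_coe.2 ?_))
      exact (Finset.single_le_sum (f := fun μ => (D μ).toNNReal) (fun _ _ => zero_le)
        (Finset.mem_univ μ)).trans (le_add_of_nonneg_right zero_le)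
    · exact (hD' x).trans ((Real.le_coe_toNNReal _).trans
        (NNReal.coe_le_coe.2 (le_add_of_nonneg_left zero_le)))
  set c : NNReal := 2 * ((A + A) + (d + 1) * (K * A)) + (d * (M * (B * B)) + M * B) with hc
  refine ⟨1 + d ^ 2 * (3 * M * c + 3 * M * (2 * B)),
    fun b v w hb hv hw hM hF hwA hcov hbB hvB => ?_⟩
  set ν := volume.restrict (tsupport ζ) with hν
  set z : EucSp d → ℂ := fun x => ζ x * w x with hzdef
  have hz : ContDiff ℝ ∞ z := hζ.mul hw
  have hzc : HasCompactSupport z := hζc.mul_right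
  have hzM : ∀ x, ‖z x‖ ≤ M := fun x => by
    rw [hzdef, norm_mul]
    exact (mul_le_of_le_one_left (norm_nonneg _) (hζ1 x)).trans (hM x)
  have hle : ∀ (f : EucSp d → ℂ) (p : ℝ≥0∞), eLpNorm f p ν ≤ eLpNorm f p volume := fun f p =>
    eLpNorm_mono_measure f Measure.restrict_le_self
  have hwc := hw.continuous
  have hFc : Continuous fun x => magTest b v w x + w x := (continuous_magTest hb hv hw).add hwc
  have hbm : ∀ μ, AEStronglyMeasurable (fun x => (b x μ : ℂ)) ν := fun μ =>
    (hb μ).aestronglyMeasurable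
  have hsm : ∀ μ, AEStronglyMeasurable (fun x => ((b x μ ^ 2 : ℝ) : ℂ)) ν := fun μ => by
    simp only [Complex.ofReal_pow]
    exact ((hb μ).pow 2).aestronglyMeasurable
  have hsq : ∀ μ, eLpNorm (fun x => ((b x μ ^ 2 : ℝ) : ℂ)) 2 ν ≤ B * B := fun μ => by
    simp only [pow_two, Complex.ofReal_mul]
    exact (eLpNorm_mul_le_four (hbm μ) (hbm μ)).trans (mul_le_mul' (hbB μ) (hbB μ))
  have hfin : ∀ μ, eLpNorm (partialDeriv μ z) 4 volume ≠ ⊤ := fun μ =>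
    ((contDiff_partialDeriv hz).continuous.memLp_of_hasCompactSupport (p := 4) (μ := volume)
      (hasCompactSupport_partialDeriv hzc)).eLpNorm_ne_top
  -- the numbers `‖∂_μ z‖₄` are finite because `z` is a test function, so that
  -- absorption is possible
  set y : Fin d → NNReal := fun μ => (eLpNorm (partialDeriv μ z) 4 volume).toNNReal with hydef
  have hy : ∀ μ, eLpNorm (partialDeriv μ z) 4 volume = y μ := fun μ =>
    (ENNReal.coe_toNNReal (hfin μ)).symm
  have hX : eLpNorm (lap z) 2 volume ≤ (c + 2 * B * ∑ μ, y μ : NNReal) := by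
    have hsub : Function.support (lap z) ⊆ tsupport ζ :=
      (support_lap_subset z).trans (closure_mono (Function.support_mul_subset_left ζ w))
    rw [← eLpNorm_restrict_eq_of_support_subset hsub, ← hν]
    -- `½ (p - b)² z` is `ζ (F - w)` plus the commutator, and the remaining terms are those of lower
    -- order in the magnetic operator
    have e1 : ∀ x, lap z x = -2 * (ζ x * ((magTest b v w x + w x) + (-1) * w x) +
        ((-1 / 2) * (lap ζ x * w x) +
          ∑ μ, -Complex.I * (partialDeriv μ ζ x * covTest b μ w x))) +
        ((∑ μ, (2 * Complex.I * (b x μ * partialDeriv μ z x) + ((b x μ ^ 2 : ℝ) : ℂ) * z x)) +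
          Complex.I * (v x * z x)) := fun x => by
      rw [lap_eq_magTest (b := b) (v := v) z x, hzdef, magTest_mul hζ hw]
      simp only [neg_mul, Finset.sum_neg_distrib]
      ring
    have m1 : Continuous fun x => ζ x * ((magTest b v w x + w x) + (-1) * w x) :=
      hζ.continuous.mul (hFc.add (continuous_const.mul hwc))
    have m2 := continuous_commutator hb hζ hw
    have m3 := continuous_lowerOrder hb hv hz
    have k1 : eLpNorm (fun x => ζ x * ((magTest b v w x + w x) + (-1) * w x)) 2 ν ≤ A + A := by
      refine (eLpNorm_mul_le_of_norm_le (C := 1) hζ1).trans ?_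
      rw [ENNReal.coe_one, one_mul]
      refine (eLpNorm_fun_add_le hFc.aestronglyMeasurable
        (continuous_const.mul hwc).aestronglyMeasurable).trans
        (add_le_add ((hle _ _).trans hF) ((eLpNorm_const_mul_le _ _ 1 (by simp)).trans ?_))
      rw [ENNReal.coe_one, one_mul]
      exact (hle _ _).trans hwA
    have k2 := eLpNorm_commutator_le hζ hw hbm hK1 hK2 ((hle _ _).trans hwA)
      fun μ => (hle _ _).trans (hcov μ)
    have k3 := eLpNorm_lowerOrder_le hbm hsm (hv.aestronglyMeasurable (μ := ν)) hz hzM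
    have k4 : ∀ μ, 2 * (eLpNorm (fun x => (b x μ : ℂ)) 4 ν * eLpNorm (partialDeriv μ z) 4 ν) +
        M * eLpNorm (fun x => ((b x μ ^ 2 : ℝ) : ℂ)) 2 ν ≤
        ((2 * B * y μ + M * (B * B) : NNReal) : ℝ≥0∞) := fun μ => by
      refine (add_le_add (mul_le_mul_right (mul_le_mul' (hbB μ) ((hle _ _).trans_eq (hy μ))) 2)
        (mul_le_mul_right (hsq μ) _)).trans_eq ?_
      push_cast
      ring
    have m4 : Continuous fun x => -2 * (ζ x * ((magTest b v w x + w x) + (-1) * w x) +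
        ((-1 / 2) * (lap ζ x * w x) +
          ∑ μ, -Complex.I * (partialDeriv μ ζ x * covTest b μ w x))) :=
      continuous_const.mul (m1.add m2)
    have k5 : eLpNorm (fun x => -2 * (ζ x * ((magTest b v w x + w x) + (-1) * w x) +
        ((-1 / 2) * (lap ζ x * w x) +
          ∑ μ, -Complex.I * (partialDeriv μ ζ x * covTest b μ w x)))) 2 ν ≤
        (2 : NNReal) * ((A + A) + (d + 1) * (K * A)) :=
      (eLpNorm_const_mul_le _ _ 2 (by simp)).trans (mul_le_mul_right ((eLpNorm_fun_add_le
        m1.aestronglyMeasurable m2.aestronglyMeasurable).trans (add_le_add k1 k2)) _)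
    calc eLpNorm (lap z) 2 ν = _ := by rw [funext e1]
      _ ≤ _ := eLpNorm_fun_add_le m4.aestronglyMeasurable m3.aestronglyMeasurable
      _ ≤ (2 : NNReal) * ((A + A) + (d + 1) * (K * A)) +
          ((∑ μ, ((2 * B * y μ + M * (B * B) : NNReal) : ℝ≥0∞)) + M * B) :=
          add_le_add k5 (k3.trans (add_le_add (Finset.sum_le_sum fun μ _ => k4 μ)
              (mul_le_mul_right hvB _)))
      _ = _ := by
          rw [← ENNReal.ofNNReal_finsetSum, Finset.sum_add_distrib, Finset.sum_const,
            ← Finset.mul_sum,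
            Finset.card_univ, Fintype.card_fin, nsmul_eq_mul, hc]
          push_cast
          ring
  -- the Gagliardo–Nirenberg inequality turns the linear bound on `Δ z` into a quadratic inequality
  have hsqy : ∀ μ, (y μ : ℝ) ^ 2 ≤ 3 * M * c + 3 * M * (2 * B) * ∑ ν, (y ν : ℝ) := fun μ => by
    have h1 := eLpNorm_partialDeriv_four_sq_le hz hzc hzM μ
    have h2 : (y μ : ℝ≥0∞) ^ 2 ≤ ((3 * M * (c + 2 * B * ∑ μ, y μ) : NNReal) : ℝ≥0∞) := by
      rw [← hy]
      refine h1.trans ?_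
      rw [ENNReal.coe_mul]
      refine mul_le_mul' (le_of_eq ?_) ((eLpNorm_partialDeriv_partialDeriv_le hz hzc μ).trans hX)
      rw [← ENNReal.ofReal_coe_nnreal]
      push_cast
      rfl
    have h3 : y μ ^ 2 ≤ 3 * M * (c + 2 * B * ∑ μ, y μ) := by exact_mod_cast h2
    have h4 : ((y μ ^ 2 : NNReal) : ℝ) ≤ ((3 * M * (c + 2 * B * ∑ μ, y μ) : NNReal) : ℝ) :=
      NNReal.coe_le_coe.2 h3
    push_cast at h4
    linarith
  have hsum := sum_le_of_sq_le (y := fun μ => (y μ : ℝ)) (p := 3 * M * c) (q := 3 * M * (2 * B))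
    (by positivity) (by positivity) hsqy
  intro μ
  rw [hy]
  refine ENNReal.coe_le_coe.2 (NNReal.coe_le_coe.1 ?_)
  refine (Finset.single_le_sum (f := fun μ => (y μ : ℝ)) (fun _ _ => NNReal.coe_nonneg _)
    (Finset.mem_univ μ)).trans (hsum.trans_eq ?_)
  push_cast
  rfl

end GradientBound

/-! ### The range of the magnetic operator on test functions -/

section Range

variable {d : ℕ} {a : EucSp d → EucSp d}

theorem mollify_ofReal (n : ℕ) (f : EucSp d → ℝ) (x : EucSp d) :
    mollify n (fun y => (f y : ℂ)) x = ((mollify n f x : ℝ) : ℂ) := by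
  simp only [mollify_apply, Complex.real_smul, ← Complex.ofReal_mul, smul_eq_mul]
  exact integral_ofReal

/-- Approximation of the vector potential and of its divergence on a compact set by smooth ones. -/
theorem exists_smooth_potential (ha : AssumptionA1 a) (h4 : ∀ μ, MemLpLocal (fun x => a x μ) 4)
    {v : EucSp d → ℝ} (hv : MemLpLocal v 2) (h : IsWeakDivergence a v) {K : Set (EucSp d)}
    (hK : IsCompact K) {t : ℝ≥0∞} (ht : 0 < t) :
    ∃ (b : EucSp d → EucSp d) (v' : EucSp d → ℝ), (∀ μ, ContDiff ℝ ∞ fun x => (b x μ : ℂ)) ∧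
      (∀ μ, HasCompactSupport fun x => (b x μ : ℂ)) ∧
      (∀ x, (v' x : ℂ) = ∑ μ, partialDeriv μ (fun y => (b y μ : ℂ)) x) ∧
      (∀ μ, eLpNorm (fun x => (b x μ : ℂ) - a x μ) 4 (volume.restrict K) ≤ t) ∧
      eLpNorm (fun x => (v' x : ℂ) - v x) 2 (volume.restrict K) ≤ t := by
  obtain ⟨r, hr⟩ := hK.isBounded.exists_norm_le
  obtain ⟨m, hm⟩ := exists_nat_gt r
  have hloc : ∀ μ, LocallyIntegrable fun x => (a x μ : ℂ) := fun μ =>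
    (ha μ).locallyIntegrable_ofReal
  have l1 : ∀ μ, Tendsto (fun n => eLpNorm (mollify n (fun x => (a x μ : ℂ)) -
      fun x => (a x μ : ℂ)) 4 (volume.restrict K)) atTop (𝓝 0) := fun μ =>
    tendsto_eLpNorm_mollify_sub_restrict (by norm_num) (by norm_num)
      (fun K hK => (h4 μ K hK).ofReal) hK
  have l2 : Tendsto (fun n => eLpNorm (mollify n (fun x => (v x : ℂ)) -
      fun x => (v x : ℂ)) 2 (volume.restrict K)) atTop (𝓝 0) :=
    tendsto_eLpNorm_mollify_sub_restrict (by norm_num) (by norm_num)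
      (fun K hK => (hv K hK).ofReal) hK
  obtain ⟨n, n1, n2⟩ := ((eventually_all.2 fun μ => (l1 μ).eventually (Iic_mem_nhds ht)).and
    (l2.eventually (Iic_mem_nhds ht))).exists
  obtain ⟨b, hbdef⟩ : ∃ b : EucSp d → EucSp d, ∀ x μ,
      (b x μ : ℂ) = cutoff d m x * mollify n (fun y => (a y μ : ℂ)) x :=
    ⟨fun x => WithLp.toLp 2 fun μ => cutoffBump d ((1 / ((m : ℝ) + 1)) • x) *
      mollify n (fun y => a y μ) x, fun x μ => by
        rw [mollify_ofReal, cutoff, ← Complex.ofReal_mul]⟩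
  have hb : ∀ μ, ContDiff ℝ ∞ fun x => (b x μ : ℂ) := fun μ => by
    simp only [hbdef]
    exact (contDiff_cutoff m).mul (contDiff_mollify n (hloc μ))
  have hbr : ∀ μ, ContDiff ℝ ∞ fun x => b x μ := fun μ => Complex.reCLM.contDiff.comp (hb μ)
  have hKm : ∀ x ∈ K, ‖x‖ < (m : ℝ) + 1 := fun x hx => by linarith [hr x hx]
  have hbK : ∀ x ∈ K, ∀ μ, (fun y => (b y μ : ℂ)) =ᶠ[𝓝 x] mollify n fun y => (a y μ : ℂ) :=
    fun x hx μ => by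
      filter_upwards [(isOpen_lt continuous_norm continuous_const).mem_nhds (hKm x hx)] with y hy
      rw [hbdef, cutoff_eq_one (le_of_lt hy), one_mul]
  have hv' : ∀ x, ((∑ μ, partialDeriv μ (fun y => b y μ) x : ℝ) : ℂ) =
      ∑ μ, partialDeriv μ (fun y => (b y μ : ℂ)) x := fun x => by
    rw [Complex.ofReal_sum]
    exact Finset.sum_congr rfl fun μ _ =>
      (partialDeriv_clm_comp Complex.ofRealCLM ((hbr μ).differentiable (by simp) x)).symm
  refine ⟨b, fun x => ∑ μ, partialDeriv μ (fun y => b y μ) x, hb, fun μ => ?_, hv', fun μ => ?_, ?_⟩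
  · simp only [hbdef]
    exact (hasCompactSupport_cutoff m).mul_right
  · refine (eLpNorm_congr_ae ?_).trans_le (n1 μ)
    filter_upwards [ae_restrict_mem hK.measurableSet] with x hx
    rw [(hbK x hx μ).eq_of_nhds, Pi.sub_apply]
  · refine (eLpNorm_congr_ae ?_).trans_le n2
    filter_upwards [ae_restrict_mem hK.measurableSet] with x hx
    rw [hv', Pi.sub_apply, ← sum_partialDeriv_mollify hloc (h.hasWeakDiv ha hv) n x]
    congr 1
    refine Finset.sum_congr rfl fun μ _ => ?_
    simp only [partialDeriv]
    rw [(hbK x hx μ).fderiv_eq]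

theorem eLpNorm_sq_sub_sq_le {ν : Measure (EucSp d)} {f g : EucSp d → ℂ} {B t : NNReal}
    (hf : AEStronglyMeasurable f ν) (hg : AEStronglyMeasurable g ν)
    (hfB : eLpNorm f 4 ν ≤ B) (hgB : eLpNorm g 4 ν ≤ B)
    (hfg : eLpNorm (fun x => f x - g x) 4 ν ≤ t) :
    eLpNorm (fun x => f x ^ 2 - g x ^ 2) 2 ν ≤ t * (B + B) := by
  have e : ∀ x, f x ^ 2 - g x ^ 2 = (f x - g x) * (f x + g x) := fun x => by ring
  simp only [e]
  exact (eLpNorm_mul_le_four (hf.sub hg) (hf.add hg)).trans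
    (mul_le_mul' hfg ((eLpNorm_add_le hf hg (by norm_num)).trans (add_le_add hfB hgB)))

theorem exists_cutoff_of_small {κ : NNReal} (hκ : 0 < κ) {φ : EucSp d → ℂ}
    (hφ : HasCompactSupport φ) : ∃ ζ : EucSp d → ℂ, ContDiff ℝ ∞ ζ ∧ HasCompactSupport ζ ∧
      (∀ x, ‖ζ x‖ ≤ 1) ∧ (∀ μ x, ‖partialDeriv μ ζ x‖ ≤ κ) ∧ (∀ x, ‖lap ζ x‖ ≤ κ) ∧
      ∀ x, ζ x * φ x = φ x := by
  obtain ⟨C, hC0, hC⟩ := exists_partialDeriv_cutoff_le d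
  obtain ⟨ρ, hρ⟩ := hφ.isCompact.isBounded.exists_norm_le
  have hlim : Tendsto (fun n : ℕ => (1 + d) * (C * (1 / ((n : ℝ) + 1)))) atTop
      (𝓝 ((1 + d) * (C * 0))) := (tendsto_inv_nat_succ.const_mul C).const_mul _
  rw [mul_zero, mul_zero] at hlim
  obtain ⟨n, h1, h2⟩ := ((hlim.eventually (Iic_mem_nhds (NNReal.coe_pos.2 hκ))).and
    (eventually_ge_atTop ⌈ρ⌉₊)).exists
  have h0 : 0 ≤ C * (1 / ((n : ℝ) + 1)) := by positivity
  have hd : (0 : ℝ) ≤ d := Nat.cast_nonneg d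
  replace h1 : (1 + d) * (C * (1 / ((n : ℝ) + 1))) ≤ κ := h1
  refine ⟨cutoff d n, contDiff_cutoff n, hasCompactSupport_cutoff n, norm_cutoff_le n,
    fun μ x => (hC n μ x).1.trans (by nlinarith), fun x => ?_, fun x => ?_⟩
  · refine (norm_sum_le _ _).trans ((Finset.sum_le_sum fun μ _ => (hC n μ x).2).trans ?_)
    rw [Finset.sum_const, Finset.card_univ, Fintype.card_fin, nsmul_eq_mul]
    nlinarith
  · by_cases hx : φ x = 0
    · rw [hx, mul_zero]
    · have h3 : ‖x‖ ≤ ρ := hρ x (subset_tsupport _ hx)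
      have h4 : ((⌈ρ⌉₊ : ℕ) : ℝ) ≤ n := by exact_mod_cast h2
      rw [cutoff_eq_one (by linarith [Nat.le_ceil ρ]), one_mul]

/-- Functions `(½ (p - a)² + 1) s` with a test function `s` come arbitrarily close in `L²` to any
test function `φ`. Here `s = ζ w`, where `w` is an approximate solution for a smooth vector
potential `b` near `a`, and `ζ` is a cutoff function with small derivatives. The error from the
replacement of `a` by `b` is small since the gradient of `s` is bounded in `L⁴` uniformly in `b`. -/
theorem exists_test_approxSolution (ha : AssumptionA1 a)
    (h4 : ∀ μ, MemLpLocal (fun x => a x μ) 4) {v : EucSp d → ℝ} (hv : MemLpLocal v 2)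
    (h : IsWeakDivergence a v) {φ : EucSp d → ℂ} (hφ : ContDiff ℝ ∞ φ) (hφc : HasCompactSupport φ)
    {ε : NNReal} (hε : 0 < ε) : ∃ s : EucSp d → ℂ, ContDiff ℝ ∞ s ∧ HasCompactSupport s ∧
      eLpNorm (fun x => magTest a v s x + s x - φ x) 2 volume ≤ 3 * ε := by
  have hφ2 : MemLp φ 2 volume := hφ.continuous.memLp_of_hasCompactSupport hφc
  obtain ⟨M', hM'⟩ := hφ.continuous.bounded_above_of_compact_support hφc
  obtain ⟨M, hM⟩ : ∃ M : NNReal, ∀ x, ‖φ x‖ ≤ M :=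
    ⟨M'.toNNReal, fun x => (hM' x).trans (Real.le_coe_toNNReal _)⟩
  obtain ⟨A, hA⟩ : ∃ A : NNReal, (A : ℝ≥0∞) = eLpNorm φ 2 volume + ε := by
    refine ⟨(eLpNorm φ 2 volume + ε).toNNReal, ENNReal.coe_toNNReal ?_⟩
    exact ENNReal.add_ne_top.2 ⟨hφ2.eLpNorm_ne_top, ENNReal.coe_ne_top⟩
  have hA0 : 0 < A := by
    have : (0 : ℝ≥0∞) < A := by
      rw [hA]
      exact (ENNReal.coe_pos.2 hε).trans_le (le_add_of_nonneg_left zero_le)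
    exact ENNReal.coe_pos.1 this
  -- this bound on the derivatives of `ζ` makes the commutator at most `ε`
  have hκ : 0 < ε / ((d + 1) * A) := by positivity
  obtain ⟨ζ, hζ, hζc, hζ1, hζ2, hζ3, hζφ⟩ := exists_cutoff_of_small hκ hφc
  set ν := volume.restrict (tsupport ζ) with hν
  have ha4 : ∀ μ, MemLp (fun x => (a x μ : ℂ)) 4 ν := fun μ => (h4 μ _ hζc.isCompact).ofReal
  have hv2 : MemLp (fun x => (v x : ℂ)) 2 ν := (hv _ hζc.isCompact).ofReal
  obtain ⟨B, hB1, hB2⟩ : ∃ B : NNReal, (∀ μ, eLpNorm (fun x => (a x μ : ℂ)) 4 ν + 1 ≤ B) ∧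
      eLpNorm (fun x => (v x : ℂ)) 2 ν + 1 ≤ B := by
    have e1 : ∀ μ, ((eLpNorm (fun x => (a x μ : ℂ)) 4 ν).toNNReal : ℝ≥0∞) =
        eLpNorm (fun x => (a x μ : ℂ)) 4 ν := fun μ => ENNReal.coe_toNNReal (ha4 μ).eLpNorm_ne_top
    have e2 : ((eLpNorm (fun x => (v x : ℂ)) 2 ν).toNNReal : ℝ≥0∞) =
        eLpNorm (fun x => (v x : ℂ)) 2 ν := ENNReal.coe_toNNReal hv2.eLpNorm_ne_top
    refine ⟨(∑ μ, (eLpNorm (fun x => (a x μ : ℂ)) 4 ν).toNNReal +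
      (eLpNorm (fun x => (v x : ℂ)) 2 ν).toNNReal) + 1, fun μ => ?_, ?_⟩
    · rw [← e1, ENNReal.coe_add, ENNReal.coe_one]
      refine add_le_add (ENNReal.coe_le_coe.2 ?_) le_rfl
      exact (Finset.single_le_sum (f := fun μ => (eLpNorm (fun x => (a x μ : ℂ)) 4 ν).toNNReal)
        (fun _ _ => zero_le) (Finset.mem_univ μ)).trans (le_add_of_nonneg_right zero_le)
    · rw [← e2, ENNReal.coe_add, ENNReal.coe_one]
      exact add_le_add (ENNReal.coe_le_coe.2 (le_add_of_nonneg_left zero_le)) le_rfl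
  -- the bound `Y` does not depend on `b`, so the distance `t` of `b` to `a` may be
  -- chosen in terms of `Y`
  obtain ⟨Y, hY⟩ := exists_gradient_bound hζ hζc hζ1 M A B
  obtain ⟨t, ht0, ht1, ht2⟩ : ∃ t : NNReal, 0 < t ∧ t ≤ 1 ∧
      t * (d * (2 * Y + M * (B + B)) + M) ≤ ε := by
    refine ⟨min 1 (ε / (d * (2 * Y + M * (B + B)) + M + 1)), by positivity, min_le_left _ _, ?_⟩
    calc _ ≤ ε / (d * (2 * Y + M * (B + B)) + M + 1) * (d * (2 * Y + M * (B + B)) + M + 1) :=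
          mul_le_mul' (min_le_right _ _) (le_add_of_nonneg_right zero_le)
      _ = ε := div_mul_cancel₀ _ (by positivity)
  obtain ⟨b, v', hb, hbc, hv', hba, hvv⟩ := exists_smooth_potential ha h4 hv h hζc.isCompact
    (ENNReal.coe_pos.2 ht0)
  rw [← hν] at hba hvv
  have hbcont := fun μ => (hb μ).continuous
  have hvcont : Continuous fun x => (v' x : ℂ) := by
    simp only [hv']
    exact continuous_finsetSum _ fun μ _ => (contDiff_partialDeriv (hb μ)).continuous
  have hbm : ∀ μ, AEStronglyMeasurable (fun x => (b x μ : ℂ)) ν := fun μ =>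
    (hbcont μ).aestronglyMeasurable
  have hvm : AEStronglyMeasurable (fun x => (v' x : ℂ)) ν := hvcont.aestronglyMeasurable
  obtain ⟨w, hw, hwM, hweq, hw2, hwcov⟩ := exists_smooth_approxSolution hb hbc hv' hφ2
    M.coe_nonneg hM (ENNReal.coe_pos.2 hε)
  have ht1' : (t : ℝ≥0∞) ≤ 1 := by exact_mod_cast ht1
  have htri : ∀ {p : ℝ≥0∞} (f g : EucSp d → ℂ), 1 ≤ p → AEStronglyMeasurable f ν →
      AEStronglyMeasurable g ν → eLpNorm (fun x => f x - g x) p ν ≤ t →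
      eLpNorm f p ν ≤ eLpNorm g p ν + 1 := fun {p} f g hp hf hg hfg => by
    have h5 := eLpNorm_add_le hg (hf.sub hg) hp
    calc eLpNorm f p ν = eLpNorm (g + (f - g)) p ν := by rw [add_sub_cancel]
      _ ≤ _ := h5.trans (add_le_add le_rfl (hfg.trans ht1'))
  have hbB : ∀ μ, eLpNorm (fun x => (b x μ : ℂ)) 4 ν ≤ B := fun μ =>
    (htri _ _ (by norm_num) (hbm μ) (ha4 μ).1 (hba μ)).trans (hB1 μ)
  have hvB : eLpNorm (fun x => (v' x : ℂ)) 2 ν ≤ B :=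
    (htri _ _ (by norm_num) hvm hv2.1 hvv).trans hB2
  have haB : ∀ μ, eLpNorm (fun x => (a x μ : ℂ)) 4 ν ≤ B := fun μ =>
    le_self_add.trans (hB1 μ)
  have hmcont : Continuous fun x => magTest b v' w x + w x - φ x :=
    ((continuous_magTest hbcont hvcont hw).add hw.continuous).sub hφ.continuous
  have hF : eLpNorm (fun x => magTest b v' w x + w x) 2 volume ≤ A := by
    have e : (fun x => magTest b v' w x + w x) =
        fun x => φ x + (magTest b v' w x + w x - φ x) := by
      ext x
      ring
    rw [e, hA]
    exact (eLpNorm_fun_add_le hφ2.1 hmcont.aestronglyMeasurable).trans (add_le_add le_rfl hweq)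
  have hYw := hY b v' w hbcont hvcont hw hwM hF (hw2.trans_eq hA.symm)
    (fun μ => (hwcov μ).trans_eq hA.symm) hbB hvB
  obtain ⟨s, hs⟩ : ∃ s : EucSp d → ℂ, s = fun x => ζ x * w x := ⟨_, rfl⟩
  rw [← hs] at hYw
  have hss : ContDiff ℝ ∞ s := hs ▸ hζ.mul hw
  have hsc : HasCompactSupport s := hs ▸ hζc.mul_right
  have hsM : ∀ x, ‖s x‖ ≤ M := fun x => by
    rw [hs, norm_mul]
    exact (mul_le_of_le_one_left (norm_nonneg _) (hζ1 x)).trans (hwM x)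
  refine ⟨s, hss, hsc, ?_⟩
  have ham : ∀ μ, AEStronglyMeasurable (fun x => (a x μ : ℂ)) := ha.aestronglyMeasurable
  have hvam : AEStronglyMeasurable (fun x => (v x : ℂ)) :=
    hv.locallyIntegrable_ofReal.aestronglyMeasurable
  have m1 : Continuous fun x => ζ x * (magTest b v' w x + w x - φ x) := hζ.continuous.mul hmcont
  have m2 := continuous_commutator hbcont hζ hw
  have c1 : ∀ μ, AEStronglyMeasurable (fun x => (b x μ : ℂ) - a x μ) := fun μ =>
    (hbcont μ).aestronglyMeasurable.sub (ham μ)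
  have c2 : ∀ μ, AEStronglyMeasurable (fun x => (b x μ : ℂ) ^ 2 - (a x μ : ℂ) ^ 2) := fun μ =>
    ((hbcont μ).aestronglyMeasurable.pow 2).sub ((ham μ).pow 2)
  have c3 : AEStronglyMeasurable (fun x => (v' x : ℂ) - v x) :=
    hvcont.aestronglyMeasurable.sub hvam
  have hsm : AEStronglyMeasurable s := hss.continuous.aestronglyMeasurable
  have hsm' : ∀ μ, AEStronglyMeasurable (partialDeriv μ s) := fun μ =>
    (contDiff_partialDeriv hss).continuous.aestronglyMeasurable
  -- `-½ E` is the error from the replacement of `a` by `b` in the operator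
  set E : EucSp d → ℂ := fun x => (∑ μ, (2 * Complex.I * (((b x μ : ℂ) - a x μ) *
    partialDeriv μ s x) + ((b x μ : ℂ) ^ 2 - (a x μ : ℂ) ^ 2) * s x)) +
      Complex.I * (((v' x : ℂ) - v x) * s x) with hE
  have m3 : AEStronglyMeasurable E :=
    (Finset.aestronglyMeasurable_fun_sum _ fun μ _ => ((((c1 μ).mul (hsm' μ)).const_mul _).add
      ((c2 μ).mul hsm))).add ((c3.mul hsm).const_mul _)
  have e1 : (fun x => magTest a v s x + s x - φ x) = fun x =>
      (ζ x * (magTest b v' w x + w x - φ x) + ((-1 / 2) * (lap ζ x * w x) +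
        ∑ μ, -Complex.I * (partialDeriv μ ζ x * covTest b μ w x))) + (-1 / 2) * E x := by
    ext x
    have k1 : magTest a v s x = magTest b v' s x + (-1 / 2) * E x := by
      simp only [magTest, hE]
      have : ∑ μ, (2 * Complex.I * (((b x μ : ℂ) - a x μ) * partialDeriv μ s x) +
          ((b x μ : ℂ) ^ 2 - (a x μ : ℂ) ^ 2) * s x) =
          ∑ μ, (2 * Complex.I * (b x μ * partialDeriv μ s x) + ((b x μ ^ 2 : ℝ) : ℂ) * s x) -
          ∑ μ, (2 * Complex.I * (a x μ * partialDeriv μ s x) + ((a x μ ^ 2 : ℝ) : ℂ) * s x) := by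
        rw [← Finset.sum_sub_distrib]
        refine Finset.sum_congr rfl fun μ _ => ?_
        push_cast
        ring
      rw [this]
      ring
    rw [k1, hs, magTest_mul hζ hw]
    simp only [neg_mul, Finset.sum_neg_distrib]
    linear_combination hζφ x
  have hEν : eLpNorm E 2 volume ≤ ε := by
    have hts : tsupport s ⊆ tsupport ζ := by
      rw [hs]
      exact closure_mono (Function.support_mul_subset_left ζ w)
    have hsub : Function.support E ⊆ tsupport ζ := fun x hx => by
      by_contra hxζ
      have z1 : s x = 0 := image_eq_zero_of_notMem_tsupport fun hx' => hxζ (hts hx')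
      have z2 : ∀ μ, partialDeriv μ s x = 0 := fun μ =>
        image_eq_zero_of_notMem_tsupport fun hx' =>
          hxζ (hts (tsupport_partialDeriv_subset μ s hx'))
      exact hx (by simp [hE, z1, z2])
    rw [← eLpNorm_restrict_eq_of_support_subset hsub, ← hν]
    refine (eLpNorm_lowerOrder_le (fun μ => (c1 μ).restrict) (fun μ => (c2 μ).restrict)
      c3.restrict hss hsM).trans ?_
    have k1 : ∀ μ, 2 * (eLpNorm (fun x => (b x μ : ℂ) - a x μ) 4 ν *
        eLpNorm (partialDeriv μ s) 4 ν) +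
        M * eLpNorm (fun x => (b x μ : ℂ) ^ 2 - (a x μ : ℂ) ^ 2) 2 ν ≤
        ((2 * (t * Y) + M * (t * (B + B)) : NNReal) : ℝ≥0∞) := fun μ => by
      have k2 := eLpNorm_sq_sub_sq_le (hbm μ) (ha4 μ).1 (hbB μ) (haB μ) (hba μ)
      have k3 : eLpNorm (partialDeriv μ s) 4 ν ≤ Y :=
        (eLpNorm_mono_measure _ Measure.restrict_le_self).trans (hYw μ)
      refine (add_le_add (mul_le_mul_right (mul_le_mul' (hba μ) k3) 2)
        (mul_le_mul_right k2 _)).trans_eq ?_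
      push_cast
      ring
    refine (add_le_add (Finset.sum_le_sum fun μ _ => k1 μ) (mul_le_mul_right hvv _)).trans ?_
    rw [← ENNReal.ofNNReal_finsetSum, ← ENNReal.coe_mul, ← ENNReal.coe_add]
    refine ENNReal.coe_le_coe.2 (le_of_eq_of_le ?_ ht2)
    rw [Finset.sum_const, Finset.card_univ, Fintype.card_fin, nsmul_eq_mul]
    ring
  have p1 : eLpNorm (fun x => ζ x * (magTest b v' w x + w x - φ x)) 2 volume ≤ ε := by
    refine (eLpNorm_mul_le_of_norm_le (C := 1) hζ1).trans ?_
    rw [ENNReal.coe_one, one_mul]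
    exact hweq
  have p2 : eLpNorm (fun x => (-1 / 2) * (lap ζ x * w x) +
      ∑ μ, -Complex.I * (partialDeriv μ ζ x * covTest b μ w x)) 2 volume ≤ ε := by
    refine (eLpNorm_commutator_le hζ hw (fun μ => (hbcont μ).aestronglyMeasurable) hζ2 hζ3
      (hw2.trans_eq hA.symm) fun μ => (hwcov μ).trans_eq hA.symm).trans_eq ?_
    have : ((d + 1) * (ε / ((d + 1) * A) * A) : NNReal) = ε := by field_simp
    exact_mod_cast congrArg (fun r : NNReal => (r : ℝ≥0∞)) this
  have p3 : eLpNorm (fun x => (-1 / 2) * E x) 2 volume ≤ ε := by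
    refine (eLpNorm_const_mul_le _ _ 1 (by norm_num)).trans ?_
    rw [ENNReal.coe_one, one_mul]
    exact hEν
  rw [e1]
  refine (eLpNorm_fun_add_le (m1.add m2).aestronglyMeasurable (m3.const_mul _)).trans
    ((add_le_add ((eLpNorm_fun_add_le m1.aestronglyMeasurable m2.aestronglyMeasurable).trans
      (add_le_add p1 p2)) p3).trans_eq ?_)
  ring

end Range

/-! ### Test functions form an operator core of the magnetic operator -/

section OperatorCore

variable {d : ℕ} {a : EucSp d → EucSp d}

/-- `C₀^∞` is an operator core of `½ (p - a)²` under (A3): it lies in the domain, and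
`½ (p - a)² + 1` maps it onto a dense subspace. -/
theorem magneticSchrodinger_hasCore (ha : AssumptionA1 a) (h3 : AssumptionA3 a) :
    (magneticSchrodinger a ha).HasCore (testSubspace d) := by
  obtain ⟨h4, v, hdiv, hv⟩ := h3
  obtain ⟨R, -, -, hR, -⟩ := exists_magneticResolvent ha
  rw [LinearPMap.hasCore_iff (magneticSchrodinger_isClosed ha)]
  have hgr : ∀ (s : EucSp d → ℂ) (hs : ContDiff ℝ ∞ s) (hc : HasCompactSupport s),
      ((hs.continuous.memLp_of_hasCompactSupport hc : MemLp s 2 volume).toLp s,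
        (memLp_magTest ha h4 hv hs hc).toLp (magTest a v s)) ∈ (magneticSchrodinger a ha).graph :=
    fun s hs hc => (mem_magneticSchrodinger_graph_iff ha _).2
      (mem_magneticGraph_magTest ha h4 hv hdiv hs hc)
  constructor
  · rintro f ⟨s, hs, hc, h⟩
    have e : f = (hs.continuous.memLp_of_hasCompactSupport hc : MemLp s 2 volume).toLp s :=
      Lp.ext (h.trans (MemLp.coeFn_toLp _).symm)
    rw [e]
    exact LinearPMap.mem_domain_of_mem_graph (hgr s hs hc)
  · rintro ⟨x, w⟩ hxw ε hε
    have hRx : R (x + w) = x := (hR x w).1 ((mem_magneticSchrodinger_graph_iff ha _).1 hxw)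
    obtain ⟨δ, hδ, hδε⟩ : ∃ δ : ℝ, 0 < δ ∧ (‖R‖ + 1) * (4 * δ) < ε := by
      refine ⟨ε / (8 * (‖R‖ + 1)), by positivity, ?_⟩
      have : (‖R‖ + 1) * (4 * (ε / (8 * (‖R‖ + 1)))) = ε / 2 := by
        field_simp
        norm_num
      rw [this]
      linarith
    obtain ⟨y, hy, φ, hφ, hφc, hyφ⟩ := Metric.dense_iff.1 dense_testSubspace (x + w) δ hδ
    rw [Metric.mem_ball, dist_eq_norm] at hy
    obtain ⟨s, hs, hc, hsφ⟩ := exists_test_approxSolution ha h4 hv hdiv hφ hφc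
      (Real.toNNReal_pos.2 hδ)
    obtain ⟨S, hS⟩ : ∃ S : L2Sp d, S =
      (hs.continuous.memLp_of_hasCompactSupport hc : MemLp s 2 volume).toLp s := ⟨_, rfl⟩
    obtain ⟨W, hW⟩ : ∃ W : L2Sp d, W = (memLp_magTest ha h4 hv hs hc).toLp (magTest a v s) :=
      ⟨_, rfl⟩
    have hSW := hgr s hs hc
    rw [← hS, ← hW] at hSW
    have h1 : ‖S + W - y‖ ≤ 3 * δ := by
      rw [Lp.norm_def]
      refine ENNReal.toReal_le_of_le_ofReal (by positivity) ?_
      rw [ENNReal.ofReal_mul (by norm_num), ENNReal.ofReal_ofNat]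
      refine (eLpNorm_congr_ae ?_).trans_le hsφ
      have k1 : S =ᵐ[volume] s := hS ▸ MemLp.coeFn_toLp _
      have k2 : W =ᵐ[volume] magTest a v s := hW ▸ MemLp.coeFn_toLp _
      filter_upwards [Lp.coeFn_sub (S + W) y, Lp.coeFn_add S W, k1, k2, hyφ] with t t1 t2 t3 t4 t5
      rw [t1, Pi.sub_apply, t2, Pi.add_apply, t3, t4, t5, add_comm]
    have h2 : ‖S + W - (x + w)‖ ≤ 4 * δ := by
      calc ‖S + W - (x + w)‖ = ‖(S + W - y) + (y - (x + w))‖ := by rw [sub_add_sub_cancel]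
        _ ≤ 3 * δ + δ := (norm_add_le _ _).trans (add_le_add h1 hy.le)
        _ = 4 * δ := by ring
    have hRS : R (S + W) = S := (hR S W).1 ((mem_magneticSchrodinger_graph_iff ha _).1 hSW)
    have h5 : ‖S - x‖ ≤ ‖R‖ * (4 * δ) := by
      calc ‖S - x‖ = ‖R (S + W - (x + w))‖ := by rw [map_sub, hRS, hRx]
        _ ≤ _ := (R.le_opNorm _).trans (mul_le_mul_of_nonneg_left h2 (norm_nonneg _))
    refine ⟨(S, W), hSW, hS ▸ mem_testSubspace_toLp hs hc
      (hs.continuous.memLp_of_hasCompactSupport hc), ?_, ?_⟩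
    · change ‖S - x‖ < ε
      nlinarith
    · calc ‖W - w‖ = ‖(S + W - (x + w)) - (S - x)‖ := by congr 1; abel
        _ ≤ 4 * δ + ‖R‖ * (4 * δ) := (norm_sub_le _ _).trans (add_le_add h2 h5)
        _ < ε := by linarith

end OperatorCore

end

theorem mainTheorem7 (d : ℕ) (hd : 1 ≤ d) (a : EucSp d → EucSp d) (ha : AssumptionA1 a)
    (Ψ : ℝ → ℝ) (hΨ : IsBernsteinZero Ψ) :
    (AssumptionA3 a →
      (bernsteinCalculus Ψ (magneticSchrodinger a ha)).HasCore (testSubspace d)) ∧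
    IsFormCore (bernsteinCalculus Ψ (magneticSchrodinger a ha)) (testSubspace d) := by
  exact ⟨fun h3 => bernsteinCalculus_hasCore ha hΨ (magneticSchrodinger_hasCore ha h3),
    bernsteinCalculus_isFormCore ha hΨ⟩
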